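/- Let $d\ge 2$, $I=[0,1]$, and let $\bar f\in H^5(I,\mathbb R^d)$ be a regular curve, i.e. $\partial_x\bar f(x)\neq 0$ for every $x\in I$. For a curve $f$ write $\partial_{s_f}=\frac{1}{|\partial_x f|}\partial_x$, $\nabla_{s_f}\phi=\partial_{s_f}\phi-\langle\partial_{s_f}\phi,\partial_{s_f}f\rangle\,\partial_{s_f}f$, $\vec\kappa_f=\partial_{s_f}^2 f$, and let $\mathcal E(f)=\frac12\int_I|\vec\kappa_f|^2\,|\partial_x f|\,dx$ be the elastic energy. Put $$H^{4,\perp}_c=\{\phi\in H^4(I,\mathbb R^d)\cap H^2_0(I,\mathbb R^d):\ \langle\phi,\partial_x\bar f\rangle=0 \text{ on } I\}\ \text{(with the $H^4$ norm)},\qquad L^{2,\perp}=\{\phi\in L^2(I,\mathbb R^d):\ \langle\phi,\partial_x\bar f\rangle=0\text{ a.e. on } I\}.$$ Then there is $\rho>0$ such that $\bar f+\phi$ is a regular curve for all $\phi$ in the ball $U=B_\rho(0)\subset H^{4,\perp}_c$. For every such $\rho$, the energy $E:U\to\mathbb R$, $E(\phi)=\mathcal E(\bar f+\phi)$, is Fréchet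 differentiable and has an $L^2(dx)$-gradient $dE:U\to L^{2,\perp}$, i.e. $E'(\phi)\eta=\langle dE(\phi),\eta\rangle_{L^2(dx)}$ for all $\phi\in U$, $\eta\in H^{4,\perp}_c$. For any such gradient, $dE$ is Fréchet differentiable at $0$, and its derivative $$\mathfrak L=(dE)'(0):H^{4,\perp}_c\to L^{2,\perp}$$ is a Fredholm operator of index $0$. Moreover $\mathfrak L\phi=|\partial_x\bar f|\,\nabla_{s_{\bar f}}^4\phi+B\phi$ for all $\phi\in H^{4,\perp}_c$, where $\phi\mapsto|\partial_x\bar f|\,\nabla_{s_{\bar f}}^4\phi$ is a bounded operator and $B$ is a compact operator from $H^{4,\perp}_c$ to $L^{2,\perp}$. -/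

import Mathlib

open MeasureTheory Set Filter Topology
open scoped ContDiff

noncomputable section

namespace ElasticCurve

/-- Lebesgue measure on the interval `I = [0,1]`. -/
abbrev muI : Measure ℝ := volume.restrict (Icc (0 : ℝ) 1)

/-- The Hilbert space `L²(I, ℝᵈ)`, with respect to Lebesgue measure `dx`. -/
abbrev L2 (d : ℕ) : Type := Lp (EuclideanSpace ℝ (Fin d)) 2 muI

/-- `φ` belongs to `C_c^∞((0,1), V)`. -/
def IsTestFunction {V : Type*} [NormedAddCommGroup V] [NormedSpace ℝ V] (φ : ℝ → V) : Prop :=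
  ContDiff ℝ ∞ φ ∧ HasCompactSupport φ ∧ tsupport φ ⊆ Ioo (0 : ℝ) 1

/-! ### Weak derivatives on `I` -/

section WeakDerivative

variable {d : ℕ}

/-- `v` is a weak derivative of `u` on `(0,1)`; both are integrable on `I`, and only their
values almost everywhere on `I` matter. -/
def HasWeakDeriv (u v : ℝ → EuclideanSpace ℝ (Fin d)) : Prop :=
  Integrable u muI ∧ Integrable v muI ∧
    ∀ φ : ℝ → ℝ, IsTestFunction φ → ∫ x, deriv φ x • u x ∂muI = - ∫ x, φ x • v x ∂muI

theorem HasWeakDeriv.congr {u v u' v' : ℝ → EuclideanSpace ℝ (Fin d)} (h : HasWeakDeriv u v)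
    (hu : u =ᵐ[muI] u') (hv : v =ᵐ[muI] v') : HasWeakDeriv u' v' := by
  refine ⟨h.1.congr hu, h.2.1.congr hv, fun φ hφ => ?_⟩
  have h1 : ∫ x, deriv φ x • u' x ∂muI = ∫ x, deriv φ x • u x ∂muI :=
    integral_congr_ae (by filter_upwards [hu] with x hx; rw [hx])
  have h2 : ∫ x, φ x • v' x ∂muI = ∫ x, φ x • v x ∂muI :=
    integral_congr_ae (by filter_upwards [hv] with x hx; rw [hx])
  rw [h1, h2, h.2.2 φ hφ]

theorem IsTestFunction.integrable_smul {φ : ℝ → ℝ} (hφ : IsTestFunction φ)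
    {u : ℝ → EuclideanSpace ℝ (Fin d)} (hu : Integrable u muI) :
    Integrable (fun x => φ x • u x) muI := by
  obtain ⟨C, hC⟩ := hφ.2.1.exists_bound_of_continuous hφ.1.continuous
  exact hu.bdd_smul C hφ.1.continuous.aestronglyMeasurable (Eventually.of_forall hC)

theorem IsTestFunction.integrable_deriv_smul {φ : ℝ → ℝ} (hφ : IsTestFunction φ)
    {u : ℝ → EuclideanSpace ℝ (Fin d)} (hu : Integrable u muI) :
    Integrable (fun x => deriv φ x • u x) muI := by
  have hc : Continuous (deriv φ) := hφ.1.continuous_deriv (by simp)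
  obtain ⟨C, hC⟩ := hφ.2.1.deriv.exists_bound_of_continuous hc
  exact hu.bdd_smul C hc.aestronglyMeasurable (Eventually.of_forall hC)

theorem HasWeakDeriv.zero : HasWeakDeriv (0 : ℝ → EuclideanSpace ℝ (Fin d)) 0 :=
  ⟨integrable_zero _ _ _, integrable_zero _ _ _, fun φ _ => by simp⟩

theorem HasWeakDeriv.add {u v u' v' : ℝ → EuclideanSpace ℝ (Fin d)} (h : HasWeakDeriv u v)
    (h' : HasWeakDeriv u' v') : HasWeakDeriv (u + u') (v + v') := by
  refine ⟨h.1.add h'.1, h.2.1.add h'.2.1, fun φ hφ => ?_⟩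
  simp only [Pi.add_apply, smul_add]
  rw [integral_add (hφ.integrable_deriv_smul h.1) (hφ.integrable_deriv_smul h'.1),
    integral_add (hφ.integrable_smul h.2.1) (hφ.integrable_smul h'.2.1),
    h.2.2 φ hφ, h'.2.2 φ hφ, neg_add]

theorem HasWeakDeriv.smul {u v : ℝ → EuclideanSpace ℝ (Fin d)} (c : ℝ) (h : HasWeakDeriv u v) :
    HasWeakDeriv (c • u) (c • v) := by
  refine ⟨h.1.smul c, h.2.1.smul c, fun φ hφ => ?_⟩
  simp only [Pi.smul_apply, smul_comm _ c]
  rw [integral_smul, integral_smul, h.2.2 φ hφ, smul_neg]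

/-- Weak derivatives are unique almost everywhere on `I`. -/
theorem HasWeakDeriv.unique {u v v' : ℝ → EuclideanSpace ℝ (Fin d)} (h : HasWeakDeriv u v)
    (h' : HasWeakDeriv u v') : v =ᵐ[muI] v' := by
  have hz : HasWeakDeriv 0 (v - v') := by
    have := h.add (h'.smul (-1))
    simpa [sub_eq_add_neg] using this
  have hI : ∀ᵐ x ∂(volume : Measure ℝ), x ∈ Ioo (0 : ℝ) 1 → (v - v') x = 0 := by
    refine isOpen_Ioo.ae_eq_zero_of_integral_contDiff_smul_eq_zero ?_ ?_
    · have : IntegrableOn (v - v') (Icc (0 : ℝ) 1) := hz.2.1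
      exact (this.mono_set Ioo_subset_Icc_self).locallyIntegrableOn
    · intro g hg hgc hgs
      have h1 := hz.2.2 g ⟨hg, hgc, hgs⟩
      simp only [Pi.zero_apply, smul_zero, integral_zero] at h1
      rw [← setIntegral_eq_integral_of_forall_compl_eq_zero (s := Icc (0 : ℝ) 1)]
      · exact (neg_eq_zero.mp h1.symm)
      · intro x hx
        have : g x = 0 := by
          by_contra hne
          exact hx (Ioo_subset_Icc_self (hgs (subset_tsupport g hne)))
        rw [this, zero_smul]
  have : ∀ᵐ x ∂muI, (v - v') x = 0 := by
    rw [muI, ← restrict_Ioo_eq_restrict_Icc, ae_restrict_iff' measurableSet_Ioo]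
    exact hI
  filter_upwards [this] with x hx
  exact sub_eq_zero.mp hx

open Classical in
/-- The weak derivative `∂ₓ u` on `I` (well defined almost everywhere on `I`); it is `0` by
convention if `u` is not weakly differentiable. -/
def weakDeriv (u : ℝ → EuclideanSpace ℝ (Fin d)) : ℝ → EuclideanSpace ℝ (Fin d) :=
  if h : ∃ v, HasWeakDeriv u v then h.choose else 0

theorem HasWeakDeriv.weakDeriv_ae_eq {u v : ℝ → EuclideanSpace ℝ (Fin d)}
    (h : HasWeakDeriv u v) : weakDeriv u =ᵐ[muI] v := by
  have hex : ∃ v, HasWeakDeriv u v := ⟨v, h⟩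
  rw [weakDeriv, dif_pos hex]
  exact hex.choose_spec.unique h

end WeakDerivative

/-! ### Sobolev spaces -/

/-- The tuples `(u₀, …, u_k)` in `L²(I, ℝᵈ)` in which `u_{i+1}` is the weak derivative of `u_i`. -/
def sobolevSubmodule (d k : ℕ) : Submodule ℝ (PiLp 1 (fun _ : Fin (k + 1) => L2 d)) where
  carrier := {U | ∀ i : Fin k, HasWeakDeriv (U i.castSucc) (U i.succ)}
  add_mem' {U W} hU hW i := by
    refine ((hU i).add (hW i)).congr ?_ ?_
    · exact (Lp.coeFn_add _ _).symm
    · exact (Lp.coeFn_add _ _).symm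
  zero_mem' i := by
    refine HasWeakDeriv.zero.congr ?_ ?_
    · exact (Lp.coeFn_zero _ _ _).symm
    · exact (Lp.coeFn_zero _ _ _).symm
  smul_mem' c U hU i := by
    refine ((hU i).smul c).congr ?_ ?_
    · exact (Lp.coeFn_smul _ _).symm
    · exact (Lp.coeFn_smul _ _).symm

/-- The Sobolev space `Hᵏ(I, ℝᵈ)`. An element `u` is recorded together with its weak derivatives
`(u, ∂ₓu, …, ∂ₓᵏu)`, all in `L²` (they are determined by `u`), so that the norm inherited from the
`ℓ¹`-product is the Sobolev norm `∑_{i ≤ k} ‖∂ₓⁱ u‖_{L²}`. -/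
def Sobolev (d k : ℕ) : Type := sobolevSubmodule d k

instance (d k : ℕ) : NormedAddCommGroup (Sobolev d k) :=
  inferInstanceAs (NormedAddCommGroup (sobolevSubmodule d k))

instance (d k : ℕ) : NormedSpace ℝ (Sobolev d k) :=
  inferInstanceAs (NormedSpace ℝ (sobolevSubmodule d k))

/-- The weak derivative `∂ₓⁱ u ∈ L²` of `u ∈ Hᵏ(I, ℝᵈ)`. -/
def Sobolev.wderiv {d k : ℕ} (U : Sobolev d k) (i : Fin (k + 1)) : L2 d :=
  U.1 i

theorem Sobolev.hasWeakDeriv {d k : ℕ} (U : Sobolev d k) (i : Fin k) :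
    HasWeakDeriv (U.wderiv i.castSucc) (U.wderiv i.succ) :=
  U.2 i

theorem Sobolev.norm_eq {d k : ℕ} (U : Sobolev d k) : ‖U‖ = ∑ i, ‖U.wderiv i‖ := by
  have h : ‖U‖ = ‖(U.1 : PiLp 1 (fun _ : Fin (k + 1) => L2 d))‖ := rfl
  rw [h, PiLp.norm_eq_of_nat 1 (by norm_num)]
  simp [Sobolev.wderiv]

/-- The embedding `Hᵏ(I, ℝᵈ) → L²(I, ℝᵈ)`: it sends an element to its underlying function. -/
def Sobolev.toL2 (d k : ℕ) : Sobolev d k →ₗ[ℝ] L2 d where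
  toFun U := U.wderiv 0
  map_add' _ _ := rfl
  map_smul' _ _ := rfl

/-- The test functions `C_c^∞((0,1), ℝᵈ)` as a subspace of `Hᵏ(I, ℝᵈ)`. -/
def Sobolev.testFunctions (d k : ℕ) : Submodule ℝ (Sobolev d k) where
  carrier := {U | ∃ φ : ℝ → EuclideanSpace ℝ (Fin d),
    IsTestFunction φ ∧ (Sobolev.toL2 d k U : ℝ → EuclideanSpace ℝ (Fin d)) =ᵐ[muI] φ}
  add_mem' {U W} := by
    rintro ⟨φ, hφ, hU⟩ ⟨ψ, hψ, hW⟩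
    refine ⟨φ + ψ, ⟨hφ.1.add hψ.1, hφ.2.1.add hψ.2.1, ?_⟩, ?_⟩
    · exact (tsupport_add φ ψ).trans (union_subset hφ.2.2 hψ.2.2)
    · rw [map_add]
      exact (Lp.coeFn_add _ _).trans (hU.add hW)
  zero_mem' := by
    refine ⟨0, ⟨contDiff_const, HasCompactSupport.zero, by simp [tsupport]⟩, ?_⟩
    rw [map_zero]
    exact Lp.coeFn_zero _ _ _
  smul_mem' c U := by
    rintro ⟨φ, hφ, hU⟩
    refine ⟨c • φ, ⟨hφ.1.const_smul c, hφ.2.1.smul_left (f := fun _ => c), ?_⟩, ?_⟩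
    · exact (tsupport_smul_subset_right (fun _ => c) φ).trans hφ.2.2
    · rw [map_smul]
      exact (Lp.coeFn_smul _ _).trans (hU.const_smul c)

/-- `H₀ᵏ(I, ℝᵈ)`, the closure of the test functions in `Hᵏ(I, ℝᵈ)`. -/
def SobolevZero (d k : ℕ) : Submodule ℝ (Sobolev d k) :=
  (Sobolev.testFunctions d k).topologicalClosure

/-- `H⁴_c = H⁴(I, ℝᵈ) ∩ H²₀(I, ℝᵈ)`, with the norm of `H⁴`. -/
def H4c (d : ℕ) : Submodule ℝ (Sobolev d 4) :=
  ((SobolevZero d 2).map (Sobolev.toL2 d 2)).comap (Sobolev.toL2 d 4)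

/-! ### Geometry of curves -/

section Geometry

variable {d : ℕ}

/-- `f` is a regular (immersed) curve: `∂ₓ f` is continuous and has no zero on the closed
interval `I`. -/
def IsRegularCurve (f : ℝ → EuclideanSpace ℝ (Fin d)) : Prop :=
  ∃ g : ℝ → EuclideanSpace ℝ (Fin d),
    HasWeakDeriv f g ∧ ContinuousOn g (Icc 0 1) ∧ ∀ x ∈ Icc (0 : ℝ) 1, g x ≠ 0

/-- The arc length derivative `∂_{s_f} φ = |∂ₓ f|⁻¹ ∂ₓ φ`. -/
def arcDeriv (f φ : ℝ → EuclideanSpace ℝ (Fin d)) : ℝ → EuclideanSpace ℝ (Fin d) :=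
  fun x => ‖weakDeriv f x‖⁻¹ • weakDeriv φ x

/-- The normal derivative `∇_{s_f} φ = ∂_{s_f} φ - ⟨∂_{s_f} φ, ∂_{s_f} f⟩ ∂_{s_f} f`. -/
def normalDeriv (f φ : ℝ → EuclideanSpace ℝ (Fin d)) : ℝ → EuclideanSpace ℝ (Fin d) :=
  fun x => arcDeriv f φ x - (inner ℝ (arcDeriv f φ x) (arcDeriv f f x)) • arcDeriv f f x

/-- The curvature vector `κ = ∂_{s_f} ∂_{s_f} f`. -/
def curvature (f : ℝ → EuclideanSpace ℝ (Fin d)) : ℝ → EuclideanSpace ℝ (Fin d) :=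
  arcDeriv f (arcDeriv f f)

/-- The elastic energy `ℰ(f) = ½ ∫_I |κ|² |∂ₓ f| dx`. -/
def elasticEnergy (f : ℝ → EuclideanSpace ℝ (Fin d)) : ℝ :=
  (1 / 2) * ∫ x, ‖curvature f x‖ ^ 2 * ‖weakDeriv f x‖ ∂muI

/-- `L^{2,⊥}`: the fields in `L²(I, ℝᵈ)` that are normal to `f`. -/
def L2Perp (f : ℝ → EuclideanSpace ℝ (Fin d)) : Submodule ℝ (L2 d) where
  carrier := {u | ∀ᵐ x ∂muI, inner ℝ (u x) (weakDeriv f x) = 0}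
  add_mem' {u v} hu hv := by
    simp only [mem_ofPred_eq] at hu hv ⊢
    filter_upwards [hu, hv, Lp.coeFn_add u v] with x h1 h2 h3
    rw [h3, Pi.add_apply, inner_add_left, h1, h2, add_zero]
  zero_mem' := by
    simp only [mem_ofPred_eq]
    filter_upwards [Lp.coeFn_zero (EuclideanSpace ℝ (Fin d)) 2 muI] with x h
    rw [h, Pi.zero_apply, inner_zero_left]
  smul_mem' c u hu := by
    simp only [mem_ofPred_eq] at hu ⊢
    filter_upwards [hu, Lp.coeFn_smul c u] with x h1 h2
    rw [h2, Pi.smul_apply, inner_smul_left, h1, mul_zero]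

/-- `H_c^{4,⊥}`: the fields in `H⁴_c` that are normal to `f`, with the norm of `H⁴`. (Normality
almost everywhere is the same as normality at every point of `I`, by continuity, for `f` in
`H⁴`.) -/
def H4cPerp (f : ℝ → EuclideanSpace ℝ (Fin d)) : Submodule ℝ (Sobolev d 4) :=
  H4c d ⊓ (L2Perp f).comap (Sobolev.toL2 d 4)

/-- The underlying field `I → ℝᵈ` of an element of `H_c^{4,⊥}`. -/
def H4cPerp.field {f : ℝ → EuclideanSpace ℝ (Fin d)} (φ : H4cPerp f) :
    ℝ → EuclideanSpace ℝ (Fin d) :=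
  Sobolev.toL2 d 4 φ.1

/-- The energy of normal variations, `E(φ) = ℰ(f + φ)`, for `φ ∈ H_c^{4,⊥}`. -/
def normalEnergy (f : ℝ → EuclideanSpace ℝ (Fin d)) (φ : H4cPerp f) : ℝ :=
  elasticEnergy (f + H4cPerp.field φ)

/-- On the ball `B_ρ(0) ⊂ H_c^{4,⊥}`, the energy `E` is Fréchet differentiable and `G` is its
gradient with respect to the fixed `L²(dx)` scalar product:
`E'(φ) η = ⟨G(φ), η⟩_{L²(dx)}` for all `η ∈ H_c^{4,⊥}`. -/
def IsL2Gradient (f : ℝ → EuclideanSpace ℝ (Fin d)) (ρ : ℝ) (G : H4cPerp f → L2Perp f) : Prop :=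
  ∀ φ ∈ Metric.ball (0 : H4cPerp f) ρ, DifferentiableAt ℝ (normalEnergy f) φ ∧
    ∀ η : H4cPerp f,
      fderiv ℝ (normalEnergy f) φ η = inner ℝ (G φ : L2 d) (Sobolev.toL2 d 4 η.1)

/-- All the curves `f + φ` with `φ ∈ B_ρ(0) ⊂ H_c^{4,⊥}` are immersed. -/
def IsAdmissibleRadius (f : ℝ → EuclideanSpace ℝ (Fin d)) (ρ : ℝ) : Prop :=
  0 < ρ ∧ ∀ φ ∈ Metric.ball (0 : H4cPerp f) ρ, IsRegularCurve (f + H4cPerp.field φ)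

end Geometry

/-- The index `dim ker T - codim im T` of an operator (meaningful when both are finite). -/
def fredholmIndex {X Y : Type*} [AddCommGroup X] [Module ℝ X] [TopologicalSpace X]
    [AddCommGroup Y] [Module ℝ Y] [TopologicalSpace Y] (T : X →L[ℝ] Y) : ℤ :=
  (Module.finrank ℝ T.ker : ℤ) - (Module.finrank ℝ (Y ⧸ T.range) : ℤ)

end ElasticCurve

end

/-! Write `p = ∂ₓf` and `q = ∂ₓ²f`. The energy density is `½⟨M(p)q, q⟩` with `M(p) = |p|⁻³P(p)`,
where `P(p)` is the orthogonal projection onto the complement of `p`. Two integrations by parts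
against clamped fields turn the first variation into the pairing with `M(∂ₓf)∂ₓ⁴f + G(∂ₓf, ∂ₓ²f,
∂ₓ³f)`, `G` smooth where `p ≠ 0`; the gradient on normal fields is the pointwise normal projection
of this expression. It is the only gradient, because `H_c^{4,⊥}` is dense in `L^{2,⊥}`.

Since `H⁴` embeds into `C³` and the fourth derivative enters linearly, the gradient is Fréchet
differentiable from `H⁴` to `L²`. The linearization at the base curve is `P M ∂ₓ⁴φ` plus terms in
`∂ₓφ, ∂ₓ²φ, ∂ₓ³φ` with `L²` coefficients. Such terms are compact: `H⁴ → C³` is compact by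
Arzelà–Ascoli, and multiplication by an `L²` coefficient is bounded from `C⁰` to `L²`
(`isCompactOperator_lowerOp`).

The leading part is an isomorphism (`bijective_normalPart_leadingOp`). The positive factor `|p|⁻³`
is harmless, so the operator to study is `φ ↦ Pφ''''`. For normal clamped `φ` one has `⟨Pφ'''', φ⟩ =
⟨φ'''', φ⟩ = ‖φ''‖²`, which gives injectivity. For surjectivity, solve `W'''' = y` with clamped ends
and project: `φ = PW` satisfies `Pφ'''' = y + Ky` with `K` compact by the Leibniz rule, and the
Riesz theory reduces the claim to injectivity of `id + K`. This step uses four derivatives of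
`P(∂ₓf)`, hence `f ∈ H⁵`. A compact perturbation of an isomorphism is Fredholm of index zero.

Finally `∇ = N(∂ₓf)∂ₓ` with `N(p) = |p|⁻¹P(p)`, and `|p|N(p)⁴ = M(p)` because `P` is idempotent. So
`|∂ₓf|∇⁴` has the same leading part as the linearization and differs from it by a compact operator.
-/

noncomputable section

/-! ### Compact perturbations of isomorphisms -/

section Fredholm

/-- A finite rank perturbation of the identity has equal nullity and defect. -/
theorem LinearMap.finrank_ker_one_add_eq {Y : Type*} [AddCommGroup Y] [Module ℝ Y]
    (G : Y →ₗ[ℝ] Y) [FiniteDimensional ℝ (LinearMap.range G)] :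
    Module.finrank ℝ (LinearMap.ker (LinearMap.id + G)) =
      Module.finrank ℝ (Y ⧸ LinearMap.range (LinearMap.id + G)) := by
  set R := LinearMap.range G with hR
  have hmap : ∀ x ∈ R, (LinearMap.id + G : Y →ₗ[ℝ] Y) x ∈ R := fun x hx =>
    R.add_mem hx (LinearMap.mem_range_self G x)
  let g : R →ₗ[ℝ] R := (LinearMap.id + G).restrict hmap
  have hker : Module.finrank ℝ (LinearMap.ker (LinearMap.id + G)) =
      Module.finrank ℝ (LinearMap.ker g) := by
    -- If `x + G x = 0` then `x = G (-x)` lies in `R`, so nothing of the kernel is lost on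
    -- restricting to `R`.
    have hle : LinearMap.ker (LinearMap.id + G) ≤ R := by
      intro x hx
      have hx' : x + G x = 0 := hx
      have : x = G (-x) := by rw [map_neg]; exact eq_neg_of_add_eq_zero_left hx'
      rw [this]; exact LinearMap.mem_range_self G _
    have : LinearMap.ker g = (LinearMap.ker (LinearMap.id + G)).comap R.subtype := by
      ext x
      simp [g, LinearMap.mem_ker, Subtype.ext_iff]
    rw [this]
    exact (LinearEquiv.finrank_eq (Submodule.comapSubtypeEquivOfLe hle)).symm
  -- Modulo the range of `id + G`, every `y` is congruent to `G (-y)`. Thus `R` covers the cokernel,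
  -- with kernel `range g`, and rank-nullity for the endomorphism `g` of the finite-dimensional `R`
  -- finishes the count.
  let q : R →ₗ[ℝ] (Y ⧸ LinearMap.range (LinearMap.id + G)) :=
    (LinearMap.range (LinearMap.id + G)).mkQ ∘ₗ R.subtype
  have hq : Function.Surjective q := by
    intro z
    obtain ⟨y, rfl⟩ := Submodule.mkQ_surjective _ z
    refine ⟨⟨G (-y), LinearMap.mem_range_self G _⟩, ?_⟩
    simp only [q, LinearMap.comp_apply, Submodule.subtype_apply, Submodule.mkQ_apply]
    rw [Submodule.Quotient.eq]
    refine ⟨-y, ?_⟩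
    simp [sub_eq_add_neg, add_comm]
  have hqk : LinearMap.ker q = LinearMap.range g := by
    ext x
    simp only [q, LinearMap.mem_ker, LinearMap.comp_apply, Submodule.subtype_apply,
      Submodule.mkQ_apply, Submodule.Quotient.mk_eq_zero, LinearMap.mem_range]
    constructor
    · rintro ⟨y, hy⟩
      have hy' : y + G y = x := hy
      have hyR : y ∈ R := by
        rw [eq_sub_of_add_eq hy']
        exact R.sub_mem x.2 (LinearMap.mem_range_self G y)
      exact ⟨⟨y, hyR⟩, Subtype.ext hy⟩
    · rintro ⟨y, hy⟩
      exact ⟨y, congrArg Subtype.val hy⟩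
  have h1 := LinearMap.finrank_range_add_finrank_ker q
  have h2 := LinearMap.finrank_range_add_finrank_ker g
  rw [LinearMap.range_eq_top.mpr hq, finrank_top, hqk] at h1
  rw [hker]
  omega

/-- A compact operator into a Hilbert space is a norm limit of operators of finite rank. -/
theorem IsCompactOperator.exists_finiteRank_norm_sub_lt {X Y : Type*} [NormedAddCommGroup X]
    [NormedSpace ℝ X] [NormedAddCommGroup Y] [InnerProductSpace ℝ Y] {C : X →L[ℝ] Y}
    (hC : IsCompactOperator C) {ε : ℝ} (hε : 0 < ε) :
    ∃ G : X →L[ℝ] Y, FiniteDimensional ℝ (LinearMap.range (G : X →ₗ[ℝ] Y)) ∧ ‖C - G‖ ≤ ε := by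
  obtain ⟨K, hK, hKC⟩ := hC.image_closedBall_subset_compact (f := (C : X →ₗ[ℝ] Y)) 1
  obtain ⟨t, -, htf, ht⟩ := hK.finite_cover_balls hε
  -- `S` is spanned by a finite `ε`-net of the compact image of the unit ball. The projection of `C
  -- x` to `S` is at least as close to `C x` as the nearest net point.
  let S : Submodule ℝ Y := Submodule.span ℝ t
  have : FiniteDimensional ℝ S := FiniteDimensional.span_of_finite ℝ htf
  refine ⟨S.starProjection.comp C, ?_, ?_⟩
  · refine Submodule.finiteDimensional_of_le (S₂ := S) ?_
    rintro _ ⟨x, rfl⟩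
    exact S.starProjection_apply_mem (C x)
  · refine ContinuousLinearMap.opNorm_le_of_unit_norm hε.le fun x hx => ?_
    have hxK : C x ∈ K := hKC ⟨x, by simp [hx], rfl⟩
    obtain ⟨y, hy, hxy⟩ := mem_iUnion₂.mp (ht hxK)
    have hyS : y ∈ S := Submodule.subset_span hy
    have := S.starProjection_minimal (C x)
    rw [sub_apply, ContinuousLinearMap.comp_apply, this]
    refine (ciInf_le ⟨0, ?_⟩ (⟨y, hyS⟩ : S)).trans ?_
    · rintro _ ⟨z, rfl⟩; exact norm_nonneg _
    · rw [← dist_eq_norm]; exact (Metric.mem_ball.mp hxy).le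

/-- The sum of an isomorphism and an operator of finite rank is Fredholm of index zero. -/
theorem ContinuousLinearEquiv.isFredholm_add_finiteRank {X Y : Type*} [NormedAddCommGroup X]
    [NormedSpace ℝ X] [NormedAddCommGroup Y] [NormedSpace ℝ Y] (e : X ≃L[ℝ] Y) (G : X →L[ℝ] Y)
    [hG : FiniteDimensional ℝ (LinearMap.range (G : X →ₗ[ℝ] Y))] :
    ((e : X →L[ℝ] Y) + G).IsFredholm ∧ ElasticCurve.fredholmIndex ((e : X →L[ℝ] Y) + G) = 0 := by
  constructor
  · refine ContinuousLinearMap.IsFredholm.of_isQuasiInverse (v := (e.symm : Y →L[ℝ] X)) ?_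
    have hN : ((G : X →ₗ[ℝ] Y)).HasNoetherianRange := by
      rw [LinearMap.HasNoetherianRange]; infer_instance
    constructor
    · refine LinearMap.FiniteRangeSetoid.equiv_iff_hasNoetherianRange.mpr ?_
      have h : ((e.symm : Y →L[ℝ] X) : Y →ₗ[ℝ] X) ∘ₗ (((e : X →L[ℝ] Y) + G : X →L[ℝ] Y) :
          X →ₗ[ℝ] Y) - LinearMap.id = ((e.symm : Y →L[ℝ] X) : Y →ₗ[ℝ] X) ∘ₗ (G : X →ₗ[ℝ] Y) := by
        ext x; simp
      rw [h]
      exact hN.comp_left _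
    · refine LinearMap.FiniteRangeSetoid.equiv_iff_hasNoetherianRange.mpr ?_
      have h : (((e : X →L[ℝ] Y) + G : X →L[ℝ] Y) : X →ₗ[ℝ] Y) ∘ₗ
          ((e.symm : Y →L[ℝ] X) : Y →ₗ[ℝ] X) - LinearMap.id =
          (G : X →ₗ[ℝ] Y) ∘ₗ ((e.symm : Y →L[ℝ] X) : Y →ₗ[ℝ] X) := by
        ext x; simp
      rw [h]
      exact hN.comp_right _
  -- For the index, factor `e + G = (id + G e⁻¹) e`; the isomorphism `e` changes neither nullity nor
  -- defect.
  · let H : Y →ₗ[ℝ] Y := (G : X →ₗ[ℝ] Y) ∘ₗ (e.symm : Y →ₗ[ℝ] X)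
    have : FiniteDimensional ℝ (LinearMap.range H) :=
      Submodule.finiteDimensional_of_le (LinearMap.range_comp_le_range _ _)
    have key := LinearMap.finrank_ker_one_add_eq H
    have hcomp : (((e : X →L[ℝ] Y) + G : X →L[ℝ] Y) : X →ₗ[ℝ] Y) =
        (LinearMap.id + H) ∘ₗ (e.toLinearEquiv : X →ₗ[ℝ] Y) := by
      ext x; simp [H]
    unfold ElasticCurve.fredholmIndex
    have h1 : Module.finrank ℝ (((e : X →L[ℝ] Y) + G).ker) =
        Module.finrank ℝ (LinearMap.ker (LinearMap.id + H)) := by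
      have : ((e : X →L[ℝ] Y) + G).ker =
          (LinearMap.ker (LinearMap.id + H)).comap (e.toLinearEquiv : X →ₗ[ℝ] Y) := by
        rw [← LinearMap.ker_comp, ← hcomp]
      rw [this]
      exact LinearEquiv.finrank_eq
        (e.toLinearEquiv.ofSubmodule' (LinearMap.ker (LinearMap.id + H)))
    have h2 : ((e : X →L[ℝ] Y) + G).range = LinearMap.range (LinearMap.id + H) := by
      have : ((e : X →L[ℝ] Y) + G).range =
        LinearMap.range ((LinearMap.id + H) ∘ₗ (e.toLinearEquiv : X →ₗ[ℝ] Y)) := by rw [← hcomp]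
      rw [this, LinearMap.range_comp, LinearEquiv.range, Submodule.map_top]
    rw [h1, h2, key, sub_self]

/-- The sum of an isomorphism onto a Hilbert space and a compact operator is Fredholm of
index zero. -/
theorem ContinuousLinearEquiv.isFredholm_add_compact {X Y : Type*} [NormedAddCommGroup X]
    [NormedSpace ℝ X] [NormedAddCommGroup Y] [InnerProductSpace ℝ Y] [CompleteSpace Y]
    (e : X ≃L[ℝ] Y) {K : X →L[ℝ] Y} (hK : IsCompactOperator K) :
    ((e : X →L[ℝ] Y) + K).IsFredholm ∧ ElasticCurve.fredholmIndex ((e : X →L[ℝ] Y) + K) = 0 := by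
  -- Here `e + K = (1 + C) e` and `1 + C = (1 + (C - G)) + G` with `G` of finite rank. Since `‖C -
  -- G‖ ≤ 1/2`, the first bracket is invertible by the Neumann series, so `e + K` is the isomorphism
  -- `e'` plus the finite rank operator `G'`.
  let C : Y →L[ℝ] Y := K.comp (e.symm : Y →L[ℝ] X)
  have hC : IsCompactOperator C := hK.comp_clm (e.symm : Y →L[ℝ] X)
  obtain ⟨G, hG, hCG⟩ := hC.exists_finiteRank_norm_sub_lt (ε := 1 / 2) (by norm_num)
  let u : (Y →L[ℝ] Y)ˣ := Units.oneSub (-(C - G)) (by rw [norm_neg]; linarith)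
  let e' : X ≃L[ℝ] Y := e.trans (ContinuousLinearEquiv.unitsEquiv ℝ Y u)
  let G' : X →L[ℝ] Y := G.comp (e : X →L[ℝ] Y)
  have : FiniteDimensional ℝ (LinearMap.range (G' : X →ₗ[ℝ] Y)) :=
    Submodule.finiteDimensional_of_le (LinearMap.range_comp_le_range _ _)
  have : (e : X →L[ℝ] Y) + K = (e' : X →L[ℝ] Y) + G' := by
    ext x
    simp [e', G', u, C]
    abel
  rw [this]
  exact e'.isFredholm_add_finiteRank G'

/-- Riesz: an injective compact perturbation of the identity is surjective. -/
theorem IsCompactOperator.surjective_id_add {Y : Type*} [NormedAddCommGroup Y] [NormedSpace ℝ Y]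
    [CompleteSpace Y] {K : Y →L[ℝ] Y} (hK : IsCompactOperator K)
    (hinj : ∀ y, y + K y = 0 → y = 0) : Function.Surjective fun y => y + K y := by
  -- Fredholm alternative at `-1`: either `-1` is an eigenvalue, which injectivity excludes, or `K +
  -- 1` is bijective.
  rcases hK.hasEigenvalue_or_mem_resolventSet (μ := (-1 : ℝ)) (by norm_num) with h | h
  · obtain ⟨y, hy⟩ := h.exists_hasEigenvector
    exact absurd (hinj y (by have := hy.apply_eq_smul; simp at this; simp [this])) hy.2
  · rw [spectrum.mem_resolventSet_iff, ← IsUnit.neg_iff,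
      ContinuousLinearMap.isUnit_iff_bijective] at h
    intro z
    obtain ⟨y, hy⟩ := h.2 z
    exact ⟨y, by simpa [add_comm] using hy⟩

end Fredholm

namespace ElasticCurve

/-! ### Absolutely continuous functions on the unit interval -/

section Primitive

variable {V V' : Type*} [NormedAddCommGroup V] [NormedSpace ℝ V] [NormedAddCommGroup V']
  [NormedSpace ℝ V']

theorem setIntegral_muI (g : ℝ → V) : ∫ x, g x ∂muI = ∫ x in (0 : ℝ)..1, g x := by
  rw [intervalIntegral.integral_of_le zero_le_one, integral_Icc_eq_integral_Ioc]

theorem norm_intervalIntegral_le_muI {g : ℝ → V} (hg : Integrable g muI) {x y : ℝ}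
    (hx : x ∈ Icc (0 : ℝ) 1) (hy : y ∈ Icc (0 : ℝ) 1) :
    ‖∫ t in x..y, g t‖ ≤ ∫ t, ‖g t‖ ∂muI := by
  refine (intervalIntegral.norm_integral_le_integral_norm_uIoc).trans ?_
  have hsub : uIoc x y ⊆ Icc (0 : ℝ) 1 := fun t ht =>
    (uIoc_subset_uIcc.trans (uIcc_subset_Icc hx hy)) ht
  exact setIntegral_mono_set hg.norm (Eventually.of_forall fun _ => norm_nonneg _)
    (LE.le.eventuallyLE hsub)

omit [NormedSpace ℝ V] in
theorem intervalIntegrable_of_muI {g : ℝ → V} (hg : Integrable g muI) {x y : ℝ}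
    (hx : x ∈ Icc (0 : ℝ) 1) (hy : y ∈ Icc (0 : ℝ) 1) : IntervalIntegrable g volume x y := by
  rw [intervalIntegrable_iff]
  have hg' : IntegrableOn g (Icc 0 1) := hg
  exact hg'.mono_set
    (fun t ht => (uIoc_subset_uIcc.trans (uIcc_subset_Icc hx hy)) ht)

/-- On `[0,1]`, `u` is absolutely continuous with integrable derivative `v`. -/
def IsPrimitive (u v : ℝ → V) : Prop :=
  Integrable v muI ∧ ∀ x ∈ Icc (0 : ℝ) 1, u x = u 0 + ∫ t in (0 : ℝ)..x, v t

theorem zero_mem_I : (0 : ℝ) ∈ Icc (0 : ℝ) 1 := ⟨le_rfl, zero_le_one⟩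

theorem one_mem_I : (1 : ℝ) ∈ Icc (0 : ℝ) 1 := ⟨zero_le_one, le_rfl⟩

theorem IsPrimitive.sub_eq {u v : ℝ → V} (h : IsPrimitive u v) {x y : ℝ}
    (hx : x ∈ Icc (0 : ℝ) 1) (hy : y ∈ Icc (0 : ℝ) 1) : u y - u x = ∫ t in x..y, v t := by
  rw [h.2 x hx, h.2 y hy, add_sub_add_left_eq_sub, intervalIntegral.integral_interval_sub_left
    (intervalIntegrable_of_muI h.1 zero_mem_I hy) (intervalIntegrable_of_muI h.1 zero_mem_I hx)]

theorem IsPrimitive.continuousOn {u v : ℝ → V} (h : IsPrimitive u v) :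
    ContinuousOn u (Icc 0 1) := by
  have : ContinuousOn (fun x => u 0 + ∫ t in (0 : ℝ)..x, v t) (Icc 0 1) := by
    refine continuousOn_const.add ?_
    have h1 : IntegrableOn v (uIcc (0 : ℝ) 1) := by
      rw [uIcc_of_le zero_le_one]; exact h.1
    have := intervalIntegral.continuousOn_primitive_interval h1
    rwa [uIcc_of_le zero_le_one] at this
  exact this.congr h.2

omit [NormedSpace ℝ V] in
theorem integrable_muI_of_continuousOn {u : ℝ → V} (h : ContinuousOn u (Icc 0 1)) :
    Integrable u muI := h.integrableOn_compact isCompact_Icc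

theorem IsPrimitive.add {u v u' v' : ℝ → V} (h : IsPrimitive u v) (h' : IsPrimitive u' v') :
    IsPrimitive (fun x => u x + u' x) (fun x => v x + v' x) := by
  refine ⟨h.1.add h'.1, fun x hx => ?_⟩
  simp only
  rw [intervalIntegral.integral_add (intervalIntegrable_of_muI h.1 zero_mem_I hx)
    (intervalIntegrable_of_muI h'.1 zero_mem_I hx), h.2 x hx, h'.2 x hx]
  abel

theorem IsPrimitive.congr {u v u' v' : ℝ → V} (h : IsPrimitive u v)
    (hu : ∀ x ∈ Icc (0 : ℝ) 1, u' x = u x) (hv : v' =ᵐ[muI] v) : IsPrimitive u' v' := by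
  refine ⟨h.1.congr hv.symm, fun x hx => ?_⟩
  rw [hu x hx, hu 0 zero_mem_I, h.2 x hx]
  congr 1
  refine intervalIntegral.integral_congr_ae_restrict ?_
  have : volume.restrict (uIoc 0 x) ≤ muI := Measure.restrict_mono
    (fun t ht => (uIoc_subset_uIcc.trans (uIcc_subset_Icc zero_mem_I hx)) ht) le_rfl
  exact ae_mono this hv.symm

theorem isPrimitive_of_hasDerivAt [CompleteSpace V] {u v : ℝ → V}
    (h : ∀ x ∈ Icc (0 : ℝ) 1, HasDerivAt u (v x) x) (hv : ContinuousOn v (Icc 0 1)) :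
    IsPrimitive u v := by
  refine ⟨integrable_muI_of_continuousOn hv, fun x hx => ?_⟩
  rw [intervalIntegral.integral_eq_sub_of_hasDerivAt
    (fun t ht => h t (uIcc_subset_Icc zero_mem_I hx ht))
    (intervalIntegrable_of_muI (integrable_muI_of_continuousOn hv) zero_mem_I hx)]
  abel

theorem isPrimitive_integral {v : ℝ → V} (hv : Integrable v muI) (c : V) :
    IsPrimitive (fun x => c + ∫ t in (0 : ℝ)..x, v t) v :=
  ⟨hv, fun x _ => by simp⟩

theorem aestronglyMeasurable_clm_apply {μ : Measure ℝ} {C : ℝ → V →L[ℝ] V'} {s : ℝ → V}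
    (hC : AEStronglyMeasurable C μ) (hs : AEStronglyMeasurable s μ) :
    AEStronglyMeasurable (fun x => C x (s x)) μ :=
  isBoundedBilinearMap_apply.continuous.comp_aestronglyMeasurable (hC.prodMk hs)

theorem integrable_clm_apply {C : ℝ → V →L[ℝ] V'} {s : ℝ → V}
    (hC : ContinuousOn C (Icc 0 1)) (hs : Integrable s muI) :
    Integrable (fun x => C x (s x)) muI := by
  obtain ⟨M, hM⟩ := isCompact_Icc.exists_bound_of_continuousOn hC
  refine (hs.norm.const_mul M).mono' (aestronglyMeasurable_clm_apply
    (hC.aestronglyMeasurable measurableSet_Icc) hs.1) ?_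
  filter_upwards [ae_restrict_mem measurableSet_Icc] with x hx
  exact (C x).le_of_opNorm_le (hM x hx) _

/-- Product rule for a `C¹` family of operators applied to an absolutely continuous function. -/
theorem IsPrimitive.clm_apply [CompleteSpace V] [CompleteSpace V'] {C C' : ℝ → V →L[ℝ] V'}
    {r s : ℝ → V}
    (hC : ∀ x ∈ Icc (0 : ℝ) 1, HasDerivAt C (C' x) x) (hC' : ContinuousOn C' (Icc 0 1))
    (h : IsPrimitive r s) :
    IsPrimitive (fun x => C x (r x)) (fun x => C' x (r x) + C x (s x)) := by
  have hCc : ContinuousOn C (Icc 0 1) := fun x hx => (hC x hx).continuousAt.continuousWithinAt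
  have i1 : Integrable (fun x => C' x (r x)) muI :=
    integrable_clm_apply hC' (integrable_muI_of_continuousOn h.continuousOn)
  have i2 : Integrable (fun x => C x (s x)) muI := integrable_clm_apply hCc h.1
  have i12 : Integrable (fun x => C' x (r x) + C x (s x)) muI := i1.add i2
  refine ⟨i12, fun x hx => ?_⟩
  obtain ⟨M, hM⟩ := isCompact_Icc.exists_bound_of_continuousOn hCc
  obtain ⟨M', hM'⟩ := isCompact_Icc.exists_bound_of_continuousOn hC'
  have hM0 : 0 ≤ M := (norm_nonneg _).trans (hM 0 zero_mem_I)
  have hM0' : 0 ≤ M' := (norm_nonneg _).trans (hM' 0 zero_mem_I)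
  rw [← sub_eq_zero, ← norm_le_zero_iff]
  refine le_of_forall_pos_le_add fun δ hδ => ?_
  -- The boundary value will contribute an error `Mε` and the integral `M'ε + Mε`.
  obtain ⟨ε, hε, hεδ⟩ : ∃ ε : ℝ, 0 < ε ∧ (2 * M + M') * ε ≤ δ := by
    refine ⟨δ / (2 * M + M' + 1), by positivity, ?_⟩
    rw [mul_div_assoc', div_le_iff₀ (by positivity)]
    nlinarith
  -- `s` is only integrable, so it is replaced by a continuous `g` close to it in `L¹`. Its
  -- primitive `p` is `C¹`, satisfies the classical product rule, and stays within `ε` of `r`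
  -- uniformly.
  obtain ⟨g, -, hgε, hgc, hgi⟩ := h.1.exists_hasCompactSupport_integral_sub_le hε
  set p : ℝ → V := fun x => r 0 + ∫ t in (0 : ℝ)..x, g t with hp
  have hpd : ∀ t, HasDerivAt p (g t) t := fun t =>
    (intervalIntegral.integral_hasDerivAt_right (hgc.intervalIntegrable _ _)
      (hgc.stronglyMeasurableAtFilter _ _) hgc.continuousAt).const_add _
  have hpc : Continuous p := continuous_iff_continuousAt.mpr fun t => (hpd t).continuousAt
  have hpP : IsPrimitive p g := isPrimitive_of_hasDerivAt (fun t _ => hpd t) hgc.continuousOn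
  have j1 : Integrable (fun x => C' x (p x)) muI :=
    integrable_clm_apply hC' (integrable_muI_of_continuousOn hpc.continuousOn)
  have j2 : Integrable (fun x => C x (g x)) muI := integrable_clm_apply hCc hgi
  have j12 : Integrable (fun x => C' x (p x) + C x (g x)) muI := j1.add j2
  have hcl : C x (p x) = C 0 (r 0) + ∫ t in (0 : ℝ)..x, (C' t (p t) + C t (g t)) := by
    rw [intervalIntegral.integral_eq_sub_of_hasDerivAt (f := fun t => C t (p t))
      (fun t ht => (hC t (uIcc_subset_Icc zero_mem_I hx ht)).clm_apply (hpd t))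
      (intervalIntegrable_of_muI j12 zero_mem_I hx)]
    simp [hp]
  have hrp : ∀ t ∈ Icc (0 : ℝ) 1, ‖r t - p t‖ ≤ ε := by
    intro t ht
    rw [h.2 t ht, hp]
    simp only
    rw [add_sub_add_left_eq_sub, ← intervalIntegral.integral_sub
      (intervalIntegrable_of_muI h.1 zero_mem_I ht) (intervalIntegrable_of_muI hgi zero_mem_I ht)]
    exact (norm_intervalIntegral_le_muI (h.1.sub hgi) zero_mem_I ht).trans hgε
  have hsplit : C x (r x) - (C 0 (r 0) + ∫ t in (0 : ℝ)..x, (C' t (r t) + C t (s t))) =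
      C x (r x - p x) - ∫ t in (0 : ℝ)..x, (C' t (r t - p t) + C t (s t - g t)) := by
    have e : (∫ t in (0 : ℝ)..x, (C' t (r t - p t) + C t (s t - g t))) =
        (∫ t in (0 : ℝ)..x, (C' t (r t) + C t (s t))) -
          ∫ t in (0 : ℝ)..x, (C' t (p t) + C t (g t)) := by
      rw [← intervalIntegral.integral_sub (intervalIntegrable_of_muI i12 zero_mem_I hx)
        (intervalIntegrable_of_muI j12 zero_mem_I hx)]
      refine intervalIntegral.integral_congr fun t _ => ?_
      simp only [map_sub]; abel
    rw [e, map_sub, hcl]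
    abel
  rw [hsplit, zero_add]
  have b1 : ‖C x (r x - p x)‖ ≤ M * ε :=
    ((C x).le_of_opNorm_le (hM x hx) _).trans (by gcongr; exact hrp x hx)
  have i3 : Integrable (fun t => C' t (r t - p t) + C t (s t - g t)) muI := by
    refine (i12.sub j12).congr (Eventually.of_forall fun t => ?_)
    simp only [Pi.sub_apply, map_sub]; abel
  have b2 : ‖∫ t in (0 : ℝ)..x, (C' t (r t - p t) + C t (s t - g t))‖ ≤ M' * ε + M * ε := by
    refine (norm_intervalIntegral_le_muI i3 zero_mem_I hx).trans ?_
    have hsg : Integrable (fun t => M * ‖s t - g t‖) muI := (h.1.sub hgi).norm.const_mul M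
    have : ∫ t, ‖C' t (r t - p t) + C t (s t - g t)‖ ∂muI ≤
        ∫ t, (M' * ε + M * ‖s t - g t‖) ∂muI := by
      refine integral_mono_ae i3.norm
        ((integrable_const _).add hsg) ?_
      filter_upwards [ae_restrict_mem measurableSet_Icc] with t ht
      refine (norm_add_le _ _).trans (add_le_add ?_ ((C t).le_of_opNorm_le (hM t ht) _))
      exact ((C' t).le_of_opNorm_le (hM' t ht) _).trans (by gcongr; exact hrp t ht)
    refine this.trans ?_
    rw [integral_add (integrable_const _) hsg, integral_const]
    refine add_le_add ?_ ((integral_const_mul M _).trans_le (mul_le_mul_of_nonneg_left hgε hM0))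
    simp [muI]
  refine (norm_sub_le _ _).trans ?_
  linarith

theorem IsPrimitive.intervalIntegral_eq {u v : ℝ → V} (h : IsPrimitive u v) :
    ∫ x, v x ∂muI = u 1 - u 0 := by
  rw [setIntegral_muI, h.sub_eq zero_mem_I one_mem_I]

end Primitive

/-! ### Test functions and weak derivatives -/

section TestFunctions

variable {V : Type*} [NormedAddCommGroup V] [NormedSpace ℝ V]

theorem IsTestFunction.eq_zero {φ : ℝ → V} (h : IsTestFunction φ) {x : ℝ}
    (hx : x ∉ Ioo (0 : ℝ) 1) : φ x = 0 := by
  by_contra hne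
  exact hx (h.2.2 (subset_tsupport φ hne))

theorem IsTestFunction.sub_smul {ψ : ℝ → V} (h : IsTestFunction ψ) {χ : ℝ → ℝ}
    (h₀ : IsTestFunction χ) (c : V) : IsTestFunction (fun x => ψ x - χ x • c) := by
  refine ⟨h.1.sub (h₀.1.smul contDiff_const), ?_, ?_⟩
  · exact h.2.1.sub (h₀.2.1.smul_right (f' := fun _ => c))
  · refine (tsupport_sub (f := ψ) (g := fun x => χ x • c)).trans (union_subset h.2.2 ?_)
    exact (tsupport_smul_subset_left χ (fun _ => c)).trans h₀.2.2

theorem exists_isTestFunction_integral_eq_one :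
    ∃ χ : ℝ → ℝ, IsTestFunction χ ∧ ∫ x in (0 : ℝ)..1, χ x = 1 := by
  let b : ContDiffBump (1 / 2 : ℝ) := ⟨1 / 8, 1 / 4, by norm_num, by norm_num⟩
  have hts : tsupport (b.normed volume) ⊆ Ioo (0 : ℝ) 1 := by
    rw [b.tsupport_normed_eq]
    intro x hx
    rw [Metric.mem_closedBall, Real.dist_eq, abs_le] at hx
    have : b.rOut = 1 / 4 := rfl
    constructor <;> linarith [hx.1, hx.2]
  have ht : IsTestFunction (b.normed volume) := ⟨b.contDiff_normed, b.hasCompactSupport_normed, hts⟩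
  refine ⟨b.normed volume, ht, ?_⟩
  rw [← setIntegral_muI, setIntegral_eq_integral_of_forall_compl_eq_zero, b.integral_normed]
  intro x hx
  exact ht.eq_zero fun h => hx (Ioo_subset_Icc_self h)

/-- A test function of mean zero has a primitive that is a test function. -/
theorem IsTestFunction.primitive [CompleteSpace V] {ψ : ℝ → V} (h : IsTestFunction ψ)
    (h0 : ∫ x in (0 : ℝ)..1, ψ x = 0) :
    IsTestFunction (fun x => ∫ t in (0 : ℝ)..x, ψ t) ∧
      ∀ x, HasDerivAt (fun x => ∫ t in (0 : ℝ)..x, ψ t) (ψ x) x := by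
  have hc := h.1.continuous
  have hd : ∀ x, HasDerivAt (fun x => ∫ t in (0 : ℝ)..x, ψ t) (ψ x) x := fun x =>
    intervalIntegral.integral_hasDerivAt_right (hc.intervalIntegrable _ _)
      (hc.stronglyMeasurableAtFilter _ _) hc.continuousAt
  refine ⟨?_, hd⟩
  -- Left of `a` the primitive integrates zero. Right of `b` it equals the full integral, which
  -- vanishes by `h0`. Hence its support stays in `[a, b]`.
  obtain ⟨a, b, ha, hb, hab⟩ : ∃ a b : ℝ, 0 < a ∧ b < 1 ∧ tsupport ψ ⊆ Icc a b := by
    rcases (tsupport ψ).eq_empty_or_nonempty with he | hne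
    · exact ⟨1 / 2, 1 / 2, by norm_num, by norm_num, by simp [he]⟩
    · obtain ⟨a, ha, ha'⟩ := h.2.1.isCompact.exists_isLeast hne
      obtain ⟨b, hb, hb'⟩ := h.2.1.isCompact.exists_isGreatest hne
      exact ⟨a, b, (h.2.2 ha).1, (h.2.2 hb).2, fun x hx => ⟨ha' hx, hb' hx⟩⟩
  have hz : ∀ x, x ∉ Icc a b → ψ x = 0 := fun x hx => by
    by_contra hne
    exact hx (hab (subset_tsupport ψ hne))
  have hsupp : Function.support (fun x => ∫ t in (0 : ℝ)..x, ψ t) ⊆ Icc a b := by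
    intro x hx
    by_contra hxn
    apply hx
    by_cases hxa : x < a
    · simp only
      refine intervalIntegral.integral_zero_ae (Eventually.of_forall fun t ht => hz t fun ht' => ?_)
      have : t ≤ max 0 x := ht.2
      rcases max_cases 0 x with h | h <;> linarith [ht'.1]
    · have hxb : b < x := by
        by_contra hb'
        exact hxn ⟨not_lt.mp hxa, not_lt.mp hb'⟩
      simp only
      rw [← intervalIntegral.integral_add_adjacent_intervals (b := 1)
        (hc.intervalIntegrable _ _) (hc.intervalIntegrable _ _), h0, zero_add]
      refine intervalIntegral.integral_zero_ae (Eventually.of_forall fun t ht => hz t fun ht' => ?_)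
      have : min 1 x < t := ht.1
      rcases min_cases 1 x with h | h <;> linarith [ht'.2]
  have hts : tsupport (fun x => ∫ t in (0 : ℝ)..x, ψ t) ⊆ Icc a b :=
    closure_minimal hsupp isClosed_Icc
  refine ⟨?_, HasCompactSupport.of_support_subset_isCompact isCompact_Icc hsupp,
    hts.trans fun x hx => ⟨ha.trans_le hx.1, hx.2.trans_lt hb⟩⟩
  rw [contDiff_infty_iff_deriv]
  refine ⟨fun x => (hd x).differentiableAt, ?_⟩
  have : deriv (fun x => ∫ t in (0 : ℝ)..x, ψ t) = ψ := funext fun x => (hd x).deriv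
  rw [this]
  exact h.1

end TestFunctions

/-! ### The lemma of du Bois-Reymond and absolutely continuous representatives -/

section WeakDeriv

variable {d : ℕ}

theorem ae_eq_zero_of_forall_isTestFunction {u : ℝ → EuclideanSpace ℝ (Fin d)}
    (hu : Integrable u muI) (h : ∀ g : ℝ → ℝ, IsTestFunction g → ∫ x, g x • u x ∂muI = 0) :
    u =ᵐ[muI] 0 := by
  have hI : ∀ᵐ x ∂(volume : Measure ℝ), x ∈ Ioo (0 : ℝ) 1 → u x = 0 := by
    refine isOpen_Ioo.ae_eq_zero_of_integral_contDiff_smul_eq_zero ?_ ?_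
    · have : IntegrableOn u (Icc (0 : ℝ) 1) := hu
      exact (this.mono_set Ioo_subset_Icc_self).locallyIntegrableOn
    · intro g hg hgc hgs
      have ht : IsTestFunction g := ⟨hg, hgc, hgs⟩
      rw [← h g ht, setIntegral_eq_integral_of_forall_compl_eq_zero]
      intro x hx
      rw [ht.eq_zero fun h => hx (Ioo_subset_Icc_self h), zero_smul]
  rw [EventuallyEq, muI, ← restrict_Ioo_eq_restrict_Icc, ae_restrict_iff' measurableSet_Ioo]
  exact hI

/-- The lemma of du Bois-Reymond. -/
theorem ae_eq_const_of_forall_deriv {u : ℝ → EuclideanSpace ℝ (Fin d)}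
    (hu : Integrable u muI)
    (h : ∀ g : ℝ → ℝ, IsTestFunction g → ∫ x, deriv g x • u x ∂muI = 0) :
    ∃ c, u =ᵐ[muI] fun _ => c := by
  obtain ⟨χ, hχ, hχ1⟩ := exists_isTestFunction_integral_eq_one
  refine ⟨∫ x, χ x • u x ∂muI, ?_⟩
  set c := ∫ x, χ x • u x ∂muI with hc
  have key : (fun x => u x - c) =ᵐ[muI] 0 := by
    refine ae_eq_zero_of_forall_isTestFunction (hu.sub (integrable_const c)) fun g hg => ?_
    set m := ∫ x in (0 : ℝ)..1, g x with hm
    -- Subtracting `m χ` makes the mean zero, so the difference is the derivative of a test function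
    -- and the hypothesis applies to it.
    have hg' : IsTestFunction (fun x => g x - χ x • m) := hg.sub_smul hχ m
    have i1 : IntervalIntegrable g volume 0 1 := hg.1.continuous.intervalIntegrable _ _
    have i2 : IntervalIntegrable χ volume 0 1 := hχ.1.continuous.intervalIntegrable _ _
    have h0 : ∫ x in (0 : ℝ)..1, (g x - χ x • m) = 0 := by
      rw [intervalIntegral.integral_sub i1 (by simpa using i2.mul_const m)]
      simp [hχ1, hm]
    obtain ⟨hp, hpd⟩ := hg'.primitive h0
    have h1 := h _ hp
    have h2 : ∫ x, (g x • u x - m • (χ x • u x)) ∂muI = 0 := by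
      rw [← h1]
      refine integral_congr_ae (Eventually.of_forall fun x => ?_)
      simp only [(hpd x).deriv]
      rw [sub_smul, smul_smul, smul_eq_mul, mul_comm]
    have i3 : Integrable (fun x => m • (χ x • u x)) muI := (hχ.integrable_smul hu).smul m
    rw [integral_sub (hg.integrable_smul hu) i3, integral_smul,
      ← hc, sub_eq_zero] at h2
    simp only [smul_sub]
    rw [integral_sub (hg.integrable_smul hu) (hg.integrable_smul (integrable_const c)), h2,
      integral_smul_const, setIntegral_muI, sub_self]
  filter_upwards [key] with x hx
  exact sub_eq_zero.mp hx

theorem IsPrimitive.hasWeakDeriv {u v : ℝ → EuclideanSpace ℝ (Fin d)} (h : IsPrimitive u v) :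
    HasWeakDeriv u v := by
  have hu := integrable_muI_of_continuousOn h.continuousOn
  refine ⟨hu, h.1, fun φ hφ => ?_⟩
  have hd : ∀ x, HasDerivAt φ (deriv φ x) x := fun x =>
    (hφ.1.differentiable (by simp) x).hasDerivAt
  have hc : Continuous (deriv φ) := hφ.1.continuous_deriv (by simp)
  have key := IsPrimitive.clm_apply
    (C := fun x => φ x • ContinuousLinearMap.id ℝ (EuclideanSpace ℝ (Fin d)))
    (C' := fun x => deriv φ x • ContinuousLinearMap.id ℝ (EuclideanSpace ℝ (Fin d)))
    (fun x _ => (hd x).smul_const (ContinuousLinearMap.id ℝ (EuclideanSpace ℝ (Fin d)))) (hc.smul continuous_const).continuousOn h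
  have := key.intervalIntegral_eq
  simp only [smul_apply, ContinuousLinearMap.id_apply] at this
  rw [integral_add (hφ.integrable_deriv_smul hu) (hφ.integrable_smul h.1),
    hφ.eq_zero (x := 1) (by simp), hφ.eq_zero (x := 0) (by simp)] at this
  simp only [zero_smul, sub_zero] at this
  exact eq_neg_of_add_eq_zero_left this

/-- A weakly differentiable function is a.e. equal to an absolutely continuous one. -/
theorem HasWeakDeriv.exists_ae_eq {u v : ℝ → EuclideanSpace ℝ (Fin d)} (h : HasWeakDeriv u v) :
    ∃ c, u =ᵐ[muI] fun x => c + ∫ t in (0 : ℝ)..x, v t := by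
  have hw := (isPrimitive_integral h.2.1 0).hasWeakDeriv
  have hz : HasWeakDeriv (u + (-1 : ℝ) • fun x => 0 + ∫ t in (0 : ℝ)..x, v t)
      (v + (-1 : ℝ) • v) := h.add (hw.smul (-1))
  obtain ⟨c, hc⟩ := ae_eq_const_of_forall_deriv hz.1 fun g hg => by
    rw [hz.2.2 g hg]; simp
  refine ⟨c, ?_⟩
  filter_upwards [hc] with x hx
  rw [← hx]
  simp

theorem eqOn_Icc_of_ae_eq {u w : ℝ → EuclideanSpace ℝ (Fin d)}
    (hu : ContinuousOn u (Icc 0 1)) (hw : ContinuousOn w (Icc 0 1)) (h : u =ᵐ[muI] w) :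
    ∀ x ∈ Icc (0 : ℝ) 1, u x = w x :=
  Measure.eqOn_Icc_of_ae_eq volume zero_ne_one h hu hw

end WeakDeriv

end ElasticCurve

namespace ElasticCurve

/-! ### Continuous representatives in Sobolev spaces -/

section Representatives

variable {d : ℕ}

/-- Integrate down from the top derivative. Extending the top one by zero outside `I` makes it
integrable on `ℝ`, so the successive primitives are continuous on all of `ℝ` and the derivatives are
two-sided even at the ends of `I`. -/
theorem exists_representatives (n : ℕ) : ∀ (u : ℕ → ℝ → EuclideanSpace ℝ (Fin d)),
    (∀ j < n, HasWeakDeriv (u j) (u (j + 1))) → Integrable (u n) muI →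
    ∃ w : ℕ → ℝ → EuclideanSpace ℝ (Fin d), (∀ j ≤ n, w j =ᵐ[muI] u j) ∧
      (∀ j < n, IsPrimitive (w j) (w (j + 1))) ∧ (∀ j < n, Continuous (w j)) ∧
      (∀ j, j + 1 < n → ∀ x, HasDerivAt (w j) (w (j + 1) x) x) ∧
      ∀ j ≤ n, ∀ a b, IntervalIntegrable (w j) volume a b := by
  induction n with
  | zero =>
    intro u _ hu
    have hi : Integrable ((Icc (0 : ℝ) 1).indicator (u 0)) volume :=
      (integrable_indicator_iff measurableSet_Icc).mpr hu
    refine ⟨fun _ => (Icc (0 : ℝ) 1).indicator (u 0), ?_, by simp, by simp, by simp,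
      fun j _ a b => hi.intervalIntegrable⟩
    intro j hj
    obtain rfl : j = 0 := by omega
    exact indicator_ae_eq_restrict measurableSet_Icc
  | succ n ih =>
    intro u hu hui
    obtain ⟨w, h1, h2, h3, h4, h5⟩ := ih (fun j => u (j + 1))
      (fun j hj => hu (j + 1) (by omega)) hui
    obtain ⟨c, hc⟩ := ((hu 0 (by omega)).congr (EventuallyEq.refl _ _)
      (h1 0 (by omega)).symm).exists_ae_eq
    set p : ℝ → EuclideanSpace ℝ (Fin d) := fun x => c + ∫ t in (0 : ℝ)..x, w 0 t with hp
    have hpc : Continuous p :=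
      continuous_const.add (intervalIntegral.continuous_primitive (h5 0 (by omega)) 0)
    refine ⟨fun j => Nat.casesOn j p w, ?_, ?_, ?_, ?_, ?_⟩
    · rintro (_ | j) hj
      · exact hc.symm
      · exact h1 j (by omega)
    · rintro (_ | j) hj
      · exact isPrimitive_integral ((hu 0 (by omega)).2.1.congr (h1 0 (by omega)).symm) c
      · exact h2 j (by omega)
    · rintro (_ | j) hj
      · exact hpc
      · exact h3 j (by omega)
    · rintro (_ | j) hj x
      · have hw : Continuous (w 0) := h3 0 (by omega)
        exact (intervalIntegral.integral_hasDerivAt_right (hw.intervalIntegrable _ _)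
          (hw.stronglyMeasurableAtFilter _ _) hw.continuousAt).const_add _
      · exact h4 j (by omega) x
    · rintro (_ | j) hj a b
      · exact hpc.intervalIntegrable a b
      · exact h5 j (by omega) a b

theorem L2.integrable (u : L2 d) : Integrable u muI :=
  (Lp.memLp u).integrable (by norm_num)

variable {k : ℕ}

/-- The weak derivatives of an element of `Hᵏ`, indexed by all natural numbers. -/
def Sobolev.wderivNat (U : Sobolev d k) (j : ℕ) : ℝ → EuclideanSpace ℝ (Fin d) :=
  if h : j < k + 1 then U.wderiv ⟨j, h⟩ else 0

theorem Sobolev.wderivNat_eq (U : Sobolev d k) (j : Fin (k + 1)) :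
    U.wderivNat j = U.wderiv j := by
  rw [Sobolev.wderivNat, dif_pos j.2]

theorem Sobolev.exists_rep (U : Sobolev d k) :
    ∃ w : ℕ → ℝ → EuclideanSpace ℝ (Fin d), (∀ j ≤ k, w j =ᵐ[muI] U.wderivNat j) ∧
      (∀ j < k, IsPrimitive (w j) (w (j + 1))) ∧ (∀ j < k, Continuous (w j)) ∧
      (∀ j, j + 1 < k → ∀ x, HasDerivAt (w j) (w (j + 1) x) x) ∧
      ∀ j ≤ k, ∀ a b, IntervalIntegrable (w j) volume a b := by
  refine exists_representatives k _ (fun j hj => ?_) ?_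
  · have := U.hasWeakDeriv ⟨j, hj⟩
    have h1 := U.wderivNat_eq (Fin.castSucc ⟨j, hj⟩)
    have h2 := U.wderivNat_eq (Fin.succ ⟨j, hj⟩)
    simp only [Fin.val_castSucc, Fin.val_succ] at h1 h2
    rwa [h1, h2]
  · have := U.wderivNat_eq (Fin.last k)
    rw [Fin.val_last] at this
    rw [this]
    exact L2.integrable _

/-- The representatives of the derivatives of `U ∈ Hᵏ`: for `j < k` the function `U.rep j` is
continuous on `ℝ`, and for `j + 1 < k` its derivative is `U.rep (j + 1)`. -/
def Sobolev.rep (U : Sobolev d k) : ℕ → ℝ → EuclideanSpace ℝ (Fin d) := U.exists_rep.choose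

theorem Sobolev.rep_ae_eq (U : Sobolev d k) (j : Fin (k + 1)) :
    U.rep j =ᵐ[muI] U.wderiv j := by
  rw [← U.wderivNat_eq]
  exact U.exists_rep.choose_spec.1 j (by omega)

theorem Sobolev.rep_isPrimitive (U : Sobolev d k) {j : ℕ} (hj : j < k) :
    IsPrimitive (U.rep j) (U.rep (j + 1)) := U.exists_rep.choose_spec.2.1 j hj

theorem Sobolev.rep_continuous (U : Sobolev d k) {j : ℕ} (hj : j < k) :
    Continuous (U.rep j) := U.exists_rep.choose_spec.2.2.1 j hj

theorem Sobolev.rep_hasDerivAt (U : Sobolev d k) {j : ℕ} (hj : j + 1 < k) (x : ℝ) :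
    HasDerivAt (U.rep j) (U.rep (j + 1) x) x := U.exists_rep.choose_spec.2.2.2.1 j hj x

theorem Sobolev.rep_zero_ae_eq (U : Sobolev d k) :
    U.rep 0 =ᵐ[muI] (Sobolev.toL2 d k U : ℝ → EuclideanSpace ℝ (Fin d)) :=
  U.rep_ae_eq 0

theorem Sobolev.rep_ae_eq' (U : Sobolev d k) {j : ℕ} (hj : j < k + 1) :
    U.rep j =ᵐ[muI] U.wderiv ⟨j, hj⟩ := U.rep_ae_eq ⟨j, hj⟩

theorem Sobolev.rep_memLp (U : Sobolev d k) {j : ℕ} (hj : j < k + 1) :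
    MemLp (U.rep j) 2 muI := (Lp.memLp _).ae_eq (U.rep_ae_eq' hj).symm

theorem Sobolev.rep_eq_of_ae_eq (U : Sobolev d k) {j : ℕ} (hj : j < k)
    {w : ℝ → EuclideanSpace ℝ (Fin d)} (hw : ContinuousOn w (Icc 0 1))
    (h : U.wderiv ⟨j, by omega⟩ =ᵐ[muI] w) : ∀ x ∈ Icc (0 : ℝ) 1, U.rep j x = w x :=
  eqOn_Icc_of_ae_eq (U.rep_continuous hj).continuousOn hw ((U.rep_ae_eq' (by omega)).trans h)

theorem Sobolev.rep_add (U W : Sobolev d k) {j : ℕ} (hj : j < k) :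
    ∀ x ∈ Icc (0 : ℝ) 1, (U + W).rep j x = U.rep j x + W.rep j x := by
  refine (U + W).rep_eq_of_ae_eq hj
    ((U.rep_continuous hj).add (W.rep_continuous hj)).continuousOn ?_
  filter_upwards [U.rep_ae_eq' (j := j) (by omega), W.rep_ae_eq' (j := j) (by omega),
    Lp.coeFn_add (U.wderiv ⟨j, by omega⟩) (W.wderiv ⟨j, by omega⟩)] with x h1 h2 h3
  rw [h1, h2]
  exact h3

theorem Sobolev.rep_smul (c : ℝ) (U : Sobolev d k) {j : ℕ} (hj : j < k) :
    ∀ x ∈ Icc (0 : ℝ) 1, (c • U).rep j x = c • U.rep j x := by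
  refine (c • U).rep_eq_of_ae_eq hj ((U.rep_continuous hj).const_smul c).continuousOn ?_
  filter_upwards [U.rep_ae_eq' (j := j) (by omega),
    Lp.coeFn_smul c (U.wderiv ⟨j, by omega⟩)] with x h1 h3
  rw [h1]
  exact h3

/-- Cauchy–Schwarz on the interval between `x` and `y`. It supplies the Hölder-1/2 modulus needed
for equicontinuity. -/
theorem norm_intervalIntegral_le_sqrt {v : ℝ → EuclideanSpace ℝ (Fin d)} (hv : MemLp v 2 muI)
    {x y : ℝ} (hx : x ∈ Icc (0 : ℝ) 1) (hy : y ∈ Icc (0 : ℝ) 1) :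
    ‖∫ t in x..y, v t‖ ≤ (eLpNorm v 2 muI).toReal * √|y - x| := by
  have hsub : uIoc x y ⊆ Icc (0 : ℝ) 1 := fun t ht =>
    (uIoc_subset_uIcc.trans (uIcc_subset_Icc hx hy)) ht
  have hle : volume.restrict (uIoc x y) ≤ muI := Measure.restrict_mono hsub le_rfl
  have hv' : MemLp v 2 (volume.restrict (uIoc x y)) := hv.mono_measure hle
  have hvol : volume.restrict (uIoc x y) univ = ENNReal.ofReal |y - x| := by
    rw [Measure.restrict_apply_univ, uIoc, Real.volume_Ioc, max_sub_min_eq_abs]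
  have hfin : IsFiniteMeasure (volume.restrict (uIoc x y)) := ⟨by rw [hvol]; simp⟩
  refine intervalIntegral.norm_integral_le_integral_norm_uIoc.trans ?_
  rw [integral_norm_eq_lintegral_enorm hv'.aestronglyMeasurable, ← eLpNorm_one_eq_lintegral_enorm]
  have h1 := eLpNorm_le_eLpNorm_mul_rpow_measure_univ (p := 1) (q := 2) (by norm_num)
    hv'.aestronglyMeasurable
  have h2 : eLpNorm v 1 (volume.restrict (uIoc x y)) ≤
      eLpNorm v 2 muI * ENNReal.ofReal (√|y - x|) := by
    refine h1.trans ?_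
    refine mul_le_mul' (eLpNorm_mono_measure v hle) ?_
    · rw [hvol, Real.sqrt_eq_rpow, ENNReal.ofReal_rpow_of_nonneg (abs_nonneg _) (by norm_num)]
      norm_num
  have h3 := ENNReal.toReal_mono (ENNReal.mul_ne_top hv.eLpNorm_ne_top ENNReal.ofReal_ne_top) h2
  rwa [ENNReal.toReal_mul, ENNReal.toReal_ofReal (Real.sqrt_nonneg _)] at h3

theorem integral_norm_le_norm (u : L2 d) : ∫ x, ‖u x‖ ∂muI ≤ ‖u‖ := by
  have hp : muI univ = 1 := by simp [muI]
  have : IsProbabilityMeasure muI := ⟨hp⟩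
  rw [Lp.norm_def, integral_norm_eq_lintegral_enorm (Lp.aestronglyMeasurable u), ← eLpNorm_one_eq_lintegral_enorm]
  exact ENNReal.toReal_mono (Lp.memLp u).eLpNorm_ne_top
    (eLpNorm_le_eLpNorm_of_exponent_le (by norm_num) (Lp.aestronglyMeasurable u))

theorem Sobolev.norm_wderiv_le (U : Sobolev d k) (j : Fin (k + 1)) : ‖U.wderiv j‖ ≤ ‖U‖ := by
  rw [U.norm_eq]
  exact Finset.single_le_sum (f := fun j => ‖U.wderiv j‖) (fun _ _ => norm_nonneg _)
    (Finset.mem_univ j)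

theorem Sobolev.norm_rep_sub_le (U : Sobolev d k) {j : ℕ} (hj : j < k) {x y : ℝ}
    (hx : x ∈ Icc (0 : ℝ) 1) (hy : y ∈ Icc (0 : ℝ) 1) :
    ‖U.rep j y - U.rep j x‖ ≤ ‖U.wderiv ⟨j + 1, by omega⟩‖ * √|y - x| := by
  rw [(U.rep_isPrimitive hj).sub_eq hx hy]
  refine (norm_intervalIntegral_le_sqrt (U.rep_memLp (by omega)) hx hy).trans (le_of_eq ?_)
  rw [Lp.norm_def, eLpNorm_congr_ae (U.rep_ae_eq' (by omega))]

theorem integral_norm_rep_le (U : Sobolev d k) {j : ℕ} (hj : j < k + 1) :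
    ∫ x, ‖U.rep j x‖ ∂muI ≤ ‖U.wderiv ⟨j, hj⟩‖ := by
  refine le_trans (le_of_eq (integral_congr_ae ?_)) (integral_norm_le_norm _)
  filter_upwards [U.rep_ae_eq' hj] with x hx
  rw [hx]

/-- The Sobolev inequality. -/
theorem Sobolev.norm_rep_le (U : Sobolev d k) {j : ℕ} (hj : j < k) {x : ℝ}
    (hx : x ∈ Icc (0 : ℝ) 1) : ‖U.rep j x‖ ≤ ‖U‖ := by
  have hi := integrable_muI_of_continuousOn (U.rep_continuous hj).continuousOn
  -- The pointwise bound is averaged over `y ∈ I`, which has length one; this leaves the `L²` norms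
  -- of two consecutive derivatives, two of the summands of `‖U‖`.
  have h1 : ∀ y ∈ Icc (0 : ℝ) 1, ‖U.rep j x‖ ≤ ‖U.rep j y‖ + ‖U.wderiv ⟨j + 1, by omega⟩‖ := by
    intro y hy
    have := U.norm_rep_sub_le hj hy hx
    have h2 : √|x - y| ≤ 1 := by
      rw [Real.sqrt_le_one, abs_le]
      constructor <;> linarith [hx.1, hx.2, hy.1, hy.2]
    have h3 := norm_le_norm_add_norm_sub' (U.rep j x) (U.rep j y)
    nlinarith [norm_nonneg (U.wderiv ⟨j + 1, by omega⟩)]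
  have h2 : ∫ _, ‖U.rep j x‖ ∂muI ≤ ∫ y, (‖U.rep j y‖ + ‖U.wderiv ⟨j + 1, by omega⟩‖) ∂muI := by
    refine integral_mono_ae (integrable_const _) (hi.norm.add (integrable_const _)) ?_
    filter_upwards [ae_restrict_mem measurableSet_Icc] with y hy
    exact h1 y hy
  rw [integral_add hi.norm (integrable_const _), integral_const, integral_const] at h2
  simp only [muI, Measure.real, Measure.restrict_apply_univ, Real.volume_Icc, sub_zero,
    ENNReal.ofReal_one, ENNReal.toReal_one, one_smul] at h2
  refine h2.trans ?_
  have h3 := integral_norm_rep_le U (j := j) (by omega)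
  have h4 : ‖U.wderiv ⟨j, by omega⟩‖ + ‖U.wderiv ⟨j + 1, by omega⟩‖ ≤ ‖U‖ := by
    rw [U.norm_eq]
    have hne : (⟨j, by omega⟩ : Fin (k + 1)) ≠ ⟨j + 1, by omega⟩ := by
      simp [Fin.ext_iff]
    rw [← Finset.sum_pair (f := fun i => ‖U.wderiv i‖) hne]
    exact Finset.sum_le_sum_of_subset_of_nonneg (Finset.subset_univ _)
      fun _ _ _ => norm_nonneg _
  have h3' : ∫ y in Icc 0 1, ‖U.rep j y‖ ≤ ‖U.wderiv ⟨j, by omega⟩‖ := h3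
  linarith

/-- The embedding `U ↦ ∂ₓʲ U` of `Hᵏ` into the continuous functions, for `j < k`. -/
def Sobolev.evalC (d k : ℕ) (j : Fin k) :
    Sobolev d k →L[ℝ] BoundedContinuousFunction (Icc (0 : ℝ) 1) (EuclideanSpace ℝ (Fin d)) :=
  LinearMap.mkContinuous
    { toFun := fun U => BoundedContinuousFunction.mkOfCompact
        ⟨fun x => U.rep j x, (U.rep_continuous j.2).comp continuous_subtype_val⟩
      map_add' := fun U W => by
        ext1 x
        exact U.rep_add W j.2 x x.2
      map_smul' := fun c U => by
        ext1 x
        exact U.rep_smul c j.2 x x.2 } 1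
    (fun U => by
      rw [one_mul]
      refine (BoundedContinuousFunction.norm_le (norm_nonneg _)).mpr fun x => ?_
      exact U.norm_rep_le j.2 x.2)

theorem Sobolev.evalC_apply (U : Sobolev d k) (j : Fin k) (x : Icc (0 : ℝ) 1) :
    Sobolev.evalC d k j U x = U.rep j x := rfl

/-- The Rellich–Kondrachov theorem on the interval. -/
theorem Sobolev.isCompactOperator_evalC (j : Fin k) :
    IsCompactOperator (Sobolev.evalC d k j) := by
  -- Both conditions defining `A` survive pointwise limits, so `A` is closed. It contains the image
  -- of the unit ball and is equicontinuous with modulus `√r`.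
  set A : Set (BoundedContinuousFunction (Icc (0 : ℝ) 1) (EuclideanSpace ℝ (Fin d))) :=
    {h | (∀ x, h x ∈ Metric.closedBall 0 1) ∧ ∀ x y : Icc (0 : ℝ) 1,
      ‖h y - h x‖ ≤ √|(y : ℝ) - x|} with hA
  have hAc : IsClosed A := by
    rw [hA, ofPred_and]
    refine IsClosed.inter ?_ ?_
    · simp only [ofPred_forall]
      exact isClosed_iInter fun x => Metric.isClosed_closedBall.preimage
        (BoundedContinuousFunction.lipschitz_eval_const x).continuous
    · simp only [ofPred_forall]
      exact isClosed_iInter fun x => isClosed_iInter fun y => isClosed_le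
        ((BoundedContinuousFunction.lipschitz_eval_const y).continuous.sub
          (BoundedContinuousFunction.lipschitz_eval_const x).continuous).norm continuous_const
  refine ⟨A, BoundedContinuousFunction.arzela_ascoli₂ _ (isCompact_closedBall _ _) A hAc
    (fun h x hh => hh.1 x) ?_, ?_⟩
  · refine Metric.equicontinuous_of_continuity_modulus (fun r => √r) ?_ _ ?_
    · have : Tendsto (fun r : ℝ => √r) (𝓝 0) (𝓝 (√0)) := Real.continuous_sqrt.tendsto 0
      rwa [Real.sqrt_zero] at this
    · rintro x y ⟨h, hh⟩
      have := hh.2 y x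
      rwa [← dist_eq_norm, ← Real.dist_eq] at this
  · refine mem_of_superset (Metric.closedBall_mem_nhds (0 : Sobolev d k) one_pos) fun U hU => ?_
    have hU1 : ‖U‖ ≤ 1 := by simpa using hU
    refine ⟨fun x => ?_, fun x y => ?_⟩
    · rw [mem_closedBall_zero_iff, Sobolev.evalC_apply]
      exact (U.norm_rep_le j.2 x.2).trans hU1
    · rw [Sobolev.evalC_apply, Sobolev.evalC_apply]
      refine (U.norm_rep_sub_le j.2 x.2 y.2).trans ?_
      have := (U.norm_wderiv_le ⟨j + 1, by omega⟩).trans hU1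
      exact mul_le_of_le_one_left (Real.sqrt_nonneg _) this

/-- All concrete elements of `Hᵏ` below are built this way, by listing a function together with its
derivatives. -/
theorem Sobolev.exists_of_hasWeakDeriv (w : ℕ → ℝ → EuclideanSpace ℝ (Fin d))
    (hm : ∀ j ≤ k, MemLp (w j) 2 muI) (hw : ∀ j < k, HasWeakDeriv (w j) (w (j + 1))) :
    ∃ U : Sobolev d k, ∀ j : Fin (k + 1), U.wderiv j =ᵐ[muI] w j := by
  refine ⟨⟨WithLp.toLp 1 fun j : Fin (k + 1) => (hm j (by omega)).toLp (w j), fun i => ?_⟩,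
    fun j => (hm j (by omega)).coeFn_toLp⟩
  exact (hw i i.2).congr (hm i (by omega)).coeFn_toLp.symm (hm (i + 1) (by omega)).coeFn_toLp.symm

theorem Sobolev.ext_wderiv {U W : Sobolev d k} (h : ∀ j, U.wderiv j = W.wderiv j) : U = W :=
  Subtype.ext (PiLp.ext h)

/-- An element of `Hᵏ` is determined by its underlying function. -/
theorem Sobolev.toL2_injective : Function.Injective (Sobolev.toL2 d k) := by
  intro U W h
  have key : ∀ j (hj : j < k + 1), U.wderiv ⟨j, hj⟩ = W.wderiv ⟨j, hj⟩ := by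
    intro j
    induction j with
    | zero => intro _; exact h
    | succ j ih =>
      intro hj
      have h1 := U.hasWeakDeriv ⟨j, by omega⟩
      have h2 := W.hasWeakDeriv ⟨j, by omega⟩
      have h3 := ih (by omega)
      simp only [Fin.castSucc_mk, Fin.succ_mk] at h1 h2
      rw [h3] at h1
      exact Lp.ext (h1.unique h2)
  exact Sobolev.ext_wderiv fun j => key j j.2

end Representatives

end ElasticCurve

namespace ElasticCurve

/-! ### Multiplication operators -/

section Multiplication

variable {d : ℕ}

theorem L2.norm_le_of_ae {u v : L2 d} {M : ℝ}
    (h : ∀ᵐ x ∂muI, ‖u x‖ ≤ M * ‖v x‖) : ‖u‖ ≤ M * ‖v‖ := Lp.norm_le_mul_norm_of_ae_le_mul h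

theorem memLp_clm_apply {Z Z' : Type*} [NormedAddCommGroup Z] [NormedSpace ℝ Z]
    [NormedAddCommGroup Z'] [NormedSpace ℝ Z'] {C : ℝ → Z →L[ℝ] Z'}
    (hC : ContinuousOn C (Icc 0 1)) {u : ℝ → Z} (hu : MemLp u 2 muI) :
    MemLp (fun x => C x (u x)) 2 muI := by
  obtain ⟨M, hM⟩ := isCompact_Icc.exists_bound_of_continuousOn hC
  refine MemLp.of_le_mul (c := M) hu (aestronglyMeasurable_clm_apply
    (hC.aestronglyMeasurable measurableSet_Icc) hu.1) ?_
  filter_upwards [ae_restrict_mem measurableSet_Icc] with x hx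
  exact (C x).le_of_opNorm_le (hM x hx) _

theorem exists_mulL {C : ℝ → EuclideanSpace ℝ (Fin d) →L[ℝ] EuclideanSpace ℝ (Fin d)}
    (hC : ContinuousOn C (Icc 0 1)) :
    ∃ T : L2 d →L[ℝ] L2 d, ∀ u, T u =ᵐ[muI] fun x => C x (u x) := by
  obtain ⟨M, hM⟩ := isCompact_Icc.exists_bound_of_continuousOn hC
  refine ⟨LinearMap.mkContinuous
    { toFun := fun u => (memLp_clm_apply hC (Lp.memLp u)).toLp
      map_add' := fun u v => ?_
      map_smul' := fun c u => ?_ } M (fun u => ?_), fun u => ?_⟩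
  · refine Lp.ext ?_
    filter_upwards [(memLp_clm_apply hC (Lp.memLp u)).coeFn_toLp,
      (memLp_clm_apply hC (Lp.memLp v)).coeFn_toLp,
      (memLp_clm_apply hC (Lp.memLp (u + v))).coeFn_toLp, Lp.coeFn_add u v,
      Lp.coeFn_add (memLp_clm_apply hC (Lp.memLp u)).toLp
        (memLp_clm_apply hC (Lp.memLp v)).toLp] with x h1 h2 h3 h4 h5
    rw [h3, h5, Pi.add_apply, h1, h2, h4, Pi.add_apply, map_add]
  · refine Lp.ext ?_
    filter_upwards [(memLp_clm_apply hC (Lp.memLp u)).coeFn_toLp,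
      (memLp_clm_apply hC (Lp.memLp (c • u))).coeFn_toLp, Lp.coeFn_smul c u,
      Lp.coeFn_smul c (memLp_clm_apply hC (Lp.memLp u)).toLp] with x h1 h2 h3 h4
    rw [h2, RingHom.id_apply, h4, Pi.smul_apply, h1, h3, Pi.smul_apply, map_smul]
  · refine L2.norm_le_of_ae ?_
    filter_upwards [(memLp_clm_apply hC (Lp.memLp u)).coeFn_toLp,
      ae_restrict_mem measurableSet_Icc] with x h1 hx
    simp only [LinearMap.coe_mk, AddHom.coe_mk, h1]
    exact (C x).le_of_opNorm_le (hM x hx) _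
  · exact (memLp_clm_apply hC (Lp.memLp u)).coeFn_toLp

/-- Multiplication by a continuous family of operators on `I`, as an operator on `L²`
(`0` by convention if the family is not continuous). -/
def mulL (C : ℝ → EuclideanSpace ℝ (Fin d) →L[ℝ] EuclideanSpace ℝ (Fin d)) : L2 d →L[ℝ] L2 d :=
  open Classical in if hC : ContinuousOn C (Icc 0 1) then (exists_mulL hC).choose else 0

theorem mulL_ae_eq {C : ℝ → EuclideanSpace ℝ (Fin d) →L[ℝ] EuclideanSpace ℝ (Fin d)}
    (hC : ContinuousOn C (Icc 0 1)) (u : L2 d) : mulL C u =ᵐ[muI] fun x => C x (u x) := by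
  rw [mulL, dif_pos hC]
  exact (exists_mulL hC).choose_spec u

theorem memLp_clm_apply_bcf {C : ℝ → EuclideanSpace ℝ (Fin d) →L[ℝ] EuclideanSpace ℝ (Fin d)}
    (hC : MemLp C 2 muI)
    (h : BoundedContinuousFunction (Icc (0 : ℝ) 1) (EuclideanSpace ℝ (Fin d))) :
    MemLp (fun x => C x (IccExtend zero_le_one h x)) 2 muI := by
  have hc : Continuous (IccExtend zero_le_one h) := h.continuous.Icc_extend'
  refine MemLp.of_le_mul (c := ‖h‖) hC (aestronglyMeasurable_clm_apply hC.1
    hc.aestronglyMeasurable) (Eventually.of_forall fun x => ?_)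
  rw [mul_comm]
  exact (C x).le_opNorm_of_le (h.norm_coe_le_norm _)

/-- The argument is bounded, so an `L²` coefficient is enough. This is needed where a coefficient
contains a top derivative of the curve that is merely square integrable. -/
theorem exists_mulC {C : ℝ → EuclideanSpace ℝ (Fin d) →L[ℝ] EuclideanSpace ℝ (Fin d)}
    (hC : MemLp C 2 muI) :
    ∃ T : BoundedContinuousFunction (Icc (0 : ℝ) 1) (EuclideanSpace ℝ (Fin d)) →L[ℝ] L2 d,
      ∀ h, T h =ᵐ[muI] fun x => C x (IccExtend zero_le_one h x) := by
  refine ⟨LinearMap.mkContinuous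
    { toFun := fun h => (memLp_clm_apply_bcf hC h).toLp
      map_add' := fun u v => ?_
      map_smul' := fun c u => ?_ } ((eLpNorm C 2 muI).toReal) (fun u => ?_), fun u => ?_⟩
  · refine Lp.ext ?_
    filter_upwards [(memLp_clm_apply_bcf hC u).coeFn_toLp,
      (memLp_clm_apply_bcf hC v).coeFn_toLp,
      (memLp_clm_apply_bcf hC (u + v)).coeFn_toLp,
      Lp.coeFn_add (memLp_clm_apply_bcf hC u).toLp
        (memLp_clm_apply_bcf hC v).toLp] with x h1 h2 h3 h5
    rw [h3, h5, Pi.add_apply, h1, h2, ← map_add]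
    rfl
  · refine Lp.ext ?_
    filter_upwards [(memLp_clm_apply_bcf hC u).coeFn_toLp,
      (memLp_clm_apply_bcf hC (c • u)).coeFn_toLp,
      Lp.coeFn_smul c (memLp_clm_apply_bcf hC u).toLp] with x h1 h2 h4
    rw [h2, RingHom.id_apply, h4, Pi.smul_apply, h1, ← map_smul]
    rfl
  · simp only [LinearMap.coe_mk, AddHom.coe_mk]
    have h1 : eLpNorm (fun x => C x (IccExtend zero_le_one u x)) 2 muI ≤
        ENNReal.ofReal ‖u‖ * eLpNorm C 2 muI := by
      refine eLpNorm_le_mul_eLpNorm_of_ae_le_mul (Eventually.of_forall fun x => ?_) 2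
      rw [mul_comm]
      exact (C x).le_opNorm_of_le (u.norm_coe_le_norm _)
    rw [Lp.norm_toLp]
    have h2 := ENNReal.toReal_mono (ENNReal.mul_ne_top ENNReal.ofReal_ne_top hC.eLpNorm_ne_top) h1
    rwa [ENNReal.toReal_mul, ENNReal.toReal_ofReal (norm_nonneg _), mul_comm] at h2
  · exact (memLp_clm_apply_bcf hC u).coeFn_toLp

/-- Multiplication by a square integrable family of operators, from the continuous functions on
`I` to `L²` (`0` by convention if the family is not square integrable). -/
def mulC (C : ℝ → EuclideanSpace ℝ (Fin d) →L[ℝ] EuclideanSpace ℝ (Fin d)) :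
    BoundedContinuousFunction (Icc (0 : ℝ) 1) (EuclideanSpace ℝ (Fin d)) →L[ℝ] L2 d :=
  open Classical in if hC : MemLp C 2 muI then (exists_mulC hC).choose else 0

variable {k : ℕ}

/-- The operator `U ↦ C ∂ₓʲ U` from `Hᵏ` to `L²`, for `j < k` and `C` in `L²`. -/
def lowerOp (C : ℝ → EuclideanSpace ℝ (Fin d) →L[ℝ] EuclideanSpace ℝ (Fin d)) (j : Fin k) :
    Sobolev d k →L[ℝ] L2 d := (mulC C).comp (Sobolev.evalC d k j)

theorem lowerOp_ae_eq {C : ℝ → EuclideanSpace ℝ (Fin d) →L[ℝ] EuclideanSpace ℝ (Fin d)}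
    (hC : MemLp C 2 muI) (j : Fin k) (U : Sobolev d k) :
    lowerOp C j U =ᵐ[muI] fun x => C x (U.rep j x) := by
  have h := (exists_mulC hC).choose_spec (Sobolev.evalC d k j U)
  rw [lowerOp, mulC, dif_pos hC]
  filter_upwards [h, ae_restrict_mem measurableSet_Icc] with x h1 hx
  rw [ContinuousLinearMap.comp_apply, h1, IccExtend_of_mem _ _ hx]
  rfl

/-- The operator factors through the compact embedding of `Hᵏ` by `∂ₓʲ` into the continuous
functions. Every term of order below four is absorbed as a compact perturbation through this lemma.
-/
theorem isCompactOperator_lowerOp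
    (C : ℝ → EuclideanSpace ℝ (Fin d) →L[ℝ] EuclideanSpace ℝ (Fin d)) (j : Fin k) :
    IsCompactOperator (lowerOp C j) :=
  (Sobolev.isCompactOperator_evalC j).clm_comp (mulC C)

theorem memLp_of_continuousOn {E : Type*} [NormedAddCommGroup E] {u : ℝ → E}
    (h : ContinuousOn u (Icc 0 1)) : MemLp u 2 muI := by
  obtain ⟨M, hM⟩ := isCompact_Icc.exists_bound_of_continuousOn h
  refine MemLp.of_bound (h.aestronglyMeasurable measurableSet_Icc) M ?_
  filter_upwards [ae_restrict_mem measurableSet_Icc] with x hx using hM x hx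

/-- The operator `U ↦ ∂ₓⁱ U` from `Hᵏ` to `L²`. -/
def Sobolev.wderivL (d k : ℕ) (i : Fin (k + 1)) : Sobolev d k →L[ℝ] L2 d :=
  LinearMap.mkContinuous
    { toFun := fun U => U.wderiv i
      map_add' := fun _ _ => rfl
      map_smul' := fun _ _ => rfl } 1 fun U => by
    rw [one_mul]; exact U.norm_wderiv_le i

theorem Sobolev.wderivL_apply (i : Fin (k + 1)) (U : Sobolev d k) :
    Sobolev.wderivL d k i U = U.wderiv i := rfl

end Multiplication

/-! ### Completeness -/

section Complete

variable {d k : ℕ}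

/-- Integration against a continuous weight, as an operator on `L²`. -/
theorem exists_weightedIntegral {g : ℝ → ℝ} (hg : Continuous g) :
    ∃ T : L2 d →L[ℝ] EuclideanSpace ℝ (Fin d), ∀ u, T u = ∫ x, g x • u x ∂muI := by
  have hC : ContinuousOn (fun x => g x • ContinuousLinearMap.id ℝ (EuclideanSpace ℝ (Fin d)))
    (Icc 0 1) := (hg.smul continuous_const).continuousOn
  have hi : ∀ u : L2 d, Integrable (fun x => g x • u x) muI := fun u => by
    simpa using integrable_clm_apply hC (L2.integrable u)
  refine ⟨LinearMap.mkContinuous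
    { toFun := fun u => ∫ x, mulL (fun x => g x • ContinuousLinearMap.id ℝ _) u x ∂muI
      map_add' := fun u v => ?_
      map_smul' := fun c u => ?_ }
      ‖mulL (d := d) (fun x => g x • ContinuousLinearMap.id ℝ _)‖ fun u => ?_, fun u => ?_⟩
  · rw [← integral_add (L2.integrable _) (L2.integrable _), map_add]
    exact integral_congr_ae (Lp.coeFn_add _ _)
  · rw [RingHom.id_apply, ← integral_smul, map_smul]
    exact integral_congr_ae (Lp.coeFn_smul _ _)
  · exact (norm_integral_le_integral_norm _).trans
      ((integral_norm_le_norm _).trans (ContinuousLinearMap.le_opNorm _ _))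
  · refine integral_congr_ae ?_
    filter_upwards [mulL_ae_eq hC u] with x hx
    rw [hx]; rfl

/-- For each fixed test function the defining identity equates two expressions continuous in `L²`.
Completeness of `Hᵏ` follows, and with it the bounded inverse theorem becomes available. -/
theorem isClosed_hasWeakDeriv {E : Type*} [TopologicalSpace E] {u v : E → L2 d}
    (hu : Continuous u) (hv : Continuous v) : IsClosed {e | HasWeakDeriv (u e) (v e)} := by
  have : {e | HasWeakDeriv (u e) (v e)} = ⋂ φ : {φ : ℝ → ℝ // IsTestFunction φ},
      {e | ∫ x, deriv φ.1 x • u e x ∂muI = - ∫ x, φ.1 x • v e x ∂muI} := by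
    ext e
    simp only [mem_ofPred_eq, mem_iInter, Subtype.forall]
    exact ⟨fun h => h.2.2, fun h => ⟨L2.integrable _, L2.integrable _, h⟩⟩
  rw [this]
  refine isClosed_iInter fun φ => ?_
  obtain ⟨T, hT⟩ := exists_weightedIntegral (d := d) φ.2.1.continuous
  obtain ⟨T', hT'⟩ := exists_weightedIntegral (d := d)
    (φ.2.1.continuous_deriv (by simp) : Continuous (deriv φ.1))
  have h1 : {e | ∫ x, deriv φ.1 x • u e x ∂muI = - ∫ x, φ.1 x • v e x ∂muI} =
      {e | T' (u e) = - T (v e)} := by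
    simp only [hT, hT']
  rw [h1]
  exact isClosed_eq (T'.continuous.comp hu) (T.continuous.comp hv).neg

instance (d k : ℕ) : CompleteSpace (Sobolev d k) := by
  have hc : IsClosed (sobolevSubmodule d k : Set (PiLp 1 (fun _ : Fin (k + 1) => L2 d))) := by
    have : (sobolevSubmodule d k : Set (PiLp 1 (fun _ : Fin (k + 1) => L2 d))) =
        ⋂ i : Fin k, {U | HasWeakDeriv (U i.castSucc) (U i.succ)} := by
      ext U
      simp only [mem_iInter]
      rfl
    rw [this]
    exact isClosed_iInter fun i => isClosed_hasWeakDeriv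
      (PiLp.continuous_apply 1 _ i.castSucc) (PiLp.continuous_apply 1 _ i.succ)
  exact hc.completeSpace_coe

end Complete

end ElasticCurve

namespace ElasticCurve

/-! ### Boundary values -/

section BoundaryValues

variable {d k : ℕ}

theorem rep_ae_eq_of_hasWeakDeriv (U : Sobolev d k) {w : ℕ → ℝ → EuclideanSpace ℝ (Fin d)}
    {n : ℕ} (h0 : U.rep 0 =ᵐ[muI] w 0) (hw : ∀ j < n, HasWeakDeriv (w j) (w (j + 1))) :
    ∀ j, j ≤ k → j ≤ n → U.rep j =ᵐ[muI] w j := by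
  intro j
  induction j with
  | zero => exact fun _ _ => h0
  | succ j ih =>
    intro hk hn
    have h1 := (U.rep_isPrimitive (j := j) (by omega)).hasWeakDeriv
    exact (h1.congr (ih (by omega) (by omega)) (EventuallyEq.refl _ _)).unique (hw j (by omega))

/-- Integration by parts with one `C¹` factor and one merely absolutely continuous factor: the
product rule for the family of functionals `⟨h x, ·⟩`. -/
theorem integral_inner_add_eq {h h' r s : ℝ → EuclideanSpace ℝ (Fin d)}
    (hh : ∀ x ∈ Icc (0 : ℝ) 1, HasDerivAt h (h' x) x) (hc : ContinuousOn h' (Icc 0 1))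
    (hr : IsPrimitive r s) :
    ∫ x, (inner ℝ (h' x) (r x) + inner ℝ (h x) (s x)) ∂muI =
      inner ℝ (h 1) (r 1) - inner ℝ (h 0) (r 0) := by
  have key := IsPrimitive.clm_apply (C := fun x => innerSL ℝ (h x))
    (C' := fun x => innerSL ℝ (h' x))
    (fun x hx => ((innerSL ℝ).hasFDerivAt.comp_hasDerivAt x (hh x hx)))
    ((innerSL ℝ).continuous.comp_continuousOn hc) hr
  exact key.intervalIntegral_eq

theorem integrable_inner_of_continuousOn {h s : ℝ → EuclideanSpace ℝ (Fin d)}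
    (hh : ContinuousOn h (Icc 0 1)) (hs : Integrable s muI) :
    Integrable (fun x => inner ℝ (h x) (s x)) muI :=
  integrable_clm_apply (C := fun x => innerSL ℝ (h x))
    ((innerSL ℝ).continuous.comp_continuousOn hh) hs

/-- Du Bois-Reymond at second order. Correcting `g` by a multiple of `χ` makes it the derivative of
a test function, so `∫ g' y` depends only on the mean of `g`. Hence `y` has a constant weak
derivative. -/
theorem exists_affine_of_forall_deriv_deriv {y : ℝ → EuclideanSpace ℝ (Fin d)}
    (hy : Integrable y muI)
    (h : ∀ g : ℝ → ℝ, IsTestFunction g → ∫ x, deriv (deriv g) x • y x ∂muI = 0) :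
    ∃ a b : EuclideanSpace ℝ (Fin d), y =ᵐ[muI] fun x => a + x • b := by
  obtain ⟨χ, hχ, hχ1⟩ := exists_isTestFunction_integral_eq_one
  set c := ∫ x, deriv χ x • y x ∂muI with hc
  have hw : HasWeakDeriv y fun _ => -c := by
    refine ⟨hy, integrable_const _, fun g hg => ?_⟩
    set m := ∫ x in (0 : ℝ)..1, g x with hm
    have hg' : IsTestFunction (fun x => g x - χ x • m) := hg.sub_smul hχ m
    have i1 : IntervalIntegrable g volume 0 1 := hg.1.continuous.intervalIntegrable _ _
    have i2 : IntervalIntegrable χ volume 0 1 := hχ.1.continuous.intervalIntegrable _ _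
    have h0 : ∫ x in (0 : ℝ)..1, (g x - χ x • m) = 0 := by
      rw [intervalIntegral.integral_sub i1 (by simpa using i2.mul_const m)]
      simp [hχ1, hm]
    obtain ⟨hp, hpd⟩ := hg'.primitive h0
    have h1 := h _ hp
    have hd : deriv (fun x => ∫ t in (0 : ℝ)..x, (g t - χ t • m)) = fun x => g x - χ x • m :=
      funext fun x => (hpd x).deriv
    rw [hd] at h1
    have hdg : ∀ x, deriv (fun x => g x - χ x • m) x = deriv g x - m * deriv χ x := fun x => by
      have h1 : HasDerivAt g (deriv g x) x := (hg.1.differentiable (by simp) x).hasDerivAt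
      have h2 : HasDerivAt χ (deriv χ x) x := (hχ.1.differentiable (by simp) x).hasDerivAt
      have := (h1.sub (h2.smul_const m)).deriv
      rw [mul_comm]
      exact this
    have h2 : ∫ x, (deriv g x • y x - m • (deriv χ x • y x)) ∂muI = 0 := by
      rw [← h1]
      refine integral_congr_ae (Eventually.of_forall fun x => ?_)
      simp only [hdg, sub_smul, smul_smul]
    have i3 : Integrable (fun x => m • (deriv χ x • y x)) muI :=
      (hχ.integrable_deriv_smul hy).smul m
    rw [integral_sub (hg.integrable_deriv_smul hy) i3, integral_smul, ← hc, sub_eq_zero] at h2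
    rw [h2, integral_smul_const, setIntegral_muI, smul_neg, neg_neg]
  obtain ⟨a, ha⟩ := hw.exists_ae_eq
  refine ⟨a, -c, ?_⟩
  filter_upwards [ha] with x hx
  rw [hx, intervalIntegral.integral_const, sub_zero]

theorem IsTestFunction.deriv {V : Type*} [NormedAddCommGroup V] [NormedSpace ℝ V] {φ : ℝ → V}
    (h : IsTestFunction φ) : IsTestFunction (deriv φ) :=
  ⟨h.1.deriv' , h.2.1.deriv, tsupport_deriv_subset.trans h.2.2⟩

theorem IsTestFunction.hasDerivAt {V : Type*} [NormedAddCommGroup V] [NormedSpace ℝ V] {φ : ℝ → V}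
    (h : IsTestFunction φ) (x : ℝ) : HasDerivAt φ (_root_.deriv φ x) x :=
  (h.1.differentiable (by simp) x).hasDerivAt

theorem IsTestFunction.isPrimitive {V : Type*} [NormedAddCommGroup V] [NormedSpace ℝ V]
    [CompleteSpace V] {φ : ℝ → V} (h : IsTestFunction φ) : IsPrimitive φ (_root_.deriv φ) :=
  isPrimitive_of_hasDerivAt (fun x _ => h.hasDerivAt x) h.deriv.1.continuous.continuousOn

theorem IsTestFunction.iterate_deriv {V : Type*} [NormedAddCommGroup V] [NormedSpace ℝ V]
    {φ : ℝ → V} (h : IsTestFunction φ) (j : ℕ) : IsTestFunction (_root_.deriv^[j] φ) := by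
  induction j with
  | zero => exact h
  | succ j ih => rw [Function.iterate_succ_apply']; exact ih.deriv

theorem IsTestFunction.exists_sobolev {φ : ℝ → EuclideanSpace ℝ (Fin d)} (h : IsTestFunction φ)
    (k : ℕ) : ∃ U : Sobolev d k, ∀ j : Fin (k + 1), U.wderiv j =ᵐ[muI] _root_.deriv^[j] φ := by
  refine Sobolev.exists_of_hasWeakDeriv (fun j => _root_.deriv^[j] φ) (fun j _ => ?_) fun j _ => ?_
  · exact memLp_of_continuousOn (h.iterate_deriv j).1.continuous.continuousOn
  · rw [Function.iterate_succ_apply']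
    exact (h.iterate_deriv j).isPrimitive.hasWeakDeriv

theorem Sobolev.rep_eq_iterate_deriv (U : Sobolev d k) {φ : ℝ → EuclideanSpace ℝ (Fin d)}
    (h : IsTestFunction φ) (hU : U.rep 0 =ᵐ[muI] φ) {j : ℕ} (hj : j < k) :
    ∀ x ∈ Icc (0 : ℝ) 1, U.rep j x = _root_.deriv^[j] φ x := by
  refine eqOn_Icc_of_ae_eq (U.rep_continuous hj).continuousOn
    (h.iterate_deriv j).1.continuous.continuousOn ?_
  refine rep_ae_eq_of_hasWeakDeriv U (w := fun j => _root_.deriv^[j] φ) (n := k) hU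
    (fun j _ => ?_) j hj.le hj.le
  rw [Function.iterate_succ_apply']
  exact (h.iterate_deriv j).isPrimitive.hasWeakDeriv

/-- The vanishing of a function and of its first derivative at the ends of `I`. -/
def HasZeroBoundary (U : Sobolev d k) : Prop :=
  U.rep 0 0 = 0 ∧ U.rep 0 1 = 0 ∧ U.rep 1 0 = 0 ∧ U.rep 1 1 = 0

theorem isClosed_hasZeroBoundary (hk : 2 ≤ k) :
    IsClosed {U : Sobolev d k | HasZeroBoundary U} := by
  have h : ∀ (j : Fin k) (x : Icc (0 : ℝ) 1), IsClosed {U : Sobolev d k | U.rep j x = 0} :=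
    fun j x => isClosed_eq ((BoundedContinuousFunction.lipschitz_eval_const x).continuous.comp
      (Sobolev.evalC d k j).continuous) continuous_const
  exact (h ⟨0, by omega⟩ ⟨0, zero_mem_I⟩).inter ((h ⟨0, by omega⟩ ⟨1, one_mem_I⟩).inter
    ((h ⟨1, by omega⟩ ⟨0, zero_mem_I⟩).inter (h ⟨1, by omega⟩ ⟨1, one_mem_I⟩)))

/-- Test functions vanish at the ends with all derivatives, and by the Sobolev inequality the
boundary conditions are closed in `Hᵏ` for `k ≥ 2`. -/
theorem hasZeroBoundary_of_mem_SobolevZero (hk : 2 ≤ k) {U : Sobolev d k}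
    (hU : U ∈ SobolevZero d k) : HasZeroBoundary U := by
  have : (SobolevZero d k : Set (Sobolev d k)) ⊆ {U | HasZeroBoundary U} := by
    refine closure_minimal ?_ (isClosed_hasZeroBoundary hk)
    rintro W ⟨φ, hφ, hW⟩
    have h0 : ∀ j < k, _ := fun j hj =>
      W.rep_eq_iterate_deriv hφ (W.rep_zero_ae_eq.trans hW) (j := j) hj
    have hz : ∀ j < k, ∀ x ∈ Icc (0 : ℝ) 1, x ∉ Ioo (0 : ℝ) 1 → W.rep j x = 0 :=
      fun j hj x hx hx' => by rw [h0 j hj x hx, (hφ.iterate_deriv j).eq_zero hx']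
    exact ⟨hz 0 (by omega) 0 zero_mem_I (by simp), hz 0 (by omega) 1 one_mem_I (by simp),
      hz 1 (by omega) 0 zero_mem_I (by simp), hz 1 (by omega) 1 one_mem_I (by simp)⟩
  exact this hU

/-- Poincaré inequality from the left end point. The Hölder bound with `√x ≤ 1` gives the constant
one. -/
theorem Sobolev.norm_wderiv_le_succ (U : Sobolev d k) {j : ℕ} (hj : j < k) (h0 : U.rep j 0 = 0) :
    ‖U.wderiv ⟨j, by omega⟩‖ ≤ ‖U.wderiv ⟨j + 1, by omega⟩‖ := by
  have h : ∀ᵐ x ∂muI, ‖U.wderiv ⟨j, by omega⟩ x‖ ≤ ‖U.wderiv ⟨j + 1, by omega⟩‖ := by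
    filter_upwards [U.rep_ae_eq' (j := j) (by omega), ae_restrict_mem measurableSet_Icc] with x hx hI
    rw [← hx]
    have := U.norm_rep_sub_le hj zero_mem_I hI
    rw [h0, sub_zero, sub_zero] at this
    refine this.trans (mul_le_of_le_one_right (norm_nonneg _) ?_)
    rw [Real.sqrt_le_one, abs_of_nonneg hI.1]
    exact hI.2
  have := Lp.norm_le_of_ae_bound (norm_nonneg _) h
  simpa [muI, measureUnivNNReal] using this

/-- The pairing of an element of `H²` that vanishes to first order at the ends of `I` with an
affine function. -/
theorem integral_inner_affine_eq_zero {U : Sobolev d 2} (hU : HasZeroBoundary U)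
    (a b : EuclideanSpace ℝ (Fin d)) : ∫ x, inner ℝ (a + x • b) (U.rep 2 x) ∂muI = 0 := by
  have h1 : ∀ x : ℝ, HasDerivAt (fun x : ℝ => a + x • b) b x := fun x => by
    simpa using ((hasDerivAt_id x).smul_const b).const_add a
  have e1 := integral_inner_add_eq (fun x _ => h1 x) continuousOn_const
    (U.rep_isPrimitive (j := 1) (by omega))
  have e2 := integral_inner_add_eq (h := fun _ => b) (h' := fun _ => 0)
    (fun x _ => hasDerivAt_const x b) continuousOn_const (U.rep_isPrimitive (j := 0) (by omega))
  simp only [hU.1, hU.2.1, hU.2.2.1, hU.2.2.2, inner_zero_right, inner_zero_left, zero_add,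
    sub_zero] at e1 e2
  have hc : ContinuousOn (fun x : ℝ => a + x • b) (Icc 0 1) :=
    fun x _ => (h1 x).continuousAt.continuousWithinAt
  rw [integral_add (integrable_inner_of_continuousOn continuousOn_const
      (integrable_muI_of_continuousOn (U.rep_continuous (by omega)).continuousOn))
    (integrable_inner_of_continuousOn hc (U.rep_isPrimitive (by omega)).1), e2, zero_add] at e1
  exact e1

/-- Anything orthogonal to all second derivatives of test functions is affine, and `U''` is
orthogonal to affine functions because its boundary values vanish. So `U''` is an `L²` limit of
second derivatives of test functions, and the Poincaré inequality lifts this to convergence in `H²`.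
-/
theorem mem_SobolevZero_of_hasZeroBoundary {U : Sobolev d 2} (hU : HasZeroBoundary U) :
    U ∈ SobolevZero d 2 := by
  set S : Submodule ℝ (L2 d) :=
    (Sobolev.testFunctions d 2).map ((Sobolev.wderivL d 2 2) : Sobolev d 2 →ₗ[ℝ] L2 d) with hS
  have hmem : U.wderiv 2 ∈ S.topologicalClosure := by
    rw [← Submodule.orthogonal_orthogonal_eq_closure, Submodule.mem_orthogonal]
    intro y hy
    obtain ⟨a, b, hab⟩ := exists_affine_of_forall_deriv_deriv (L2.integrable y) fun g hg => by
      refine ext_inner_left ℝ fun v => ?_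
      rw [inner_zero_right]
      have hgv : IsTestFunction (fun x => g x • v) :=
        ⟨hg.1.smul contDiff_const, hg.2.1.smul_right (f' := fun _ => v),
          (tsupport_smul_subset_left g (fun _ => v)).trans hg.2.2⟩
      obtain ⟨W, hW⟩ := hgv.exists_sobolev 2
      have h1 := hy (W.wderiv 2) ⟨W, ⟨_, hgv, hW 0⟩, rfl⟩
      have hdd : _root_.deriv^[2] (fun x => g x • v) =
          fun x => _root_.deriv (_root_.deriv g) x • v := by
        have e1 : _root_.deriv (fun x => g x • v) = fun x => _root_.deriv g x • v :=
          funext fun x => ((hg.hasDerivAt x).smul_const v).deriv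
        have e2 : _root_.deriv (fun x => _root_.deriv g x • v) =
          fun x => _root_.deriv (_root_.deriv g) x • v :=
          funext fun x => ((hg.deriv.hasDerivAt x).smul_const v).deriv
        change _root_.deriv (_root_.deriv (fun x => g x • v)) = _
        rw [e1, e2]
      rw [L2.inner_def] at h1
      rw [← integral_inner (hg.deriv.integrable_deriv_smul (L2.integrable y)), ← h1]
      refine integral_congr_ae ?_
      filter_upwards [hW 2] with x hx
      rw [hx]
      simp only [Fin.val_two, hdd]
      rw [inner_smul_left, inner_smul_right]
      rfl
    rw [L2.inner_def, ← integral_inner_affine_eq_zero hU a b]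
    refine integral_congr_ae ?_
    filter_upwards [hab, U.rep_ae_eq 2] with x h1 h2
    rw [h1, ← h2]
    rfl
  rw [SobolevZero, ← SetLike.mem_coe, Submodule.topologicalClosure_coe, Metric.mem_closure_iff]
  intro ε hε
  rw [← SetLike.mem_coe, Submodule.topologicalClosure_coe, Metric.mem_closure_iff] at hmem
  -- One third for each summand of the `H²` norm, all three being bounded by `‖(U - W)''‖`.
  obtain ⟨_, ⟨W, hW, rfl⟩, hWε⟩ := hmem (ε / 3) (by positivity)
  refine ⟨W, hW, ?_⟩
  have hWz := hasZeroBoundary_of_mem_SobolevZero le_rfl (Submodule.le_topologicalClosure _ hW)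
  have hsub : HasZeroBoundary (U - W) := by
    have h : ∀ j < 2, ∀ x ∈ Icc (0 : ℝ) 1, U.rep j x = 0 → W.rep j x = 0 →
        (U - W).rep j x = 0 := fun j hj x hx h1 h2 => by
      rw [sub_eq_add_neg, ← neg_one_smul ℝ W, Sobolev.rep_add _ _ hj x hx,
        Sobolev.rep_smul _ _ hj x hx, h1, h2]
      simp
    exact ⟨h 0 (by omega) 0 zero_mem_I hU.1 hWz.1, h 0 (by omega) 1 one_mem_I hU.2.1 hWz.2.1,
      h 1 (by omega) 0 zero_mem_I hU.2.2.1 hWz.2.2.1,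
      h 1 (by omega) 1 one_mem_I hU.2.2.2 hWz.2.2.2⟩
  have h0 := (U - W).norm_wderiv_le_succ (j := 0) (by omega) hsub.1
  have h1 := (U - W).norm_wderiv_le_succ (j := 1) (by omega) hsub.2.2.1
  have h2 : ‖(U - W).wderiv 2‖ < ε / 3 := by
    rw [dist_eq_norm] at hWε
    exact hWε
  rw [dist_eq_norm, Sobolev.norm_eq, Fin.sum_univ_three]
  have e0 : (U - W).wderiv ⟨0, by omega⟩ = (U - W).wderiv 0 := rfl
  have e1 : (U - W).wderiv ⟨0 + 1, by omega⟩ = (U - W).wderiv 1 := rfl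
  have e1' : (U - W).wderiv ⟨1, by omega⟩ = (U - W).wderiv 1 := rfl
  have e2 : (U - W).wderiv ⟨1 + 1, by omega⟩ = (U - W).wderiv 2 := rfl
  rw [e0, e1] at h0
  rw [e1', e2] at h1
  linarith

/-- `H⁴_c` consists of the elements of `H⁴` that vanish to first order at the ends of `I`. -/
theorem mem_H4c_iff {U : Sobolev d 4} : U ∈ H4c d ↔ HasZeroBoundary U := by
  have key : ∀ W : Sobolev d 2, Sobolev.toL2 d 2 W = Sobolev.toL2 d 4 U →
      (HasZeroBoundary W ↔ HasZeroBoundary U) := by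
    intro W h
    have h0 : W.rep 0 =ᵐ[muI] U.rep 0 :=
      W.rep_zero_ae_eq.trans ((by rw [h] : (Sobolev.toL2 d 2 W : ℝ → EuclideanSpace ℝ (Fin d))
        =ᵐ[muI] Sobolev.toL2 d 4 U).trans U.rep_zero_ae_eq.symm)
    have h1 : ∀ j < 2, ∀ x ∈ Icc (0 : ℝ) 1, W.rep j x = U.rep j x := fun j hj =>
      eqOn_Icc_of_ae_eq (W.rep_continuous hj).continuousOn
        (U.rep_continuous (by omega)).continuousOn
        (rep_ae_eq_of_hasWeakDeriv W (n := 2) h0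
          (fun i hi => (U.rep_isPrimitive (by omega)).hasWeakDeriv) j (by omega) (by omega))
    unfold HasZeroBoundary
    rw [h1 0 (by omega) 0 zero_mem_I, h1 0 (by omega) 1 one_mem_I, h1 1 (by omega) 0 zero_mem_I,
      h1 1 (by omega) 1 one_mem_I]
  constructor
  · rintro ⟨W, hW, h⟩
    exact (key W h).mp (hasZeroBoundary_of_mem_SobolevZero le_rfl hW)
  · intro hU
    obtain ⟨W, hW⟩ := Sobolev.exists_of_hasWeakDeriv (k := 2) U.rep
      (fun j hj => U.rep_memLp (by omega))
      (fun j hj => (U.rep_isPrimitive (by omega)).hasWeakDeriv)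
    have h : Sobolev.toL2 d 2 W = Sobolev.toL2 d 4 U :=
      Lp.ext ((hW 0).trans U.rep_zero_ae_eq)
    exact ⟨W, mem_SobolevZero_of_hasZeroBoundary ((key W h).mpr hU), h⟩

theorem isClosed_H4c : IsClosed (H4c d : Set (Sobolev d 4)) := by
  have : (H4c d : Set (Sobolev d 4)) = {U | HasZeroBoundary U} := by
    ext U; exact mem_H4c_iff
  rw [this]
  exact isClosed_hasZeroBoundary (by omega)

/-- Coercivity of the bi-Laplacian with clamped boundary conditions. -/
theorem eq_zero_of_inner_wderiv_four {U : Sobolev d 4} (hU : U ∈ H4c d)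
    (h : inner ℝ (U.wderiv 4) (U.wderiv 0) = 0) : U = 0 := by
  obtain ⟨h00, h01, h10, h11⟩ := mem_H4c_iff.mp hU
  have hc : ∀ j < 4, ContinuousOn (U.rep j) (Icc 0 1) := fun j hj =>
    (U.rep_continuous hj).continuousOn
  have hi : ∀ j < 4, Integrable (U.rep j) muI := fun j hj => integrable_muI_of_continuousOn (hc j hj)
  -- Two integrations by parts without boundary terms give `⟨U'''', U⟩ = ‖U''‖²`; the Poincaré
  -- inequality then descends from `U'' = 0` to `U = 0`.
  have e1 := integral_inner_add_eq (fun x _ => U.rep_hasDerivAt (j := 0) (by omega) x)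
    (hc 1 (by omega)) (U.rep_isPrimitive (j := 3) (by omega))
  have e2 := integral_inner_add_eq (fun x _ => U.rep_hasDerivAt (j := 1) (by omega) x)
    (hc 2 (by omega)) (U.rep_isPrimitive (j := 2) (by omega))
  rw [integral_add (integrable_inner_of_continuousOn (hc _ (by omega)) (hi _ (by omega)))
    (integrable_inner_of_continuousOn (hc _ (by omega)) (U.rep_isPrimitive (by omega)).1),
    h00, h01] at e1
  rw [integral_add (integrable_inner_of_continuousOn (hc _ (by omega)) (hi _ (by omega)))
    (integrable_inner_of_continuousOn (hc _ (by omega)) (hi _ (by omega))), h10, h11] at e2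
  simp only [inner_zero_left, sub_zero, zero_add] at e1 e2
  have e3 : ∫ x, inner ℝ (U.rep 0 x) (U.rep 4 x) ∂muI = 0 := by
    rw [← h, L2.inner_def]
    refine integral_congr_ae ?_
    filter_upwards [U.rep_ae_eq 0, U.rep_ae_eq 4] with x h0 h4
    rw [← h0, ← h4, real_inner_comm]
    rfl
  have e4 : inner ℝ (U.wderiv 2) (U.wderiv 2) = 0 := by
    have : inner ℝ (U.wderiv 2) (U.wderiv 2) =
        ∫ x, inner ℝ (U.rep 2 x) (U.rep 2 x) ∂muI := by
      rw [L2.inner_def]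
      refine integral_congr_ae ?_
      filter_upwards [U.rep_ae_eq 2] with x h0
      rw [← h0]; rfl
    rw [this]
    linarith
  have e5 : U.wderiv 2 = 0 := inner_self_eq_zero.mp e4
  have n1 := U.norm_wderiv_le_succ (j := 1) (by omega) h10
  have n0 := U.norm_wderiv_le_succ (j := 0) (by omega) h00
  have f2 : U.wderiv ⟨1 + 1, by omega⟩ = U.wderiv 2 := rfl
  rw [f2, e5, norm_zero] at n1
  have f1 : ‖U.wderiv ⟨0, by omega⟩‖ ≤ 0 := n0.trans n1
  refine Sobolev.toL2_injective ?_
  rw [map_zero]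
  exact norm_le_zero_iff.mp f1

/-- The fourfold primitive of `u` already vanishes to first order at `0`. A cubic with the same
property corrects the data at `1` without changing the fourth derivative. -/
theorem exists_H4c_wderiv_four (u : L2 d) : ∃ U ∈ H4c d, U.wderiv 4 = u := by
  set p3 : ℝ → EuclideanSpace ℝ (Fin d) := fun x => 0 + ∫ t in (0 : ℝ)..x, u t with hp3
  have P3 : IsPrimitive p3 u := isPrimitive_integral (L2.integrable u) 0
  set p2 : ℝ → EuclideanSpace ℝ (Fin d) := fun x => 0 + ∫ t in (0 : ℝ)..x, p3 t with hp2
  have P2 : IsPrimitive p2 p3 := isPrimitive_integral (integrable_muI_of_continuousOn P3.continuousOn) 0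
  set p1 : ℝ → EuclideanSpace ℝ (Fin d) := fun x => 0 + ∫ t in (0 : ℝ)..x, p2 t with hp1
  have P1 : IsPrimitive p1 p2 := isPrimitive_integral (integrable_muI_of_continuousOn P2.continuousOn) 0
  set p0 : ℝ → EuclideanSpace ℝ (Fin d) := fun x => 0 + ∫ t in (0 : ℝ)..x, p1 t with hp0
  have P0 : IsPrimitive p0 p1 := isPrimitive_integral (integrable_muI_of_continuousOn P1.continuousOn) 0
  have z1 : p1 0 = 0 := by simp [hp1]
  have z0 : p0 0 = 0 := by simp [hp0]
  -- The solution of `a/6 + b/2 = -p0 1` and `a/2 + b = -p1 1`, the conditions at `1` for the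
  -- correction `x³/6 • a + x²/2 • b`.
  set a : EuclideanSpace ℝ (Fin d) := (12 : ℝ) • p0 1 - (6 : ℝ) • p1 1 with ha
  set b : EuclideanSpace ℝ (Fin d) := (2 : ℝ) • p1 1 - (6 : ℝ) • p0 1 with hb
  have hpoly : ∀ (α β α' β' : ℝ → ℝ), (∀ x, HasDerivAt α (α' x) x) → (∀ x, HasDerivAt β (β' x) x) →
      Continuous α' → Continuous β' →
      IsPrimitive (fun x => α x • a + β x • b) (fun x => α' x • a + β' x • b) := by
    intro α β α' β' h1 h2 h3 h4
    exact isPrimitive_of_hasDerivAt (fun x _ => ((h1 x).smul_const a).add ((h2 x).smul_const b))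
      (by fun_prop)
  let w : ℕ → ℝ → EuclideanSpace ℝ (Fin d)
    | 0 => fun x => p0 x + ((x ^ 3 / 6) • a + (x ^ 2 / 2) • b)
    | 1 => fun x => p1 x + ((x ^ 2 / 2) • a + x • b)
    | 2 => fun x => p2 x + (x • a + (1 : ℝ) • b)
    | 3 => fun x => p3 x + ((1 : ℝ) • a + (0 : ℝ) • b)
    | _ => fun x => u x + ((0 : ℝ) • a + (0 : ℝ) • b)
  have d3 : ∀ x : ℝ, HasDerivAt (fun x : ℝ => x ^ 3 / 6) (x ^ 2 / 2) x := fun x => by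
    exact ((hasDerivAt_pow 3 x).div_const 6).congr_deriv (by norm_num; ring)
  have d2 : ∀ x : ℝ, HasDerivAt (fun x : ℝ => x ^ 2 / 2) x x := fun x => by
    exact ((hasDerivAt_pow 2 x).div_const 2).congr_deriv (by norm_num)
  have hw : ∀ j < 4, IsPrimitive (w j) (w (j + 1)) := by
    intro j hj
    interval_cases j
    · exact P0.add (hpoly _ _ _ _ d3 d2 (by fun_prop) (by fun_prop))
    · exact P1.add (hpoly _ _ _ _ d2 hasDerivAt_id (by fun_prop) (by fun_prop))
    · exact P2.add (hpoly _ _ _ _ hasDerivAt_id (fun x => hasDerivAt_const x 1)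
        (by fun_prop) (by fun_prop))
    · exact P3.add (hpoly _ _ _ _ (fun x => hasDerivAt_const x 1) (fun x => hasDerivAt_const x 0)
        (by fun_prop) (by fun_prop))
  have hu4 : w 4 = u := by
    ext1 x
    change u x + ((0 : ℝ) • a + (0 : ℝ) • b) = u x
    simp
  obtain ⟨U, hU⟩ := Sobolev.exists_of_hasWeakDeriv (k := 4) w (fun j hj => by
      rcases Nat.lt_or_ge j 4 with h | h
      · exact memLp_of_continuousOn (hw j h).continuousOn
      · obtain rfl : j = 4 := by omega
        rw [hu4]; exact Lp.memLp u) (fun j hj => (hw j hj).hasWeakDeriv)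
  have hr : ∀ j (hj : j < 4), ∀ x ∈ Icc (0 : ℝ) 1, U.rep j x = w j x := fun j hj =>
    U.rep_eq_of_ae_eq hj (hw j hj).continuousOn (hU ⟨j, by omega⟩)
  refine ⟨U, mem_H4c_iff.mpr ⟨?_, ?_, ?_, ?_⟩, ?_⟩
  · rw [hr 0 (by omega) 0 zero_mem_I]
    simp [w, z0]
  · rw [hr 0 (by omega) 1 one_mem_I]
    simp only [w, ha, hb]
    module
  · rw [hr 1 (by omega) 0 zero_mem_I]
    simp [w, z1]
  · rw [hr 1 (by omega) 1 one_mem_I]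
    simp only [w, ha, hb]
    module
  · refine Lp.ext ((hU 4).trans ?_)
    exact Eventually.of_forall fun x => congrFun hu4 x

instance (d : ℕ) : CompleteSpace (H4c d) := isClosed_H4c.completeSpace_coe

/-- The fourth derivative is an isomorphism from `H⁴_c` onto `L²`. -/
theorem exists_equiv_wderiv_four (d : ℕ) :
    ∃ e : H4c d ≃L[ℝ] L2 d, ∀ U, e U = U.1.wderiv 4 := by
  let T : H4c d →L[ℝ] L2 d := (Sobolev.wderivL d 4 4).comp (H4c d).subtypeL
  have hinj : LinearMap.ker (T : H4c d →ₗ[ℝ] L2 d) = ⊥ := by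
    rw [LinearMap.ker_eq_bot']
    intro U hU
    have hU' : U.1.wderiv 4 = 0 := hU
    exact Subtype.ext (eq_zero_of_inner_wderiv_four U.2 (by rw [hU', inner_zero_left]))
  have hsurj : LinearMap.range (T : H4c d →ₗ[ℝ] L2 d) = ⊤ := by
    rw [LinearMap.range_eq_top]
    intro u
    obtain ⟨U, hU, h⟩ := exists_H4c_wderiv_four u
    exact ⟨⟨U, hU⟩, h⟩
  exact ⟨ContinuousLinearEquiv.ofBijective T hinj hsurj, fun U => rfl⟩

end BoundaryValues

end ElasticCurve

namespace ElasticCurve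

/-! ### The normal projection and the elastic energy density -/

section Density

variable {d : ℕ}

/-- The orthogonal projection onto the complement of the line spanned by `p`. -/
def normalProj (p : EuclideanSpace ℝ (Fin d)) :
    EuclideanSpace ℝ (Fin d) →L[ℝ] EuclideanSpace ℝ (Fin d) :=
  ContinuousLinearMap.id ℝ _ -
    (‖p‖ ^ 2)⁻¹ • ContinuousLinearMap.smulRightL ℝ _ _ (innerSL ℝ p) p

theorem normalProj_apply (p v : EuclideanSpace ℝ (Fin d)) :
    normalProj p v = v - ((‖p‖ ^ 2)⁻¹ * inner ℝ p v) • p := by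
  simp [normalProj, smul_smul]

theorem normalProj_apply_of_inner_eq_zero {p v : EuclideanSpace ℝ (Fin d)} (h : inner ℝ v p = 0) :
    normalProj p v = v := by
  rw [normalProj_apply, real_inner_comm, h, mul_zero, zero_smul, sub_zero]

theorem inner_normalProj_self {p : EuclideanSpace ℝ (Fin d)} (hp : p ≠ 0)
    (v : EuclideanSpace ℝ (Fin d)) : inner ℝ (normalProj p v) p = 0 := by
  have h : ‖p‖ ≠ 0 := norm_ne_zero_iff.mpr hp
  rw [normalProj_apply, inner_sub_left, inner_smul_left, real_inner_self_eq_norm_sq,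
    real_inner_comm v p]
  simp
  field_simp
  ring

theorem normalProj_normalProj {p : EuclideanSpace ℝ (Fin d)} (hp : p ≠ 0)
    (v : EuclideanSpace ℝ (Fin d)) : normalProj p (normalProj p v) = normalProj p v :=
  normalProj_apply_of_inner_eq_zero (inner_normalProj_self hp v)

theorem inner_normalProj_left (p v w : EuclideanSpace ℝ (Fin d)) :
    inner ℝ (normalProj p v) w = inner ℝ v (normalProj p w) := by
  rw [normalProj_apply, normalProj_apply, inner_sub_left, inner_sub_right, inner_smul_left,
    inner_smul_right, real_inner_comm v p]
  simp
  ring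

theorem contDiffAt_normalProj {p : EuclideanSpace ℝ (Fin d)} (hp : p ≠ 0) :
    ContDiffAt ℝ ∞ normalProj p := by
  have h : (‖p‖ ^ 2) ≠ 0 := pow_ne_zero 2 (norm_ne_zero_iff.mpr hp)
  refine contDiffAt_const.sub (((contDiff_norm_sq ℝ).contDiffAt.inv h).smul ?_)
  exact ((ContinuousLinearMap.smulRightL ℝ _ _).contDiff.contDiffAt.comp p
    (innerSL ℝ).contDiff.contDiffAt).clm_apply contDiffAt_id

/-- The operator `N(p) = |p|⁻¹ P(p)`; the normal derivative is `N(∂ₓ f) ∂ₓ`. -/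
def normalDerivSymbol (p : EuclideanSpace ℝ (Fin d)) :
    EuclideanSpace ℝ (Fin d) →L[ℝ] EuclideanSpace ℝ (Fin d) := ‖p‖⁻¹ • normalProj p

theorem contDiffAt_normalDerivSymbol {p : EuclideanSpace ℝ (Fin d)} (hp : p ≠ 0) :
    ContDiffAt ℝ ∞ normalDerivSymbol p :=
  ((contDiffAt_norm ℝ hp).inv (norm_ne_zero_iff.mpr hp)).smul (contDiffAt_normalProj hp)

/-- Differentiating a unit vector removes the tangential part. This formula turns the curvature into
an expression in `∂ₓf` and `∂ₓ²f`. -/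
theorem hasDerivAt_unit_tangent {p : ℝ → EuclideanSpace ℝ (Fin d)} {q : EuclideanSpace ℝ (Fin d)}
    {x : ℝ} (h : HasDerivAt p q x) (hp : p x ≠ 0) :
    HasDerivAt (fun y => ‖p y‖⁻¹ • p y) (normalDerivSymbol (p x) q) x := by
  have h0 : ‖p x‖ ≠ 0 := norm_ne_zero_iff.mpr hp
  have h1 : HasDerivAt (fun y => ‖p y‖) (inner ℝ (p x) q / ‖p x‖) x := by
    have := h.norm_sq.sqrt (pow_ne_zero 2 h0)
    simp only [Real.sqrt_sq (norm_nonneg _)] at this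
    exact this.congr_deriv (by field_simp)
  have h2 := (h1.inv h0).smul h
  refine h2.congr_deriv ?_
  rw [normalDerivSymbol, smul_apply, normalProj_apply, smul_sub, smul_smul,
    sub_eq_add_neg, ← neg_smul]
  simp only [Pi.inv_apply]
  congr 2
  field_simp

/-- The Hessian `M(p) = |p|⁻³ P(p)` of the elastic energy density with respect to the second
derivative. -/
def bendingTensor (p : EuclideanSpace ℝ (Fin d)) :
    EuclideanSpace ℝ (Fin d) →L[ℝ] EuclideanSpace ℝ (Fin d) := (‖p‖ ^ 3)⁻¹ • normalProj p

theorem contDiffAt_bendingTensor {p : EuclideanSpace ℝ (Fin d)} (hp : p ≠ 0) :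
    ContDiffAt ℝ ∞ bendingTensor p :=
  (((contDiffAt_norm ℝ hp).pow 3).inv (pow_ne_zero 3 (norm_ne_zero_iff.mpr hp))).smul
    (contDiffAt_normalProj hp)

theorem inner_bendingTensor_left (p v w : EuclideanSpace ℝ (Fin d)) :
    inner ℝ (bendingTensor p v) w = inner ℝ v (bendingTensor p w) := by
  simp only [bendingTensor, smul_apply, inner_smul_left, inner_smul_right,
    inner_normalProj_left]
  rfl

/-- The elastic energy density `½ ⟨M(p) q, q⟩`. -/
def energyDensity (z : EuclideanSpace ℝ (Fin d) × EuclideanSpace ℝ (Fin d)) : ℝ :=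
  (1 / 2) * inner ℝ (bendingTensor z.1 z.2) z.2

/-- The gradient of the elastic energy density with respect to the first derivative. -/
def densityGradient (z : EuclideanSpace ℝ (Fin d) × EuclideanSpace ℝ (Fin d)) :
    EuclideanSpace ℝ (Fin d) :=
  ∑ i, ((1 / 2 : ℝ) * inner ℝ (fderiv ℝ bendingTensor z.1 (EuclideanSpace.single i 1) z.2) z.2) •
    EuclideanSpace.single i (1 : ℝ)

/-- The gradient is defined by coordinates so that its smoothness is that of a finite sum; this
identity recovers its variational meaning. -/
theorem inner_densityGradient (z : EuclideanSpace ℝ (Fin d) × EuclideanSpace ℝ (Fin d))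
    (h : EuclideanSpace ℝ (Fin d)) :
    inner ℝ (densityGradient z) h = (1 / 2) * inner ℝ (fderiv ℝ bendingTensor z.1 h z.2) z.2 := by
  have hh : h = ∑ i, h i • EuclideanSpace.single i (1 : ℝ) := by
    have := (EuclideanSpace.basisFun (Fin d) ℝ).sum_repr h
    simpa using this.symm
  conv_rhs => rw [hh]
  simp only [densityGradient, map_sum, map_smul, sum_apply, sum_inner, smul_apply,
    inner_smul_left, Finset.mul_sum]
  refine Finset.sum_congr rfl fun i _ => ?_
  simp [EuclideanSpace.inner_single_left]
  ring

theorem contDiffAt_fderiv_bendingTensor {p : EuclideanSpace ℝ (Fin d)} (hp : p ≠ 0) :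
    ContDiffAt ℝ ∞ (fderiv ℝ (bendingTensor (d := d))) p :=
  (contDiffAt_bendingTensor hp).fderiv_right (by simp)

theorem contDiffAt_densityGradient {z : EuclideanSpace ℝ (Fin d) × EuclideanSpace ℝ (Fin d)}
    (hz : z.1 ≠ 0) : ContDiffAt ℝ ∞ (densityGradient (d := d)) z := by
  refine ContDiffAt.sum fun i _ => ?_
  have h : ContDiffAt ℝ ∞ (fun z : EuclideanSpace ℝ (Fin d) × EuclideanSpace ℝ (Fin d) =>
      fderiv ℝ bendingTensor z.1) z := (contDiffAt_fderiv_bendingTensor hz).comp z contDiffAt_fst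
  have h' : ContDiffAt ℝ ∞ (fun z : EuclideanSpace ℝ (Fin d) × EuclideanSpace ℝ (Fin d) =>
      (1 / 2 : ℝ) * inner ℝ (fderiv ℝ bendingTensor z.1 (EuclideanSpace.single i 1) z.2) z.2) z :=
    contDiffAt_const.mul (((h.clm_apply contDiffAt_const).clm_apply contDiffAt_snd).inner ℝ
      contDiffAt_snd)
  exact h'.smul contDiffAt_const

/-- The factor `1/2` cancels in the `q`-derivative because the bending tensor is symmetric. -/
theorem hasFDerivAt_energyDensity {z : EuclideanSpace ℝ (Fin d) × EuclideanSpace ℝ (Fin d)}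
    (hz : z.1 ≠ 0) :
    ContDiffAt ℝ ∞ (energyDensity (d := d)) z ∧ ∀ h k, fderiv ℝ energyDensity z (h, k) =
      inner ℝ (densityGradient z) h + inner ℝ (bendingTensor z.1 z.2) k := by
  have h1 : ContDiffAt ℝ ∞ (fun z : EuclideanSpace ℝ (Fin d) × EuclideanSpace ℝ (Fin d) =>
      bendingTensor z.1) z := (contDiffAt_bendingTensor hz).comp z contDiffAt_fst
  refine ⟨contDiffAt_const.mul ((h1.clm_apply contDiffAt_snd).inner ℝ contDiffAt_snd),
    fun h k => ?_⟩
  have hM : HasFDerivAt (fun z : EuclideanSpace ℝ (Fin d) × EuclideanSpace ℝ (Fin d) =>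
      bendingTensor z.1) ((fderiv ℝ bendingTensor z.1).comp
        (ContinuousLinearMap.fst ℝ _ _)) z :=
    HasFDerivAt.comp z (((contDiffAt_bendingTensor hz).differentiableAt (by simp)).hasFDerivAt)
      hasFDerivAt_fst
  have hd := (((hM.clm_apply hasFDerivAt_snd).inner ℝ hasFDerivAt_snd).const_mul (1 / 2 : ℝ))
  have : fderiv ℝ energyDensity z = _ := hd.fderiv
  rw [this, inner_densityGradient]
  simp [fderivInnerCLM_apply]
  rw [inner_add_left, inner_bendingTensor_left z.1 k z.2, real_inner_comm k]
  ring

/-- The part of lower order in the Euler–Lagrange operator of the elastic energy, as a function of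
the first three derivatives of the curve. -/
def eulerLagrangeLower (z : EuclideanSpace ℝ (Fin d) × EuclideanSpace ℝ (Fin d) ×
    EuclideanSpace ℝ (Fin d)) : EuclideanSpace ℝ (Fin d) :=
  fderiv ℝ (fun y : EuclideanSpace ℝ (Fin d) × EuclideanSpace ℝ (Fin d) =>
      fderiv ℝ bendingTensor y.1 y.2 y.2) (z.1, z.2.1) z.2 +
    fderiv ℝ bendingTensor z.1 z.2.1 z.2.2 - fderiv ℝ densityGradient (z.1, z.2.1) z.2

theorem contDiffAt_bendingTensor_deriv
    {z : EuclideanSpace ℝ (Fin d) × EuclideanSpace ℝ (Fin d)} (hz : z.1 ≠ 0) :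
    ContDiffAt ℝ ∞ (fun y : EuclideanSpace ℝ (Fin d) × EuclideanSpace ℝ (Fin d) =>
      fderiv ℝ bendingTensor y.1 y.2 y.2) z :=
  ((((contDiffAt_fderiv_bendingTensor hz).comp z contDiffAt_fst).clm_apply
    contDiffAt_snd).clm_apply contDiffAt_snd)

theorem contDiffAt_eulerLagrangeLower {z : EuclideanSpace ℝ (Fin d) ×
    EuclideanSpace ℝ (Fin d) × EuclideanSpace ℝ (Fin d)} (hz : z.1 ≠ 0) :
    ContDiffAt ℝ ∞ (eulerLagrangeLower (d := d)) z := by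
  have hπ : ContDiffAt ℝ ∞ (fun z : EuclideanSpace ℝ (Fin d) × EuclideanSpace ℝ (Fin d) ×
      EuclideanSpace ℝ (Fin d) => (z.1, z.2.1)) z :=
    contDiffAt_fst.prodMk (contDiffAt_fst.comp z contDiffAt_snd)
  have h1 := ((contDiffAt_bendingTensor_deriv (z := (z.1, z.2.1)) hz).fderiv_right
    (m := ∞) (by simp)).comp z hπ
  have h2 := ((contDiffAt_densityGradient (z := (z.1, z.2.1)) hz).fderiv_right
    (m := ∞) (by simp)).comp z hπ
  have h3 : ContDiffAt ℝ ∞ (fun z : EuclideanSpace ℝ (Fin d) × EuclideanSpace ℝ (Fin d) ×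
      EuclideanSpace ℝ (Fin d) => fderiv ℝ bendingTensor z.1 z.2.1 z.2.2) z :=
    (((contDiffAt_fderiv_bendingTensor hz).comp z contDiffAt_fst).clm_apply
      (contDiffAt_fst.comp z contDiffAt_snd)).clm_apply (contDiffAt_snd.comp z contDiffAt_snd)
  exact ((h1.clm_apply contDiffAt_snd).add h3).sub (h2.clm_apply contDiffAt_snd)

end Density

/-! ### Superposition operators -/

section Superposition

variable {Z Z' : Type*} [NormedAddCommGroup Z] [NormedSpace ℝ Z] [NormedAddCommGroup Z']
  [NormedSpace ℝ Z']

/-- A `C¹` function is differentiable uniformly along a compact curve. -/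
theorem exists_uniform_fderiv {F : Z → Z'} {u : ℝ → Z} (hu : ContinuousOn u (Icc 0 1))
    (hF : ∀ x ∈ Icc (0 : ℝ) 1, ContDiffAt ℝ 1 F (u x)) {ε : ℝ} (hε : 0 < ε) :
    ∃ δ > 0, ∀ x ∈ Icc (0 : ℝ) 1, ∀ h : Z, ‖h‖ < δ →
      ‖F (u x + h) - F (u x) - fderiv ℝ F (u x) h‖ ≤ ε * ‖h‖ := by
  -- Strict differentiability at `u x`, together with continuity of the derivative, controls
  -- increments between any two points of a small ball. A Lebesgue number of the compact image then
  -- makes the radius uniform.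
  have loc : ∀ x : Icc (0 : ℝ) 1, ∃ r > 0, ∀ w ∈ Metric.ball (u x) r, ∀ y ∈ Metric.ball (u x) r,
      ‖F y - F w - fderiv ℝ F w (y - w)‖ ≤ ε * ‖y - w‖ := by
    intro x
    have h1 := ((hF x x.2).hasStrictFDerivAt one_ne_zero).isLittleO.def (half_pos hε)
    have h2 := (hF x x.2).continuousAt_fderiv one_ne_zero
    have h3 : ∀ᶠ w in 𝓝 (u x), ‖fderiv ℝ F w - fderiv ℝ F (u x)‖ < ε / 2 := by
      have := Metric.tendsto_nhds.mp h2 (ε / 2) (half_pos hε)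
      simpa only [dist_eq_norm] using this
    obtain ⟨r1, hr1, hb1⟩ := Metric.eventually_nhds_iff_ball.mp h1
    obtain ⟨r2, hr2, hb2⟩ := Metric.eventually_nhds_iff_ball.mp h3
    refine ⟨min r1 r2, lt_min hr1 hr2, fun w hw y hy => ?_⟩
    have e1 := hb1 (y, w) (by
      rw [← ball_prod_same]
      exact ⟨Metric.ball_subset_ball (min_le_left _ _) hy,
        Metric.ball_subset_ball (min_le_left _ _) hw⟩)
    have e2 := (fderiv ℝ F w - fderiv ℝ F (u x)).le_of_opNorm_le
      (hb2 w (Metric.ball_subset_ball (min_le_right _ _) hw)).le (y - w)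
    have e3 : F y - F w - fderiv ℝ F w (y - w) = (F y - F w - fderiv ℝ F (u x) (y - w)) -
        (fderiv ℝ F w - fderiv ℝ F (u x)) (y - w) := by
      rw [sub_apply]; abel
    rw [e3]
    refine (norm_sub_le _ _).trans ?_
    simp only at e1
    linarith
  choose r hr hb using loc
  obtain ⟨δ, hδ, hδ'⟩ := lebesgue_number_lemma_of_metric (isCompact_Icc.image_of_continuousOn hu)
    (c := fun x : Icc (0 : ℝ) 1 => Metric.ball (u x) (r x)) (fun _ => Metric.isOpen_ball) (by
      rintro _ ⟨x, hx, rfl⟩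
      exact mem_iUnion.mpr ⟨⟨x, hx⟩, Metric.mem_ball_self (hr _)⟩)
  refine ⟨δ, hδ, fun x hx h hh => ?_⟩
  obtain ⟨i, hi⟩ := hδ' (u x) ⟨x, hx, rfl⟩
  have := hb i (u x) (hi (Metric.mem_ball_self hδ)) (u x + h) (hi (by simpa using hh))
  simpa using this

end Superposition

end ElasticCurve

namespace ElasticCurve

/-! ### Coefficients along a curve -/

section Coefficients

variable {d k : ℕ} {Z Z' Z'' : Type*} [NormedAddCommGroup Z] [NormedSpace ℝ Z]
  [NormedAddCommGroup Z'] [NormedSpace ℝ Z'] [NormedAddCommGroup Z''] [NormedSpace ℝ Z'']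

/-- `c` is `n` times continuously differentiable near every point of `I`. -/
def SmoothOnI (n : ℕ) (c : ℝ → Z) : Prop := ∀ x ∈ Icc (0 : ℝ) 1, ContDiffAt ℝ n c x

theorem SmoothOnI.mono {m n : ℕ} {c : ℝ → Z} (h : SmoothOnI n c) (hmn : m ≤ n) : SmoothOnI m c :=
  fun x hx => (h x hx).of_le (by exact_mod_cast hmn)

theorem SmoothOnI.continuousOn {n : ℕ} {c : ℝ → Z} (h : SmoothOnI n c) :
    ContinuousOn c (Icc 0 1) := fun x hx => (h x hx).continuousAt.continuousWithinAt

theorem SmoothOnI.hasDerivAt {n : ℕ} {c : ℝ → Z} (h : SmoothOnI (n + 1) c) :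
    ∀ x ∈ Icc (0 : ℝ) 1, HasDerivAt c (deriv c x) x := fun x hx =>
  ((h x hx).differentiableAt (by simp)).hasDerivAt

theorem SmoothOnI.deriv {n : ℕ} {c : ℝ → Z} (h : SmoothOnI (n + 1) c) :
    SmoothOnI n (deriv c) := fun x hx => by
  have h1 : ContDiffAt ℝ n (fderiv ℝ c) x := (h x hx).fderiv_right (by simp)
  exact h1.clm_apply contDiffAt_const

theorem SmoothOnI.add {n : ℕ} {c c' : ℝ → Z} (h : SmoothOnI n c) (h' : SmoothOnI n c') :
    SmoothOnI n (fun x => c x + c' x) := fun x hx => (h x hx).add (h' x hx)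

theorem SmoothOnI.comp_clm {n : ℕ} {c : ℝ → Z' →L[ℝ] Z''} {c' : ℝ → Z →L[ℝ] Z'}
    (h : SmoothOnI n c) (h' : SmoothOnI n c') :
    SmoothOnI n (fun x => (c x).comp (c' x)) := fun x hx => (h x hx).clm_comp (h' x hx)

theorem Sobolev.contDiff_rep (U : Sobolev d k) (n : ℕ) :
    ∀ j, j + n < k → ContDiff ℝ n (U.rep j) := by
  induction n with
  | zero => exact fun j hj => contDiff_zero.mpr (U.rep_continuous hj)
  | succ n ih =>
    intro j hj
    have hd := fun x => U.rep_hasDerivAt (j := j) (by omega) x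
    have : ContDiff ℝ ((n : ℕ) + 1 : WithTop ℕ∞) (U.rep j) := by
      rw [contDiff_succ_iff_deriv]
      refine ⟨fun x => (hd x).differentiableAt, by simp, ?_⟩
      rw [show deriv (U.rep j) = U.rep (j + 1) from funext fun x => (hd x).deriv]
      exact ih (j + 1) (by omega)
    exact_mod_cast this

/-- The underlying function of an element of `H⁵`. -/
abbrev curve (F : Sobolev d 5) : ℝ → EuclideanSpace ℝ (Fin d) := Sobolev.toL2 d 5 F

variable {F : Sobolev d 5} (hne : ∀ x ∈ Icc (0 : ℝ) 1, F.rep 1 x ≠ 0)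

include hne in
-- The tangent of an `H⁵` curve is `C³`, and the given function is smooth away from zero.
theorem smoothOnI_comp_tangent {G : EuclideanSpace ℝ (Fin d) → Z}
    (hG : ∀ p, p ≠ 0 → ContDiffAt ℝ ∞ G p) : SmoothOnI 3 (fun x => G (F.rep 1 x)) := fun x hx =>
  ((hG _ (hne x hx)).of_le (WithTop.coe_le_coe.mpr (le_top : (3 : ℕ∞) ≤ ⊤))).comp x
    (F.contDiff_rep 3 1 (by omega)).contDiffAt

include hne in
/-- The derivatives of the normal projection along the curve. -/
theorem exists_normalProj_derivs :
    ∃ c : ℕ → ℝ → EuclideanSpace ℝ (Fin d) →L[ℝ] EuclideanSpace ℝ (Fin d),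
      (c 0 = fun x => normalProj (F.rep 1 x)) ∧
      (∀ j < 3, ∀ x ∈ Icc (0 : ℝ) 1, HasDerivAt (c j) (c (j + 1) x) x) ∧
      (∀ j ≤ 3, ContinuousOn (c j) (Icc 0 1)) ∧ IsPrimitive (c 3) (c 4) ∧ MemLp (c 4) 2 muI := by
  set a : ℝ → EuclideanSpace ℝ (Fin d) →L[ℝ]
    (EuclideanSpace ℝ (Fin d) →L[ℝ] EuclideanSpace ℝ (Fin d)) :=
    fun x => fderiv ℝ normalProj (F.rep 1 x) with ha
  have ha3 : SmoothOnI 3 a := smoothOnI_comp_tangent hne fun p hp =>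
    (contDiffAt_normalProj hp).fderiv_right (by simp)
  have ha2 := ha3.deriv
  have ha1 := ha2.deriv
  have ha0 := ha1.deriv
  have hf : ∀ j, j + 1 < 5 → ∀ x, HasDerivAt (F.rep j) (F.rep (j + 1) x) x :=
    fun j hj => F.rep_hasDerivAt hj
  have hfc : ∀ j < 5, ContinuousOn (F.rep j) (Icc 0 1) := fun j hj =>
    (F.rep_continuous hj).continuousOn
  -- Successive derivatives of `a ∂ₓ²f`. In `c 3` the summand with `F.rep 4` is kept last: it is
  -- only absolutely continuous, the rest being `C¹`. Its derivative brings `F.rep 5`, so `c 4` is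
  -- only in `L²`.
  let c : ℕ → ℝ → EuclideanSpace ℝ (Fin d) →L[ℝ] EuclideanSpace ℝ (Fin d)
    | 0 => fun x => normalProj (F.rep 1 x)
    | 1 => fun x => a x (F.rep 2 x)
    | 2 => fun x => deriv a x (F.rep 2 x) + a x (F.rep 3 x)
    | 3 => fun x => (deriv (deriv a) x (F.rep 2 x) + deriv a x (F.rep 3 x) +
        deriv a x (F.rep 3 x)) + a x (F.rep 4 x)
    | _ => fun x => ((deriv (deriv (deriv a)) x (F.rep 2 x) + deriv (deriv a) x (F.rep 3 x) +
        (deriv (deriv a) x (F.rep 3 x) + deriv a x (F.rep 4 x))) +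
        (deriv (deriv a) x (F.rep 3 x) + deriv a x (F.rep 4 x))) +
        (deriv a x (F.rep 4 x) + a x (F.rep 5 x))
  have k0 : ∀ x ∈ Icc (0 : ℝ) 1, HasDerivAt (c 0) (c 1 x) x := fun x hx =>
    ((contDiffAt_normalProj (hne x hx)).differentiableAt (by simp)).hasFDerivAt.comp_hasDerivAt x
      (hf 1 (by omega) x)
  have k1 : ∀ x ∈ Icc (0 : ℝ) 1, HasDerivAt (c 1) (c 2 x) x := fun x hx =>
    (ha3.hasDerivAt x hx).clm_apply (hf 2 (by omega) x)
  have k2 : ∀ x ∈ Icc (0 : ℝ) 1, HasDerivAt (c 2) (c 3 x) x := fun x hx =>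
    (((ha2.hasDerivAt x hx).clm_apply (hf 2 (by omega) x)).add
      ((ha3.hasDerivAt x hx).clm_apply (hf 3 (by omega) x))).congr_deriv (by simp only [c]; abel)
  have c3 : ContinuousOn (c 3) (Icc 0 1) :=
    (((ha1.continuousOn.clm_apply (hfc 2 (by omega))).add
      (ha2.continuousOn.clm_apply (hfc 3 (by omega)))).add
      (ha2.continuousOn.clm_apply (hfc 3 (by omega)))).add
      (ha3.continuousOn.clm_apply (hfc 4 (by omega)))
  have l4 : ContinuousOn (fun x => (deriv (deriv (deriv a)) x (F.rep 2 x) +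
      deriv (deriv a) x (F.rep 3 x) +
        (deriv (deriv a) x (F.rep 3 x) + deriv a x (F.rep 4 x))) +
        (deriv (deriv a) x (F.rep 3 x) + deriv a x (F.rep 4 x))) (Icc 0 1) := by
    have e1 := ha1.continuousOn.clm_apply (hfc 3 (by omega))
    have e2 := ha2.continuousOn.clm_apply (hfc 4 (by omega))
    exact (((ha0.continuousOn.clm_apply (hfc 2 (by omega))).add e1).add (e1.add e2)).add
      (e1.add e2)
  refine ⟨c, rfl, ?_, ?_, ?_, ?_⟩
  · intro j hj
    interval_cases j
    exacts [k0, k1, k2]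
  · intro j hj
    interval_cases j
    · exact fun x hx => (k0 x hx).continuousAt.continuousWithinAt
    · exact fun x hx => (k1 x hx).continuousAt.continuousWithinAt
    · exact fun x hx => (k2 x hx).continuousAt.continuousWithinAt
    · exact c3
  · refine IsPrimitive.add (isPrimitive_of_hasDerivAt (fun x hx => ?_) l4)
      (IsPrimitive.clm_apply ha3.hasDerivAt ha2.continuousOn (F.rep_isPrimitive (by omega)))
    have e1 := (ha1.hasDerivAt x hx).clm_apply (hf 2 (by omega) x)
    have e2 := (ha2.hasDerivAt x hx).clm_apply (hf 3 (by omega) x)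
    exact (e1.add e2).add e2
  · exact (memLp_of_continuousOn l4).add ((memLp_of_continuousOn
      (ha2.continuousOn.clm_apply (hfc 4 (by omega)))).add
      (memLp_clm_apply ha3.continuousOn (F.rep_memLp (by omega))))

set_option maxHeartbeats 400000 in
/-- The Leibniz rule up to order four. -/
theorem exists_sobolev_clm_apply
    {c : ℕ → ℝ → EuclideanSpace ℝ (Fin d) →L[ℝ] EuclideanSpace ℝ (Fin d)}
    (hd : ∀ j < 3, ∀ x ∈ Icc (0 : ℝ) 1, HasDerivAt (c j) (c (j + 1) x) x)
    (hc : ∀ j ≤ 3, ContinuousOn (c j) (Icc 0 1)) (h3 : IsPrimitive (c 3) (c 4))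
    (h4 : MemLp (c 4) 2 muI) (W : Sobolev d 4) :
    ∃ U : Sobolev d 4, (∀ x ∈ Icc (0 : ℝ) 1, U.rep 0 x = c 0 x (W.rep 0 x)) ∧
      (∀ x ∈ Icc (0 : ℝ) 1, U.rep 1 x = c 1 x (W.rep 0 x) + c 0 x (W.rep 1 x)) ∧
      U.wderiv 4 =ᵐ[muI] fun x => c 4 x (W.rep 0 x) + (4 : ℝ) • c 3 x (W.rep 1 x) +
        (6 : ℝ) • c 2 x (W.rep 2 x) + (4 : ℝ) • c 1 x (W.rep 3 x) + c 0 x (W.rep 4 x) := by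
  have hw : ∀ j, j + 1 < 4 → ∀ x, HasDerivAt (W.rep j) (W.rep (j + 1) x) x :=
    fun j hj => W.rep_hasDerivAt hj
  have hwc : ∀ j < 4, ContinuousOn (W.rep j) (Icc 0 1) := fun j hj =>
    (W.rep_continuous hj).continuousOn
  have prod : ∀ i < 3, ∀ j, j + 1 < 4 → ∀ x ∈ Icc (0 : ℝ) 1, HasDerivAt
      (fun y => c i y (W.rep j y)) (c (i + 1) x (W.rep j x) + c i x (W.rep (j + 1) x)) x :=
    fun i hi j hj x hx => (hd i hi x hx).clm_apply (hw j hj x)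
  have pc : ∀ i ≤ 3, ∀ j < 4, ContinuousOn (fun y => c i y (W.rep j y)) (Icc 0 1) :=
    fun i hi j hj => (hc i hi).clm_apply (hwc j hj)
  -- In `v 3` the first bracket is `C¹`, while the second collects the products with a factor, `c 3`
  -- or `W.rep 3`, that is only absolutely continuous.
  let v : ℕ → ℝ → EuclideanSpace ℝ (Fin d)
    | 0 => fun x => c 0 x (W.rep 0 x)
    | 1 => fun x => c 1 x (W.rep 0 x) + c 0 x (W.rep 1 x)
    | 2 => fun x => c 2 x (W.rep 0 x) + (2 : ℝ) • c 1 x (W.rep 1 x) + c 0 x (W.rep 2 x)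
    | 3 => fun x => ((3 : ℝ) • c 2 x (W.rep 1 x) + (3 : ℝ) • c 1 x (W.rep 2 x)) +
        (c 3 x (W.rep 0 x) + c 0 x (W.rep 3 x))
    | _ => fun x => c 4 x (W.rep 0 x) + (4 : ℝ) • c 3 x (W.rep 1 x) +
        (6 : ℝ) • c 2 x (W.rep 2 x) + (4 : ℝ) • c 1 x (W.rep 3 x) + c 0 x (W.rep 4 x)
  have v1 : ContinuousOn (v 1) (Icc 0 1) := (pc 1 (by omega) 0 (by omega)).add
    (pc 0 (by omega) 1 (by omega))
  have v2 : ContinuousOn (v 2) (Icc 0 1) := ((pc 2 (by omega) 0 (by omega)).add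
    ((pc 1 (by omega) 1 (by omega)).const_smul (2 : ℝ))).add (pc 0 (by omega) 2 (by omega))
  have v3 : ContinuousOn (v 3) (Icc 0 1) := (((pc 2 (by omega) 1 (by omega)).const_smul (3 : ℝ)).add
    ((pc 1 (by omega) 2 (by omega)).const_smul (3 : ℝ))).add
    ((pc 3 (by omega) 0 (by omega)).add (pc 0 (by omega) 3 (by omega)))
  have hv : ∀ j < 4, IsPrimitive (v j) (v (j + 1)) := by
    intro j hj
    interval_cases j
    · exact isPrimitive_of_hasDerivAt (prod 0 (by omega) 0 (by omega)) v1
    · refine isPrimitive_of_hasDerivAt (fun x hx => ((prod 1 (by omega) 0 (by omega) x hx).add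
        (prod 0 (by omega) 1 (by omega) x hx)).congr_deriv ?_) v2
      simp only [v, Nat.reduceAdd]
      module
    · refine isPrimitive_of_hasDerivAt (fun x hx => (((prod 2 (by omega) 0 (by omega) x hx).add
        ((prod 1 (by omega) 1 (by omega) x hx).const_smul (2 : ℝ))).add
        (prod 0 (by omega) 2 (by omega) x hx)).congr_deriv ?_) v3
      simp only [v, Nat.reduceAdd]
      module
    · have q1 : IsPrimitive (fun x => (3 : ℝ) • c 2 x (W.rep 1 x) + (3 : ℝ) • c 1 x (W.rep 2 x))
          (fun x => (3 : ℝ) • (c 3 x (W.rep 1 x) + c 2 x (W.rep 2 x)) +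
            (3 : ℝ) • (c 2 x (W.rep 2 x) + c 1 x (W.rep 3 x))) := by
        refine isPrimitive_of_hasDerivAt (fun x hx =>
          ((prod 2 (by omega) 1 (by omega) x hx).const_smul (3 : ℝ)).add
          ((prod 1 (by omega) 2 (by omega) x hx).const_smul (3 : ℝ))) ?_
        exact (((pc 3 (by omega) 1 (by omega)).add (pc 2 (by omega) 2 (by omega))).const_smul (3 : ℝ)).add
          (((pc 2 (by omega) 2 (by omega)).add (pc 1 (by omega) 3 (by omega))).const_smul (3 : ℝ))
      -- The roles in the product rule are exchanged: evaluation at `W.rep 0 x` is the `C¹` family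
      -- of operators, and `c 3` is the absolutely continuous function it acts on.
      have q2 : IsPrimitive (fun x => c 3 x (W.rep 0 x))
          (fun x => c 3 x (W.rep 1 x) + c 4 x (W.rep 0 x)) :=
        IsPrimitive.clm_apply
          (C := fun x => ContinuousLinearMap.apply ℝ (EuclideanSpace ℝ (Fin d)) (W.rep 0 x))
          (C' := fun x => ContinuousLinearMap.apply ℝ (EuclideanSpace ℝ (Fin d)) (W.rep 1 x))
          (fun x _ => (ContinuousLinearMap.hasFDerivAt
            (ContinuousLinearMap.apply ℝ (EuclideanSpace ℝ (Fin d)) :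
              EuclideanSpace ℝ (Fin d) →L[ℝ] (EuclideanSpace ℝ (Fin d) →L[ℝ]
                EuclideanSpace ℝ (Fin d)) →L[ℝ] EuclideanSpace ℝ (Fin d))).comp_hasDerivAt x
            (hw 0 (by omega) x))
          ((ContinuousLinearMap.apply ℝ (EuclideanSpace ℝ (Fin d))).continuous.comp_continuousOn
            (hwc 1 (by omega))) h3
      have q3 := IsPrimitive.clm_apply (hd 0 (by omega)) (hc 1 (by omega))
        (W.rep_isPrimitive (j := 3) (by omega))
      refine (q1.add (q2.add q3)).congr (fun x _ => rfl) (Eventually.of_forall fun x => ?_)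
      simp only [v, Nat.reduceAdd]
      module
  obtain ⟨U, hU⟩ := Sobolev.exists_of_hasWeakDeriv (k := 4) v (fun j hj => by
      rcases Nat.lt_or_ge j 4 with h | h
      · exact memLp_of_continuousOn (hv j h).continuousOn
      · obtain rfl : j = 4 := by omega
        have m4 : MemLp (fun x => c 4 x (W.rep 0 x)) 2 muI :=
          memLp_clm_apply (C := fun x =>
            ContinuousLinearMap.apply ℝ (EuclideanSpace ℝ (Fin d)) (W.rep 0 x))
            ((ContinuousLinearMap.apply ℝ (EuclideanSpace ℝ (Fin d))).continuous.comp_continuousOn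
            (hwc 0 (by omega))) h4
        exact (((m4.add ((memLp_of_continuousOn (pc 3 (by omega) 1 (by omega))).const_smul (4 : ℝ))).add
          ((memLp_of_continuousOn (pc 2 (by omega) 2 (by omega))).const_smul (6 : ℝ))).add
          ((memLp_of_continuousOn (pc 1 (by omega) 3 (by omega))).const_smul (4 : ℝ))).add
          (memLp_clm_apply (hc 0 (by omega)) (W.rep_memLp (by omega))))
      (fun j hj => (hv j hj).hasWeakDeriv)
  have hr : ∀ j (hj : j < 4), ∀ x ∈ Icc (0 : ℝ) 1, U.rep j x = v j x := fun j hj =>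
    U.rep_eq_of_ae_eq hj (hv j hj).continuousOn (hU ⟨j, by omega⟩)
  exact ⟨U, hr 0 (by omega), hr 1 (by omega), hU 4⟩

end Coefficients

end ElasticCurve

namespace ElasticCurve

/-! ### Normal fields along a curve -/

section NormalFields

variable {d : ℕ} {F : Sobolev d 5}

theorem hasWeakDeriv_curve (F : Sobolev d 5) : HasWeakDeriv (curve F) (F.rep 1) :=
  (F.rep_isPrimitive (j := 0) (by omega)).hasWeakDeriv.congr F.rep_zero_ae_eq
    (EventuallyEq.refl _ _)

theorem weakDeriv_curve (F : Sobolev d 5) : weakDeriv (curve F) =ᵐ[muI] F.rep 1 :=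
  (hasWeakDeriv_curve F).weakDeriv_ae_eq

theorem mem_L2Perp_iff {u : L2 d} :
    u ∈ L2Perp (curve F) ↔ ∀ᵐ x ∂muI, inner ℝ (u x) (F.rep 1 x) = 0 := by
  change (∀ᵐ x ∂muI, inner ℝ (u x) (weakDeriv (curve F) x) = 0) ↔ _
  refine eventually_congr ?_
  filter_upwards [weakDeriv_curve F] with x hx
  rw [hx]

theorem mem_H4cPerp_iff {U : Sobolev d 4} :
    U ∈ H4cPerp (curve F) ↔ HasZeroBoundary U ∧ ∀ᵐ x ∂muI, inner ℝ (U.rep 0 x) (F.rep 1 x) = 0 := by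
  change (U ∈ H4c d ∧ Sobolev.toL2 d 4 U ∈ L2Perp (curve F)) ↔ _
  rw [mem_H4c_iff, mem_L2Perp_iff]
  refine and_congr_right fun _ => eventually_congr ?_
  filter_upwards [U.rep_zero_ae_eq] with x hx
  rw [hx]

/-- The normal fields are the kernel of the bounded operator `u ↦ ⟨∂ₓf, u⟩ ∂ₓf`. -/
theorem isClosed_L2Perp (F : Sobolev d 5) : IsClosed (L2Perp (curve F) : Set (L2 d)) := by
  set C : ℝ → EuclideanSpace ℝ (Fin d) →L[ℝ] EuclideanSpace ℝ (Fin d) := fun x =>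
    ContinuousLinearMap.smulRightL ℝ _ _ (innerSL ℝ (F.rep 1 x)) (F.rep 1 x) with hC
  have hc : ContinuousOn C (Icc 0 1) := by
    have h1 : ContinuousOn (F.rep 1) (Icc 0 1) := (F.rep_continuous (by omega)).continuousOn
    exact ((ContinuousLinearMap.smulRightL ℝ _ _).continuous.comp_continuousOn
      ((innerSL ℝ).continuous.comp_continuousOn h1)).clm_apply h1
  have : (L2Perp (curve F) : Set (L2 d)) = mulL C ⁻¹' {0} := by
    ext u
    rw [SetLike.mem_coe, mem_L2Perp_iff, mem_preimage, mem_singleton_iff, Lp.eq_zero_iff_ae_eq_zero]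
    refine eventually_congr ?_
    filter_upwards [mulL_ae_eq hc u] with x hx
    rw [hx]
    simp [hC, real_inner_comm]
    intro h; rw [h, inner_zero_left]
  rw [this]
  exact isClosed_singleton.preimage (mulL C).continuous

instance (F : Sobolev d 5) : CompleteSpace (L2Perp (curve F)) := (isClosed_L2Perp F).completeSpace_coe

instance (F : Sobolev d 5) : CompleteSpace (H4cPerp (curve F)) := by
  have h : IsClosed (H4cPerp (curve F) : Set (Sobolev d 4)) :=
    isClosed_H4c.inter ((isClosed_L2Perp F).preimage (Sobolev.wderivL d 4 0).continuous)
  exact h.completeSpace_coe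

/-- The pointwise projection onto the normal space of the curve. -/
def normalProjAlong (F : Sobolev d 5) :
    ℝ → EuclideanSpace ℝ (Fin d) →L[ℝ] EuclideanSpace ℝ (Fin d) := fun x => normalProj (F.rep 1 x)

variable (hne : ∀ x ∈ Icc (0 : ℝ) 1, F.rep 1 x ≠ 0)

include hne in
theorem continuousOn_normalProjAlong : ContinuousOn (normalProjAlong F) (Icc 0 1) :=
  (smoothOnI_comp_tangent hne fun _ hp => contDiffAt_normalProj hp).continuousOn

include hne in
theorem mulL_normalProjAlong_ae_eq (u : L2 d) :
    mulL (normalProjAlong F) u =ᵐ[muI] fun x => normalProj (F.rep 1 x) (u x) :=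
  mulL_ae_eq (continuousOn_normalProjAlong hne) u

include hne in
theorem mulL_normalProjAlong_mem (u : L2 d) : mulL (normalProjAlong F) u ∈ L2Perp (curve F) := by
  rw [mem_L2Perp_iff]
  filter_upwards [mulL_normalProjAlong_ae_eq hne u, ae_restrict_mem measurableSet_Icc] with x hx hI
  rw [hx]
  exact inner_normalProj_self (hne x hI) _

include hne in
theorem mulL_normalProjAlong_eq {u : L2 d} (hu : u ∈ L2Perp (curve F)) :
    mulL (normalProjAlong F) u = u := by
  refine Lp.ext ?_
  filter_upwards [mulL_normalProjAlong_ae_eq hne u, mem_L2Perp_iff.mp hu] with x hx h0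
  rw [hx, normalProj_apply_of_inner_eq_zero h0]

include hne in
theorem inner_mulL_normalProjAlong (u v : L2 d) :
    inner ℝ (mulL (normalProjAlong F) u) v = inner ℝ u (mulL (normalProjAlong F) v) := by
  rw [L2.inner_def, L2.inner_def]
  refine integral_congr_ae ?_
  filter_upwards [mulL_normalProjAlong_ae_eq hne u, mulL_normalProjAlong_ae_eq hne v] with x h1 h2
  rw [h1, h2, inner_normalProj_left]

/-- The projection of `L²` onto the normal fields. -/
def projL2Perp : L2 d →L[ℝ] L2Perp (curve F) :=
  (mulL (normalProjAlong F)).codRestrict (L2Perp (curve F)) (mulL_normalProjAlong_mem hne)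

theorem projL2Perp_ae_eq (u : L2 d) :
    ((projL2Perp hne u : L2 d) : ℝ → EuclideanSpace ℝ (Fin d)) =ᵐ[muI]
      fun x => normalProj (F.rep 1 x) (u x) := mulL_normalProjAlong_ae_eq hne u

/-- The normal part of an operator on `H⁴`, as an operator between spaces of normal fields. -/
def normalPart (T : Sobolev d 4 →L[ℝ] L2 d) : H4cPerp (curve F) →L[ℝ] L2Perp (curve F) :=
  ((projL2Perp hne).comp T).comp (H4cPerp (curve F)).subtypeL

theorem normalPart_ae_eq (T : Sobolev d 4 →L[ℝ] L2 d) (φ : H4cPerp (curve F)) :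
    ((normalPart hne T φ : L2 d) : ℝ → EuclideanSpace ℝ (Fin d)) =ᵐ[muI]
      fun x => normalProj (F.rep 1 x) (T φ.1 x) := projL2Perp_ae_eq hne _

theorem normalPart_add (T T' : Sobolev d 4 →L[ℝ] L2 d) :
    normalPart hne (T + T') = normalPart hne T + normalPart hne T' := by
  ext1 φ
  simp [normalPart]

theorem isCompactOperator_normalPart {T : Sobolev d 4 →L[ℝ] L2 d} (hT : IsCompactOperator T) :
    IsCompactOperator (normalPart hne T) :=
  (hT.clm_comp (projL2Perp hne)).comp_clm (H4cPerp (curve F)).subtypeL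

include hne in
/-- The normal part of an element of `H⁴_c` belongs to `H_c^{4,⊥}`. -/
theorem exists_normal_part : ∃ R : Sobolev d 4 →L[ℝ] L2 d, IsCompactOperator R ∧
    ∀ W ∈ H4c d, ∃ φ : H4cPerp (curve F),
      (∀ x ∈ Icc (0 : ℝ) 1, φ.1.rep 0 x = normalProj (F.rep 1 x) (W.rep 0 x)) ∧
      φ.1.wderiv 4 = R W + mulL (normalProjAlong F) (W.wderiv 4) := by
  obtain ⟨c, hc0, hd, hc, h3, h4⟩ := exists_normalProj_derivs hne
  have m : ∀ (a : ℝ) (j) (hj : j ≤ 3), MemLp (fun x => a • c j x) 2 muI := fun a j hj =>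
    memLp_of_continuousOn ((hc j hj).const_smul a)
  -- The terms of the Leibniz expansion of `(PW)''''` in which at least one derivative falls on `P`.
  refine ⟨lowerOp (c 4) 0 + lowerOp (fun x => (4 : ℝ) • c 3 x) 1 +
    lowerOp (fun x => (6 : ℝ) • c 2 x) 2 + lowerOp (fun x => (4 : ℝ) • c 1 x) 3, ?_, ?_⟩
  · exact (((isCompactOperator_lowerOp _ _).add (isCompactOperator_lowerOp _ _)).add
      (isCompactOperator_lowerOp _ _)).add (isCompactOperator_lowerOp _ _)
  · intro W hW
    obtain ⟨w00, w01, w10, w11⟩ := mem_H4c_iff.mp hW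
    obtain ⟨U, hU0, hU1, hU4⟩ := exists_sobolev_clm_apply hd hc h3 h4 W
    have hUX : U ∈ H4cPerp (curve F) := by
      refine mem_H4cPerp_iff.mpr ⟨⟨?_, ?_, ?_, ?_⟩, ?_⟩
      · rw [hU0 0 zero_mem_I, w00, map_zero]
      · rw [hU0 1 one_mem_I, w01, map_zero]
      · rw [hU1 0 zero_mem_I, w00, w10, map_zero, map_zero, add_zero]
      · rw [hU1 1 one_mem_I, w01, w11, map_zero, map_zero, add_zero]
      · filter_upwards [ae_restrict_mem measurableSet_Icc] with x hx
        rw [hU0 x hx, hc0]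
        exact inner_normalProj_self (hne x hx) _
    refine ⟨⟨U, hUX⟩, fun x hx => ?_, Lp.ext ?_⟩
    · simp only
      rw [hU0 x hx, hc0]
    · simp only [add_apply]
      filter_upwards [hU4, Lp.coeFn_add (lowerOp (c 4) 0 W + lowerOp (fun x => (4 : ℝ) • c 3 x) 1 W +
        lowerOp (fun x => (6 : ℝ) • c 2 x) 2 W + lowerOp (fun x => (4 : ℝ) • c 1 x) 3 W)
          (mulL (normalProjAlong F) (W.wderiv 4)),
        Lp.coeFn_add (lowerOp (c 4) 0 W + lowerOp (fun x => (4 : ℝ) • c 3 x) 1 W +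
          lowerOp (fun x => (6 : ℝ) • c 2 x) 2 W) (lowerOp (fun x => (4 : ℝ) • c 1 x) 3 W),
        Lp.coeFn_add (lowerOp (c 4) 0 W + lowerOp (fun x => (4 : ℝ) • c 3 x) 1 W)
          (lowerOp (fun x => (6 : ℝ) • c 2 x) 2 W),
        Lp.coeFn_add (lowerOp (c 4) 0 W) (lowerOp (fun x => (4 : ℝ) • c 3 x) 1 W),
        lowerOp_ae_eq h4 0 W, lowerOp_ae_eq (m 4 3 le_rfl) 1 W,
        lowerOp_ae_eq (m 6 2 (by omega)) 2 W, lowerOp_ae_eq (m 4 1 (by omega)) 3 W,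
        mulL_normalProjAlong_ae_eq hne (W.wderiv 4), W.rep_ae_eq 4] with
        x e0 e1 e2 e3 e4 e5 e6 e7 e8 e9 e10
      rw [e0, e1, Pi.add_apply, e2, Pi.add_apply, e3, Pi.add_apply, e4, Pi.add_apply, e5, e6, e7,
        e8, e9, ← e10, hc0]
      rfl

include hne in
/-- The normal part of the fourth derivative is bijective between the spaces of normal fields. -/
theorem bijective_normalPart_wderiv_four :
    Function.Bijective (normalPart hne (Sobolev.wderivL d 4 4)) := by
  constructor
  -- As `φ` is normal, `P` may be moved across the pairing: `⟨φ'''', φ⟩ = ⟨Pφ'''', φ⟩ = 0`, and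
  -- coercivity applies.
  · rw [injective_iff_map_eq_zero]
    intro φ hφ
    have h1 : mulL (normalProjAlong F) (φ.1.wderiv 4) = 0 := congrArg Subtype.val hφ
    have h2 : mulL (normalProjAlong F) (φ.1.wderiv 0) = φ.1.wderiv 0 :=
      mulL_normalProjAlong_eq hne φ.2.2
    refine Subtype.ext (eq_zero_of_inner_wderiv_four φ.2.1 ?_)
    rw [← h2, ← inner_mulL_normalProjAlong hne, h1, inner_zero_left]
  · obtain ⟨e, he⟩ := exists_equiv_wderiv_four d
    obtain ⟨R, hR, hRW⟩ := exists_normal_part hne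
    -- `D y` is the clamped solution of `W'''' = y`, in general not normal. Its normal part is an
    -- approximate preimage of `y` with compact error `K y`.
    set D : L2Perp (curve F) →L[ℝ] Sobolev d 4 := (H4c d).subtypeL.comp
      ((e.symm : L2 d →L[ℝ] H4c d).comp (L2Perp (curve F)).subtypeL) with hD
    have hDm : ∀ y, D y ∈ H4c d := fun y => (e.symm (y : L2 d)).2
    have hD4 : ∀ y, (D y).wderiv 4 = (y : L2 d) := fun y => by
      rw [← e.apply_symm_apply (y : L2 d), he]; rfl
    set K : L2Perp (curve F) →L[ℝ] L2Perp (curve F) := ((projL2Perp hne).comp R).comp D with hK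
    have hKc : IsCompactOperator K := (hR.clm_comp (projL2Perp hne)).comp_clm D
    have key : ∀ y, ∃ φ : H4cPerp (curve F),
        (∀ x ∈ Icc (0 : ℝ) 1, φ.1.rep 0 x = normalProj (F.rep 1 x) ((D y).rep 0 x)) ∧
        normalPart hne (Sobolev.wderivL d 4 4) φ = y + K y := by
      intro y
      obtain ⟨φ, h0, h4⟩ := hRW (D y) (hDm y)
      refine ⟨φ, h0, Subtype.ext ?_⟩
      change mulL (normalProjAlong F) (φ.1.wderiv 4) =
        (y : L2 d) + mulL (normalProjAlong F) (R (D y))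
      rw [h4, hD4, mulL_normalProjAlong_eq hne y.2, map_add, mulL_normalProjAlong_eq hne y.2,
        add_comm]
    -- If `y + K y = 0`, the normal part of `D y` has image zero, hence vanishes by injectivity.
    -- Then `D y` is tangential while `(D y)'''' = y` is normal, so their pairing is zero and
    -- coercivity gives `D y = 0`.
    have hsurj := hKc.surjective_id_add fun y hy => by
      obtain ⟨φ, h0, h4⟩ := key y
      have hφ4 : mulL (normalProjAlong F) (φ.1.wderiv 4) = 0 := by
        rw [hy] at h4; exact congrArg Subtype.val h4
      have h2 : mulL (normalProjAlong F) (φ.1.wderiv 0) = φ.1.wderiv 0 :=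
        mulL_normalProjAlong_eq hne φ.2.2
      have hφ : φ.1 = 0 := by
        refine eq_zero_of_inner_wderiv_four φ.2.1 ?_
        rw [← h2, ← inner_mulL_normalProjAlong hne, hφ4, inner_zero_left]
      have hDy : D y = 0 := by
        refine eq_zero_of_inner_wderiv_four (hDm y) ?_
        have hz : mulL (normalProjAlong F) ((D y).wderiv 0) = 0 := by
          refine Lp.ext ?_
          filter_upwards [mulL_normalProjAlong_ae_eq hne ((D y).wderiv 0), (D y).rep_ae_eq 0,
            ae_restrict_mem measurableSet_Icc, φ.1.rep_ae_eq 0,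
            Lp.coeFn_zero (EuclideanSpace ℝ (Fin d)) 2 muI] with x e1 e2 hx e3 e4
          rw [e1, ← e2, e4]
          have := h0 x hx
          simp only [Fin.val_zero] at e3 ⊢
          rw [← this, e3, hφ]
          exact e4
        rw [hD4, ← mulL_normalProjAlong_eq hne y.2, inner_mulL_normalProjAlong hne, hz,
          inner_zero_right]
      refine Subtype.ext ?_
      rw [← hD4 y, hDy]
      rfl
    intro z
    obtain ⟨y, hy⟩ := hsurj z
    obtain ⟨φ, -, h4⟩ := key y
    exact ⟨φ, h4.trans hy⟩

/-- The leading part `φ ↦ |∂ₓ f|⁻³ P φ''''` of the linearized operator. -/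
def leadingOp (F : Sobolev d 5) : Sobolev d 4 →L[ℝ] L2 d :=
  (mulL fun x => bendingTensor (F.rep 1 x)).comp (Sobolev.wderivL d 4 4)

include hne in
theorem continuousOn_bendingTensor :
    ContinuousOn (fun x => bendingTensor (F.rep 1 x)) (Icc 0 1) :=
  (smoothOnI_comp_tangent hne fun _ hp => contDiffAt_bendingTensor hp).continuousOn

include hne in
theorem leadingOp_ae_eq (U : Sobolev d 4) :
    leadingOp F U =ᵐ[muI] fun x => bendingTensor (F.rep 1 x) (U.rep 4 x) := by
  filter_upwards [mulL_ae_eq (continuousOn_bendingTensor hne) (U.wderiv 4), U.rep_ae_eq 4]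
    with x h1 h2
  refine h1.trans ?_
  rw [← h2]
  rfl

include hne in
-- The leading operator is `φ ↦ Pφ''''` multiplied by the function `|∂ₓf|⁻³`, which together with
-- its inverse is continuous on `I` and preserves normality.
theorem bijective_normalPart_leadingOp :
    Function.Bijective (normalPart hne (leadingOp F)) := by
  obtain ⟨hinj, hsurj⟩ := bijective_normalPart_wderiv_four hne
  have key : ∀ φ : H4cPerp (curve F),
      ((normalPart hne (leadingOp F) φ : L2 d) : ℝ → EuclideanSpace ℝ (Fin d)) =ᵐ[muI]
        fun x => (‖F.rep 1 x‖ ^ 3)⁻¹ •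
          (normalPart hne (Sobolev.wderivL d 4 4) φ : L2 d) x := by
    intro φ
    filter_upwards [normalPart_ae_eq hne (leadingOp F) φ, leadingOp_ae_eq hne φ.1,
      normalPart_ae_eq hne (Sobolev.wderivL d 4 4) φ, φ.1.rep_ae_eq 4,
      ae_restrict_mem measurableSet_Icc] with x h1 h2 h3 h4 hx
    rw [h1, h2, h3, bendingTensor, smul_apply, map_smul, normalProj_normalProj (hne x hx),
      Sobolev.wderivL_apply, ← h4]
    rfl
  constructor
  · rw [injective_iff_map_eq_zero]
    intro φ hφ
    refine (injective_iff_map_eq_zero _).mp hinj φ (Subtype.ext (Lp.ext ?_))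
    filter_upwards [key φ, Lp.coeFn_zero (EuclideanSpace ℝ (Fin d)) 2 muI,
      ae_restrict_mem measurableSet_Icc] with x h1 h2 hx
    rw [hφ] at h1
    have h3 : ((0 : L2 d) : ℝ → EuclideanSpace ℝ (Fin d)) x = _ := h1
    rw [h2] at h3
    have h4 := (smul_eq_zero.mp h3.symm).resolve_left
      (inv_ne_zero (pow_ne_zero 3 (norm_ne_zero_iff.mpr (hne x hx))))
    rw [h4]
    exact h2.symm
  · intro y
    have hc : ContinuousOn (fun x => ‖F.rep 1 x‖ ^ 3 •
        ContinuousLinearMap.id ℝ (EuclideanSpace ℝ (Fin d))) (Icc 0 1) :=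
      (((F.rep_continuous (by omega)).norm.pow 3).smul continuous_const).continuousOn
    have hmem : mulL (fun x => ‖F.rep 1 x‖ ^ 3 •
        ContinuousLinearMap.id ℝ (EuclideanSpace ℝ (Fin d))) (y : L2 d) ∈ L2Perp (curve F) := by
      rw [mem_L2Perp_iff]
      filter_upwards [mulL_ae_eq hc (y : L2 d), mem_L2Perp_iff.mp y.2] with x h1 h2
      rw [h1, smul_apply, ContinuousLinearMap.id_apply, inner_smul_left, h2, mul_zero]
    obtain ⟨φ, hφ⟩ := hsurj ⟨_, hmem⟩
    refine ⟨φ, Subtype.ext (Lp.ext ?_)⟩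
    filter_upwards [key φ, mulL_ae_eq hc (y : L2 d), ae_restrict_mem measurableSet_Icc]
      with x h1 h2 hx
    rw [h1, hφ, h2, smul_apply, ContinuousLinearMap.id_apply, smul_smul, inv_mul_cancel₀
      (pow_ne_zero 3 (norm_ne_zero_iff.mpr (hne x hx))), one_smul]

/-- A compact perturbation of the leading part is Fredholm of index zero. -/
theorem isFredholm_normalPart_leadingOp_add {R : Sobolev d 4 →L[ℝ] L2 d}
    (hR : IsCompactOperator R) :
    (normalPart hne (leadingOp F + R)).IsFredholm ∧
      fredholmIndex (normalPart hne (leadingOp F + R)) = 0 := by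
  obtain ⟨hinj, hsurj⟩ := bijective_normalPart_leadingOp hne
  let e := ContinuousLinearEquiv.ofBijective (normalPart hne (leadingOp F))
    (LinearMap.ker_eq_bot.mpr hinj) (LinearMap.range_eq_top.mpr hsurj)
  have he : (e : H4cPerp (curve F) →L[ℝ] L2Perp (curve F)) = normalPart hne (leadingOp F) :=
    ContinuousLinearEquiv.coe_ofBijective _ _ _
  rw [normalPart_add, ← he]
  exact e.isFredholm_add_compact (isCompactOperator_normalPart hne hR)

include hne in
/-- `H_c^{4,⊥}` is dense in `L^{2,⊥}`. -/
theorem eq_of_forall_inner_H4cPerp {u v : L2Perp (curve F)}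
    (h : ∀ η : H4cPerp (curve F),
      inner ℝ (u : L2 d) (Sobolev.toL2 d 4 η.1) = inner ℝ (v : L2 d) (Sobolev.toL2 d 4 η.1)) :
    u = v := by
  obtain ⟨R, -, hRW⟩ := exists_normal_part hne
  set y : L2Perp (curve F) := u - v with hy
  -- The admissible variation is the projection of `g w`. Since `y` is normal, pairing with it is
  -- the same as pairing with `g w` itself.
  have key : ∀ g : ℝ → ℝ, IsTestFunction g → ∫ x, g x • (y : L2 d) x ∂muI = 0 := by
    intro g hg
    refine ext_inner_left ℝ fun w => ?_
    rw [inner_zero_right, ← integral_inner (hg.integrable_smul (L2.integrable _))]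
    have hgv : IsTestFunction (fun x => g x • w) :=
      ⟨hg.1.smul contDiff_const, hg.2.1.smul_right (f' := fun _ => w),
        (tsupport_smul_subset_left g (fun _ => w)).trans hg.2.2⟩
    obtain ⟨W, hW⟩ := hgv.exists_sobolev 4
    have hWt : W ∈ Sobolev.testFunctions d 4 := ⟨_, hgv, hW 0⟩
    have hWc : W ∈ H4c d := mem_H4c_iff.mpr
      (hasZeroBoundary_of_mem_SobolevZero (by omega) (Submodule.le_topologicalClosure _ hWt))
    obtain ⟨φ, h0, -⟩ := hRW W hWc
    have h1 : inner ℝ (y : L2 d) (Sobolev.toL2 d 4 φ.1) = 0 := by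
      rw [hy, Submodule.coe_sub, inner_sub_left, h φ, sub_self]
    have h2 : Sobolev.toL2 d 4 φ.1 = mulL (normalProjAlong F) (W.wderiv 0) := by
      refine Lp.ext ?_
      filter_upwards [mulL_normalProjAlong_ae_eq hne (W.wderiv 0), W.rep_ae_eq 0,
        φ.1.rep_zero_ae_eq, ae_restrict_mem measurableSet_Icc] with x e1 e2 e3 hx
      rw [← e3, h0 x hx, e1, ← e2]
      rfl
    rw [h2, ← inner_mulL_normalProjAlong hne, mulL_normalProjAlong_eq hne y.2, L2.inner_def] at h1
    rw [← h1]
    refine integral_congr_ae ?_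
    filter_upwards [hW 0] with x hx
    rw [hx]
    simp only [Fin.val_zero, Function.iterate_zero, id_eq, inner_smul_right]
    rw [real_inner_comm]
  have hz := ae_eq_zero_of_forall_isTestFunction (L2.integrable (y : L2 d)) key
  have hy0 : y = 0 := Subtype.ext (Lp.ext (hz.trans (Lp.coeFn_zero _ _ _).symm))
  exact sub_eq_zero.mp hy0

end NormalFields

end ElasticCurve

namespace ElasticCurve

/-! ### The elastic energy on `H⁴` and its gradient -/

section Energy

variable {d k : ℕ}

theorem continuousOn_comp_of_continuousAt {Z Z' : Type*} [TopologicalSpace Z]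
    [TopologicalSpace Z'] {G : Z → Z'} {u : ℝ → Z} {s : Set ℝ} (hu : ContinuousOn u s)
    (hG : ∀ x ∈ s, ContinuousAt G (u x)) : ContinuousOn (fun x => G (u x)) s := fun x hx =>
  (hG x hx).comp_continuousWithinAt (hu x hx)

/-- A continuous weak derivative is unique on all of `I`, so the existential witness must be `U.rep
1`. -/
theorem isRegularCurve_iff {f : ℝ → EuclideanSpace ℝ (Fin d)} {U : Sobolev d k} (hk : 1 < k)
    (hf : U.rep 0 =ᵐ[muI] f) : IsRegularCurve f ↔ ∀ x ∈ Icc (0 : ℝ) 1, U.rep 1 x ≠ 0 := by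
  have hw : HasWeakDeriv f (U.rep 1) :=
    (U.rep_isPrimitive (j := 0) (by omega)).hasWeakDeriv.congr hf (EventuallyEq.refl _ _)
  have hc : ContinuousOn (U.rep 1) (Icc 0 1) := (U.rep_continuous hk).continuousOn
  refine ⟨fun ⟨g, hg, hgc, hg0⟩ x hx => ?_, fun h => ⟨_, hw, hc, h⟩⟩
  rw [eqOn_Icc_of_ae_eq hc hgc (hw.unique hg) x hx]
  exact hg0 x hx

/-- The radius is the minimum of `|∂ₓU|` on `I`; by the Sobolev inequality a smaller perturbation
cannot cancel it. -/
theorem exists_ball_rep_one_ne_zero {U : Sobolev d k} (hk : 1 < k)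
    (hU : ∀ x ∈ Icc (0 : ℝ) 1, U.rep 1 x ≠ 0) :
    ∃ ρ > 0, ∀ W : Sobolev d k, ‖W‖ < ρ → ∀ x ∈ Icc (0 : ℝ) 1, (U + W).rep 1 x ≠ 0 := by
  obtain ⟨y, hy, hmin⟩ := isCompact_Icc.exists_isMinOn (nonempty_Icc.mpr (zero_le_one' ℝ))
    (U.rep_continuous hk).norm.continuousOn
  refine ⟨‖U.rep 1 y‖, norm_pos_iff.mpr (hU y hy), fun W hW x hx h0 => ?_⟩
  rw [U.rep_add W hk x hx, add_eq_zero_iff_eq_neg] at h0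
  have h1 : ‖U.rep 1 y‖ ≤ ‖U.rep 1 x‖ := hmin hx
  rw [h0, norm_neg] at h1
  linarith [W.norm_rep_le hk hx]

/-- The unit tangent is absolutely continuous on `I`, so the outer `weakDeriv` is a genuine weak
derivative rather than its default value. -/
theorem curvature_ae_eq {f : ℝ → EuclideanSpace ℝ (Fin d)} {U : Sobolev d 4}
    (hf : U.rep 0 =ᵐ[muI] f) (hU : ∀ x ∈ Icc (0 : ℝ) 1, U.rep 1 x ≠ 0) :
    weakDeriv f =ᵐ[muI] U.rep 1 ∧ curvature f =ᵐ[muI]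
      fun x => ‖U.rep 1 x‖⁻¹ • normalDerivSymbol (U.rep 1 x) (U.rep 2 x) := by
  have h1 : weakDeriv f =ᵐ[muI] U.rep 1 :=
    ((U.rep_isPrimitive (j := 0) (by omega)).hasWeakDeriv.congr hf
      (EventuallyEq.refl _ _)).weakDeriv_ae_eq
  have hc : ∀ j < 4, ContinuousOn (U.rep j) (Icc 0 1) := fun j hj =>
    (U.rep_continuous hj).continuousOn
  have hN : ContinuousOn (fun x => normalDerivSymbol (U.rep 1 x)) (Icc 0 1) := fun x hx =>
    (contDiffAt_normalDerivSymbol (hU x hx)).continuousAt.comp_continuousWithinAt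
      (hc 1 (by omega) x hx)
  have h2 : IsPrimitive (fun x => ‖U.rep 1 x‖⁻¹ • U.rep 1 x)
      (fun x => normalDerivSymbol (U.rep 1 x) (U.rep 2 x)) :=
    isPrimitive_of_hasDerivAt
      (fun x hx => hasDerivAt_unit_tangent (U.rep_hasDerivAt (by omega) x) (hU x hx))
      (hN.clm_apply (hc 2 (by omega)))
  have h3 : arcDeriv f f =ᵐ[muI] fun x => ‖U.rep 1 x‖⁻¹ • U.rep 1 x := by
    filter_upwards [h1] with x hx
    rw [arcDeriv, hx]
  have h4 := (h2.hasWeakDeriv.congr h3.symm (EventuallyEq.refl _ _)).weakDeriv_ae_eq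
  refine ⟨h1, ?_⟩
  filter_upwards [h1, h4] with x e1 e4
  rw [curvature, arcDeriv, e1, e4]

/-- The elastic energy as a function on `H⁴`. -/
def sobolevEnergy (U : Sobolev d 4) : ℝ := ∫ x, energyDensity (U.rep 1 x, U.rep 2 x) ∂muI

/-- The curvature is `|p|⁻²Pq`, and `|Pq|² = ⟨Pq, q⟩`; with the length element this gives the weight
`|p|⁻³`. -/
theorem elasticEnergy_eq {f : ℝ → EuclideanSpace ℝ (Fin d)} {U : Sobolev d 4}
    (hf : U.rep 0 =ᵐ[muI] f) (hU : ∀ x ∈ Icc (0 : ℝ) 1, U.rep 1 x ≠ 0) :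
    elasticEnergy f = sobolevEnergy U := by
  obtain ⟨h1, h2⟩ := curvature_ae_eq hf hU
  rw [elasticEnergy, sobolevEnergy, ← integral_const_mul]
  refine integral_congr_ae ?_
  filter_upwards [h1, h2, ae_restrict_mem measurableSet_Icc] with x e1 e2 hx
  have h0 : ‖U.rep 1 x‖ ≠ 0 := norm_ne_zero_iff.mpr (hU x hx)
  have e3 : inner ℝ (normalProj (U.rep 1 x) (U.rep 2 x)) (U.rep 2 x) =
      ‖normalProj (U.rep 1 x) (U.rep 2 x)‖ ^ 2 := by
    rw [← real_inner_self_eq_norm_sq, ← inner_normalProj_left, normalProj_normalProj (hU x hx),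
      inner_normalProj_left, real_inner_comm]
  rw [e1, e2, energyDensity, bendingTensor, normalDerivSymbol, smul_apply, smul_apply,
    real_inner_smul_left, e3, norm_smul, norm_smul, norm_inv, norm_norm]
  field_simp

variable {U : Sobolev d 4} (hU : ∀ x ∈ Icc (0 : ℝ) 1, U.rep 1 x ≠ 0)

theorem continuousOn_rep_pair (U : Sobolev d 4) :
    ContinuousOn (fun x => (U.rep 1 x, U.rep 2 x)) (Icc 0 1) :=
  ((U.rep_continuous (by omega)).prodMk (U.rep_continuous (by omega))).continuousOn

include hU in
theorem continuousOn_densityGradient :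
    ContinuousOn (fun x => densityGradient (U.rep 1 x, U.rep 2 x)) (Icc 0 1) :=
  continuousOn_comp_of_continuousAt (continuousOn_rep_pair U) fun x hx =>
    (contDiffAt_densityGradient (z := (U.rep 1 x, U.rep 2 x)) (hU x hx)).continuousAt

include hU in
theorem continuousOn_bendingTensor_rep :
    ContinuousOn (fun x => bendingTensor (U.rep 1 x)) (Icc 0 1) := fun x hx =>
  (contDiffAt_bendingTensor (hU x hx)).continuousAt.comp_continuousWithinAt
    (U.rep_continuous (by omega)).continuousAt.continuousWithinAt

include hU in
theorem integrable_energyDensity :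
    Integrable (fun x => energyDensity (U.rep 1 x, U.rep 2 x)) muI :=
  integrable_muI_of_continuousOn 
    (continuousOn_comp_of_continuousAt (continuousOn_rep_pair U) fun x hx =>
      (hasFDerivAt_energyDensity (z := (U.rep 1 x, U.rep 2 x)) (hU x hx)).1.continuousAt)

include hU in
/-- The first variation of the elastic energy. -/
theorem exists_hasFDerivAt_sobolevEnergy :
    ∃ D : Sobolev d 4 →L[ℝ] ℝ, HasFDerivAt sobolevEnergy D U ∧ ∀ W,
      D W = ∫ x, inner ℝ (densityGradient (U.rep 1 x, U.rep 2 x)) (W.rep 1 x) ∂muI +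
        ∫ x, inner ℝ (bendingTensor (U.rep 1 x) (U.rep 2 x)) (W.rep 2 x) ∂muI := by
  have hca := continuousOn_densityGradient hU
  have hcb := (continuousOn_bendingTensor_rep hU).clm_apply
    (U.rep_continuous (j := 2) (by omega)).continuousOn
  have key : ∀ (a : ℝ → EuclideanSpace ℝ (Fin d)) (ha : MemLp a 2 muI) (j : Fin 5)
      (W : Sobolev d 4), inner ℝ (ha.toLp a) (W.wderiv j) = ∫ x, inner ℝ (a x) (W.rep j x) ∂muI := by
    intro a ha j W
    rw [L2.inner_def]
    refine integral_congr_ae ?_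
    filter_upwards [ha.coeFn_toLp, W.rep_ae_eq j] with x h1 h2
    rw [h1, h2]
  have hma := memLp_of_continuousOn hca
  have hmb := memLp_of_continuousOn hcb
  set D : Sobolev d 4 →L[ℝ] ℝ := (innerSL ℝ (hma.toLp _)).comp (Sobolev.wderivL d 4 1) +
    (innerSL ℝ (hmb.toLp _)).comp (Sobolev.wderivL d 4 2) with hD
  have hDW : ∀ W, D W =
      ∫ x, inner ℝ (densityGradient (U.rep 1 x, U.rep 2 x)) (W.rep 1 x) ∂muI +
        ∫ x, inner ℝ (bendingTensor (U.rep 1 x) (U.rep 2 x)) (W.rep 2 x) ∂muI := fun W =>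
    congrArg₂ (· + ·) (key _ hma 1 W) (key _ hmb 2 W)
  refine ⟨D, ?_, hDW⟩
  rw [hasFDerivAt_iff_isLittleO_nhds_zero, Asymptotics.isLittleO_iff]
  intro ε hε
  obtain ⟨ρ, hρ, hreg⟩ := exists_ball_rep_one_ne_zero (by omega) hU
  -- The pair of first and second derivatives moves by at most `‖W‖` uniformly on `I`, so the
  -- uniform pointwise expansion integrates to the Fréchet expansion.
  obtain ⟨δ, hδ, hun⟩ := exists_uniform_fderiv (continuousOn_rep_pair U)
    (fun x hx => (hasFDerivAt_energyDensity (z := (U.rep 1 x, U.rep 2 x)) (hU x hx)).1.of_le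
      (by exact_mod_cast le_top)) hε
  filter_upwards [Metric.ball_mem_nhds (0 : Sobolev d 4) (lt_min hρ hδ)] with W hW
  rw [mem_ball_zero_iff, lt_min_iff] at hW
  have i1 := integrable_inner_of_continuousOn hca
    (integrable_muI_of_continuousOn (W.rep_continuous (j := 1) (by omega)).continuousOn)
  have i2 := integrable_inner_of_continuousOn hcb
    (integrable_muI_of_continuousOn (W.rep_continuous (j := 2) (by omega)).continuousOn)
  have i3 := integrable_energyDensity (hreg W hW.1)
  have i4 := integrable_energyDensity hU
  rw [hDW, sobolevEnergy, sobolevEnergy, ← integral_sub i3 i4, ← integral_add i1 i2]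
  have i34 : Integrable (fun x => energyDensity ((U + W).rep 1 x, (U + W).rep 2 x) -
      energyDensity (U.rep 1 x, U.rep 2 x)) muI := i3.sub i4
  have i12 : Integrable (fun x => inner ℝ (densityGradient (U.rep 1 x, U.rep 2 x)) (W.rep 1 x) +
      inner ℝ (bendingTensor (U.rep 1 x) (U.rep 2 x)) (W.rep 2 x)) muI := i1.add i2
  rw [← integral_sub i34 i12]
  have hμ : muI.real univ = 1 := by simp [muI, Measure.real]
  refine (norm_integral_le_of_norm_le_const (C := ε * ‖W‖) ?_).trans (by rw [hμ, mul_one])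
  filter_upwards [ae_restrict_mem measurableSet_Icc] with x hx
  have hh : ‖(W.rep 1 x, W.rep 2 x)‖ ≤ ‖W‖ :=
    max_le (W.norm_rep_le (by omega) hx) (W.norm_rep_le (by omega) hx)
  have := hun x hx (W.rep 1 x, W.rep 2 x) (hh.trans_lt hW.2)
  rw [(hasFDerivAt_energyDensity (z := (U.rep 1 x, U.rep 2 x)) (hU x hx)).2, Prod.mk_add_mk,
    ← U.rep_add W (by omega) x hx, ← U.rep_add W (by omega) x hx] at this
  exact this.trans (mul_le_mul_of_nonneg_left hh hε.le)

/-- The Euler–Lagrange operator of the elastic energy, pointwise. -/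
def eulerLagrange (U : Sobolev d 4) : ℝ → EuclideanSpace ℝ (Fin d) := fun x =>
  bendingTensor (U.rep 1 x) (U.rep 4 x) + eulerLagrangeLower (U.rep 1 x, U.rep 2 x, U.rep 3 x)

theorem continuousOn_rep_triple (U : Sobolev d 4) :
    ContinuousOn (fun x => (U.rep 1 x, U.rep 2 x, U.rep 3 x)) (Icc 0 1) :=
  ((U.rep_continuous (by omega)).prodMk ((U.rep_continuous (by omega)).prodMk
    (U.rep_continuous (by omega)))).continuousOn

include hU in
theorem continuousOn_eulerLagrangeLower :
    ContinuousOn (fun x => eulerLagrangeLower (U.rep 1 x, U.rep 2 x, U.rep 3 x)) (Icc 0 1) :=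
  continuousOn_comp_of_continuousAt (continuousOn_rep_triple U) fun x hx =>
    (contDiffAt_eulerLagrangeLower (z := (U.rep 1 x, U.rep 2 x, U.rep 3 x)) (hU x hx)).continuousAt

include hU in
theorem memLp_eulerLagrange : MemLp (eulerLagrange U) 2 muI :=
  (memLp_clm_apply (continuousOn_bendingTensor_rep hU) (U.rep_memLp (by omega))).add
    (memLp_of_continuousOn (continuousOn_eulerLagrangeLower hU))

include hU in
/-- Integration by parts in the first variation. -/
theorem firstVariation_eq_integral_eulerLagrange {W : Sobolev d 4} (hW : HasZeroBoundary W) :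
    ∫ x, inner ℝ (densityGradient (U.rep 1 x, U.rep 2 x)) (W.rep 1 x) ∂muI +
        ∫ x, inner ℝ (bendingTensor (U.rep 1 x) (U.rep 2 x)) (W.rep 2 x) ∂muI =
      ∫ x, inner ℝ (eulerLagrange U x) (W.rep 0 x) ∂muI := by
  obtain ⟨w00, w01, w10, w11⟩ := hW
  have hu : ∀ j, j + 1 < 4 → ∀ x, HasDerivAt (U.rep j) (U.rep (j + 1) x) x := fun j hj =>
    U.rep_hasDerivAt hj
  have huc : ∀ j < 4, ContinuousOn (U.rep j) (Icc 0 1) := fun j hj =>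
    (U.rep_continuous hj).continuousOn
  have hwc : ∀ j < 4, ContinuousOn (W.rep j) (Icc 0 1) := fun j hj =>
    (W.rep_continuous hj).continuousOn
  have hwi := fun j hj => integrable_muI_of_continuousOn (hwc j hj)
  have hpair : ∀ x, HasDerivAt (fun x => (U.rep 1 x, U.rep 2 x)) (U.rep 2 x, U.rep 3 x) x :=
    fun x => (hu 1 (by omega) x).prodMk (hu 2 (by omega) x)
  have hC : ∀ x ∈ Icc (0 : ℝ) 1, HasDerivAt (fun x => bendingTensor (U.rep 1 x))
      (fderiv ℝ bendingTensor (U.rep 1 x) (U.rep 2 x)) x := fun x hx =>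
    ((contDiffAt_bendingTensor (hU x hx)).differentiableAt
      (by simp)).hasFDerivAt.comp_hasDerivAt x (hu 1 (by omega) x)
  have hCc : ContinuousOn (fun x => fderiv ℝ bendingTensor (U.rep 1 x) (U.rep 2 x)) (Icc 0 1) :=
    ContinuousOn.clm_apply (fun x hx =>
      (contDiffAt_fderiv_bendingTensor (hU x hx)).continuousAt.comp_continuousWithinAt
        (huc 1 (by omega) x hx)) (huc 2 (by omega))
  have hbc := continuousOn_bendingTensor_rep hU
  set a : ℝ → EuclideanSpace ℝ (Fin d) := fun x => densityGradient (U.rep 1 x, U.rep 2 x) with ha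
  have hac : ContinuousOn a (Icc 0 1) := continuousOn_densityGradient hU
  set b : ℝ → EuclideanSpace ℝ (Fin d) := fun x => bendingTensor (U.rep 1 x) (U.rep 2 x) with hb
  set b' : ℝ → EuclideanSpace ℝ (Fin d) := fun x =>
    fderiv ℝ bendingTensor (U.rep 1 x) (U.rep 2 x) (U.rep 2 x) +
      bendingTensor (U.rep 1 x) (U.rep 3 x) with hb'
  have hbb' : ∀ x ∈ Icc (0 : ℝ) 1, HasDerivAt b (b' x) x := fun x hx =>
    (hC x hx).clm_apply (hu 2 (by omega) x)
  have hb'c : ContinuousOn b' (Icc 0 1) :=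
    (hCc.clm_apply (huc 2 (by omega))).add (hbc.clm_apply (huc 3 (by omega)))
  -- The Euler–Lagrange expression is `b'' - a'`. Only the summand `M(∂ₓU)∂ₓ³U` of `b'` fails to be
  -- `C¹`, so in the second integration by parts `W` is the smooth factor.
  have hprim : IsPrimitive (fun x => b' x - a x) (eulerLagrange U) := by
    have q1 := IsPrimitive.clm_apply hC hCc (U.rep_isPrimitive (j := 3) (by omega))
    have q2 : IsPrimitive (fun x => fderiv ℝ bendingTensor (U.rep 1 x) (U.rep 2 x) (U.rep 2 x) - a x)
        (fun x => fderiv ℝ (fun y : EuclideanSpace ℝ (Fin d) × EuclideanSpace ℝ (Fin d) =>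
          fderiv ℝ bendingTensor y.1 y.2 y.2) (U.rep 1 x, U.rep 2 x) (U.rep 2 x, U.rep 3 x) -
          fderiv ℝ densityGradient (U.rep 1 x, U.rep 2 x) (U.rep 2 x, U.rep 3 x)) := by
      refine isPrimitive_of_hasDerivAt (fun x hx => ?_) ?_
      · have e1 := ((contDiffAt_bendingTensor_deriv (z := (U.rep 1 x, U.rep 2 x))
          (hU x hx)).differentiableAt (by simp)).hasFDerivAt.comp_hasDerivAt x (hpair x)
        have e2 := ((contDiffAt_densityGradient (z := (U.rep 1 x, U.rep 2 x))
          (hU x hx)).differentiableAt (by simp)).hasFDerivAt.comp_hasDerivAt x (hpair x)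
        exact e1.sub e2
      · have hc2 : ContinuousOn (fun x => (U.rep 2 x, U.rep 3 x)) (Icc 0 1) :=
          (huc 2 (by omega)).prodMk (huc 3 (by omega))
        refine ContinuousOn.sub
          (ContinuousOn.clm_apply (continuousOn_comp_of_continuousAt (continuousOn_rep_pair U)
            fun x hx => ?_) hc2)
          (ContinuousOn.clm_apply (continuousOn_comp_of_continuousAt (continuousOn_rep_pair U)
            fun x hx => ?_) hc2)
        · exact ((contDiffAt_bendingTensor_deriv (z := (U.rep 1 x, U.rep 2 x))
            (hU x hx)).fderiv_right (m := ∞) (by simp)).continuousAt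
        · exact ((contDiffAt_densityGradient (z := (U.rep 1 x, U.rep 2 x))
            (hU x hx)).fderiv_right (m := ∞) (by simp)).continuousAt
    refine (q2.add q1).congr (fun x _ => ?_) (Eventually.of_forall fun x => ?_)
    · simp only [hb']
      abel
    · simp only [eulerLagrange, eulerLagrangeLower]
      abel
  have e1 := integral_inner_add_eq hbb' hb'c (W.rep_isPrimitive (j := 1) (by omega))
  have e2 := integral_inner_add_eq (fun x _ => W.rep_hasDerivAt (j := 0) (by omega) x)
    (hwc 1 (by omega)) hprim
  simp only [zero_add, Nat.reduceAdd, w00, w01, w10, w11, inner_zero_left, inner_zero_right,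
    sub_self] at e1 e2
  rw [integral_add (integrable_inner_of_continuousOn hb'c (hwi 1 (by omega)))
    (integrable_inner_of_continuousOn (hbc.clm_apply (huc 2 (by omega))) (hwi 2 (by omega)))] at e1
  rw [integral_add (f := fun x => inner ℝ (W.rep 1 x) (b' x - a x))
    (integrable_inner_of_continuousOn (hwc 1 (by omega))
      (integrable_muI_of_continuousOn (hb'c.sub hac)))
    (integrable_inner_of_continuousOn (hwc 0 (by omega)) hprim.1)] at e2
  simp only [inner_sub_right] at e2
  rw [integral_sub (integrable_inner_of_continuousOn (hwc 1 (by omega))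
      (integrable_muI_of_continuousOn hb'c))
    (integrable_inner_of_continuousOn (hwc 1 (by omega))
      (integrable_muI_of_continuousOn hac))] at e2
  have hcomm : ∀ u v : ℝ → EuclideanSpace ℝ (Fin d),
      ∫ x, inner ℝ (u x) (v x) ∂muI = ∫ x, inner ℝ (v x) (u x) ∂muI := fun u v =>
    integral_congr_ae (Eventually.of_forall fun x => real_inner_comm _ _)
  rw [hcomm _ a, hcomm _ b', hcomm _ (eulerLagrange U)] at e2
  linarith

open Classical in
/-- The `L²` gradient of the elastic energy on `H⁴` (with respect to variations in `H⁴_c`) at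
immersed curves. -/
def sobolevGradient (U : Sobolev d 4) : L2 d :=
  if h : MemLp (eulerLagrange U) 2 muI then h.toLp _ else 0

include hU in
theorem sobolevGradient_ae_eq : sobolevGradient U =ᵐ[muI] eulerLagrange U := by
  rw [sobolevGradient, dif_pos (memLp_eulerLagrange hU)]
  exact (memLp_eulerLagrange hU).coeFn_toLp

include hU in
theorem exists_hasFDerivAt_sobolevEnergy_inner :
    ∃ D : Sobolev d 4 →L[ℝ] ℝ, HasFDerivAt sobolevEnergy D U ∧
      ∀ W ∈ H4c d, D W = inner ℝ (sobolevGradient U) (Sobolev.toL2 d 4 W) := by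
  obtain ⟨D, hD, hDW⟩ := exists_hasFDerivAt_sobolevEnergy hU
  refine ⟨D, hD, fun W hW => ?_⟩
  rw [hDW, firstVariation_eq_integral_eulerLagrange hU (mem_H4c_iff.mp hW), L2.inner_def]
  refine integral_congr_ae ?_
  filter_upwards [sobolevGradient_ae_eq hU, W.rep_zero_ae_eq] with x h1 h2
  rw [h1, h2]

end Energy

/-! ### Normal variations -/

section NormalVariations

variable {d : ℕ}

theorem exists_truncation (F : Sobolev d 5) : ∃ U : Sobolev d 4,
    ∀ j < 4, ∀ x ∈ Icc (0 : ℝ) 1, U.rep j x = F.rep j x := by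
  obtain ⟨U, hU⟩ := Sobolev.exists_of_hasWeakDeriv (k := 4) F.rep
    (fun j hj => F.rep_memLp (by omega)) fun j hj => (F.rep_isPrimitive (by omega)).hasWeakDeriv
  exact ⟨U, fun j hj => U.rep_eq_of_ae_eq hj (F.rep_continuous (by omega)).continuousOn
    (hU ⟨j, by omega⟩)⟩

/-- A curve in `H⁵` as an element of `H⁴`. -/
def truncation (F : Sobolev d 5) : Sobolev d 4 := (exists_truncation F).choose

theorem truncation_rep (F : Sobolev d 5) {j : ℕ} (hj : j < 4) :
    ∀ x ∈ Icc (0 : ℝ) 1, (truncation F).rep j x = F.rep j x :=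
  (exists_truncation F).choose_spec j hj

variable {F : Sobolev d 5}

theorem truncation_add_rep_zero_ae_eq (φ : H4cPerp (curve F)) :
    (truncation F + φ.1).rep 0 =ᵐ[muI] curve F + H4cPerp.field φ := by
  filter_upwards [F.rep_zero_ae_eq, φ.1.rep_zero_ae_eq, ae_restrict_mem measurableSet_Icc]
    with x h1 h2 hx
  rw [(truncation F).rep_add φ.1 (by omega) x hx, truncation_rep F (by omega) x hx, h1, h2]
  rfl

theorem isRegularCurve_add_field_iff (φ : H4cPerp (curve F)) :
    IsRegularCurve (curve F + H4cPerp.field φ) ↔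
      ∀ x ∈ Icc (0 : ℝ) 1, (truncation F + φ.1).rep 1 x ≠ 0 :=
  isRegularCurve_iff (by omega) (truncation_add_rep_zero_ae_eq φ)

variable (hne : ∀ x ∈ Icc (0 : ℝ) 1, F.rep 1 x ≠ 0)

include hne in
theorem truncation_rep_one_ne_zero : ∀ x ∈ Icc (0 : ℝ) 1, (truncation F).rep 1 x ≠ 0 :=
  fun x hx => by
    rw [truncation_rep F (by omega) x hx]
    exact hne x hx

include hne in
theorem exists_isAdmissibleRadius : ∃ ρ, IsAdmissibleRadius (curve F) ρ := by
  obtain ⟨ρ, hρ, h⟩ := exists_ball_rep_one_ne_zero (by omega) (truncation_rep_one_ne_zero hne)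
  refine ⟨ρ, hρ, fun φ hφ => ?_⟩
  rw [isRegularCurve_add_field_iff]
  exact h φ.1 (mem_ball_zero_iff.mp hφ)

/-- The `L²(dx)` gradient of the energy of normal variations. -/
def normalGradient (φ : H4cPerp (curve F)) : L2Perp (curve F) :=
  projL2Perp hne (sobolevGradient (truncation F + φ.1))

/-- The derivative on `H⁴` is restricted to normal fields; replacing the gradient by its normal part
does not change its pairing with a normal `η`. -/
theorem hasFDerivAt_normalEnergy {φ : H4cPerp (curve F)}
    (hφ : IsRegularCurve (curve F + H4cPerp.field φ)) :
    ∃ D : H4cPerp (curve F) →L[ℝ] ℝ, HasFDerivAt (normalEnergy (curve F)) D φ ∧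
      ∀ η : H4cPerp (curve F),
        D η = inner ℝ (normalGradient hne φ : L2 d) (Sobolev.toL2 d 4 η.1) := by
  have hU := (isRegularCurve_add_field_iff φ).mp hφ
  obtain ⟨D, hD, hDW⟩ := exists_hasFDerivAt_sobolevEnergy_inner hU
  refine ⟨D.comp (H4cPerp (curve F)).subtypeL, ?_, fun η => ?_⟩
  · have h1 : HasFDerivAt (fun ψ : H4cPerp (curve F) => truncation F + ψ.1)
        (H4cPerp (curve F)).subtypeL φ := (H4cPerp (curve F)).subtypeL.hasFDerivAt.const_add _
    -- The two energies are identified only at immersed curves, hence on a neighbourhood of `φ`.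
    refine (HasFDerivAt.comp φ hD h1).congr_of_eventuallyEq ?_
    obtain ⟨ρ, hρ, hreg⟩ := exists_ball_rep_one_ne_zero (by omega) hU
    filter_upwards [Metric.ball_mem_nhds φ hρ] with ψ hψ
    have h2 : truncation F + φ.1 + (ψ.1 - φ.1) = truncation F + ψ.1 := by abel
    have h3 := hreg (ψ.1 - φ.1) (by rw [mem_ball_iff_norm] at hψ; exact hψ)
    rw [h2] at h3
    exact elasticEnergy_eq (truncation_add_rep_zero_ae_eq ψ) h3
  · change D η.1 = inner ℝ (mulL (normalProjAlong F) (sobolevGradient (truncation F + φ.1)))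
      (Sobolev.toL2 d 4 η.1)
    rw [inner_mulL_normalProjAlong hne, mulL_normalProjAlong_eq hne η.2.2]
    exact hDW η.1 η.2.1

theorem isL2Gradient_normalGradient {ρ : ℝ} (hρ : IsAdmissibleRadius (curve F) ρ) :
    IsL2Gradient (curve F) ρ (normalGradient hne) := by
  intro φ hφ
  obtain ⟨D, hD, hDη⟩ := hasFDerivAt_normalEnergy hne (hρ.2 φ hφ)
  exact ⟨hD.differentiableAt, fun η => by rw [hD.fderiv, hDη]⟩

/-- Density of the variations makes the gradient unique on the ball, so an arbitrary gradient
inherits differentiability at `0`. -/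
theorem IsL2Gradient.eq_normalGradient {ρ : ℝ} (hρ : IsAdmissibleRadius (curve F) ρ)
    {G : H4cPerp (curve F) → L2Perp (curve F)} (hG : IsL2Gradient (curve F) ρ G) :
    ∀ φ ∈ Metric.ball (0 : H4cPerp (curve F)) ρ, G φ = normalGradient hne φ := by
  intro φ hφ
  refine eq_of_forall_inner_H4cPerp hne fun η => ?_
  rw [← (hG φ hφ).2 η, ← (isL2Gradient_normalGradient hne hρ φ hφ).2 η]

end NormalVariations

end ElasticCurve

namespace ElasticCurve

/-! ### The linearization of the gradient -/

section Linearization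

variable {d : ℕ}

/-- The measure on `I` has mass one, so a constant has itself as norm. The form fits a remainder
that combines `L²` fourth derivatives with uniformly bounded terms. -/
theorem L2.norm_le_of_ae_le_add {u v w : L2 d} {α β γ : ℝ} (hα : 0 ≤ α) (hβ : 0 ≤ β) (hγ : 0 ≤ γ)
    (h : ∀ᵐ x ∂muI, ‖u x‖ ≤ α * ‖v x‖ + β * ‖w x‖ + γ) : ‖u‖ ≤ α * ‖v‖ + β * ‖w‖ + γ := by
  have : IsProbabilityMeasure muI := ⟨by simp [muI]⟩
  have hn : ∀ v : L2 d, ‖(Lp.memLp v).norm.toLp _‖ = ‖v‖ := fun v => by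
    rw [Lp.norm_toLp, eLpNorm_norm, Lp.norm_def]
  set g : Lp ℝ 2 muI := α • (Lp.memLp v).norm.toLp _ + β • (Lp.memLp w).norm.toLp _ +
    Lp.const 2 muI γ with hg
  have h1 : ‖u‖ ≤ ‖g‖ := by
    refine Lp.norm_le_norm_of_ae_le ?_
    filter_upwards [h, Lp.coeFn_add (α • (Lp.memLp v).norm.toLp _ + β • (Lp.memLp w).norm.toLp _)
        (Lp.const 2 muI γ),
      Lp.coeFn_add (α • (Lp.memLp v).norm.toLp _) (β • (Lp.memLp w).norm.toLp _),
      Lp.coeFn_smul α ((Lp.memLp v).norm.toLp _), Lp.coeFn_smul β ((Lp.memLp w).norm.toLp _),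
      (Lp.memLp v).norm.coeFn_toLp, (Lp.memLp w).norm.coeFn_toLp,
      Lp.coeFn_const 2 muI γ] with x e0 e1 e2 e3 e4 e5 e6 e7
    rw [hg, e1, Pi.add_apply, e2, Pi.add_apply, e3, e4, Pi.smul_apply, Pi.smul_apply, e5, e6, e7]
    exact e0.trans (le_abs_self _)
  refine h1.trans ((norm_add_le _ _).trans (add_le_add ((norm_add_le _ _).trans ?_) ?_))
  · rw [norm_smul, norm_smul, hn, hn, Real.norm_of_nonneg hα, Real.norm_of_nonneg hβ]
  · have := Lp.norm_const_le (p := 2) (μ := muI) γ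
    simpa [Measure.real, Real.norm_of_nonneg hγ, muI] using this

variable {U : Sobolev d 4} (hU : ∀ x ∈ Icc (0 : ℝ) 1, U.rep 1 x ≠ 0)

include hU in
theorem continuousOn_fderiv_bendingTensor :
    ContinuousOn (fun x => fderiv ℝ bendingTensor (U.rep 1 x)) (Icc 0 1) :=
  continuousOn_comp_of_continuousAt (U.rep_continuous (by omega)).continuousOn fun x hx =>
    (contDiffAt_fderiv_bendingTensor (hU x hx)).continuousAt

include hU in
/-- The lower order terms of the linearized Euler–Lagrange operator. -/
theorem exists_lowerOrder_linearization : ∃ R : Sobolev d 4 →L[ℝ] L2 d, IsCompactOperator R ∧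
    ∀ W, R W =ᵐ[muI] fun x => fderiv ℝ bendingTensor (U.rep 1 x) (W.rep 1 x) (U.rep 4 x) +
      fderiv ℝ eulerLagrangeLower (U.rep 1 x, U.rep 2 x, U.rep 3 x)
        (W.rep 1 x, W.rep 2 x, W.rep 3 x) := by
  set L : ℝ → (EuclideanSpace ℝ (Fin d) × EuclideanSpace ℝ (Fin d) × EuclideanSpace ℝ (Fin d)) →L[ℝ]
    EuclideanSpace ℝ (Fin d) :=
    fun x => fderiv ℝ eulerLagrangeLower (U.rep 1 x, U.rep 2 x, U.rep 3 x) with hL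
  have hLc : ContinuousOn L (Icc 0 1) :=
    continuousOn_comp_of_continuousAt (continuousOn_rep_triple U) fun x hx =>
      ((contDiffAt_eulerLagrangeLower (z := (U.rep 1 x, U.rep 2 x, U.rep 3 x))
        (hU x hx)).fderiv_right (m := ∞) (by simp)).continuousAt
  have hLcomp : ∀ J : EuclideanSpace ℝ (Fin d) →L[ℝ] (EuclideanSpace ℝ (Fin d) ×
      EuclideanSpace ℝ (Fin d) × EuclideanSpace ℝ (Fin d)),
      MemLp (fun x => (L x).comp J) 2 muI := fun J =>
    memLp_of_continuousOn (hLc.clm_comp continuousOn_const)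
  -- This coefficient contains `∂ₓ⁴U`, which is only in `L²`; it acts on `∂ₓW`, which is continuous.
  have hs : MemLp (fun x => (fderiv ℝ bendingTensor (U.rep 1 x)).flip (U.rep 4 x)) 2 muI :=
    memLp_clm_apply ((ContinuousLinearMap.flipₗᵢ ℝ (EuclideanSpace ℝ (Fin d))
      (EuclideanSpace ℝ (Fin d)) (EuclideanSpace ℝ (Fin d))).continuous.comp_continuousOn
      (continuousOn_fderiv_bendingTensor hU)) (U.rep_memLp (by omega))
  set J1 := ContinuousLinearMap.inl ℝ (EuclideanSpace ℝ (Fin d))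
    (EuclideanSpace ℝ (Fin d) × EuclideanSpace ℝ (Fin d)) with hJ1
  set J := ContinuousLinearMap.inr ℝ (EuclideanSpace ℝ (Fin d))
    (EuclideanSpace ℝ (Fin d) × EuclideanSpace ℝ (Fin d)) with hJ
  set J2 := J.comp (ContinuousLinearMap.inl ℝ (EuclideanSpace ℝ (Fin d))
    (EuclideanSpace ℝ (Fin d))) with hJ2
  set J3 := J.comp (ContinuousLinearMap.inr ℝ (EuclideanSpace ℝ (Fin d))
    (EuclideanSpace ℝ (Fin d))) with hJ3
  refine ⟨lowerOp (fun x => (fderiv ℝ bendingTensor (U.rep 1 x)).flip (U.rep 4 x)) 1 +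
    (lowerOp (fun x => (L x).comp J1) 1 + lowerOp (fun x => (L x).comp J2) 2 +
      lowerOp (fun x => (L x).comp J3) 3), ?_, fun W => ?_⟩
  · exact (isCompactOperator_lowerOp _ _).add (((isCompactOperator_lowerOp _ _).add
      (isCompactOperator_lowerOp _ _)).add (isCompactOperator_lowerOp _ _))
  · filter_upwards [lowerOp_ae_eq hs 1 W, lowerOp_ae_eq (hLcomp J1) 1 W,
      lowerOp_ae_eq (hLcomp J2) 2 W, lowerOp_ae_eq (hLcomp J3) 3 W,
      Lp.coeFn_add (lowerOp (fun x => (fderiv ℝ bendingTensor (U.rep 1 x)).flip (U.rep 4 x)) 1 W)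
        (lowerOp (fun x => (L x).comp J1) 1 W + lowerOp (fun x => (L x).comp J2) 2 W +
          lowerOp (fun x => (L x).comp J3) 3 W),
      Lp.coeFn_add (lowerOp (fun x => (L x).comp J1) 1 W + lowerOp (fun x => (L x).comp J2) 2 W)
        (lowerOp (fun x => (L x).comp J3) 3 W),
      Lp.coeFn_add (lowerOp (fun x => (L x).comp J1) 1 W) (lowerOp (fun x => (L x).comp J2) 2 W)]
      with x e1 e2 e3 e4 e5 e6 e7
    simp only [add_apply]
    rw [e5, Pi.add_apply, e6, Pi.add_apply, e7, Pi.add_apply, e1, e2, e3, e4]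
    simp only [ContinuousLinearMap.comp_apply, ← map_add, ContinuousLinearMap.flip_apply]
    congr 2
    simp [hJ1, hJ2, hJ3, hJ]

include hU in
/-- The gradient is Fréchet differentiable at immersed curves, as a map from `H⁴` to `L²`. -/
theorem exists_hasFDerivAt_sobolevGradient : ∃ R : Sobolev d 4 →L[ℝ] L2 d, IsCompactOperator R ∧
    HasFDerivAt sobolevGradient
      ((mulL fun x => bendingTensor (U.rep 1 x)).comp (Sobolev.wderivL d 4 4) + R) U := by
  obtain ⟨R, hR, hRW⟩ := exists_lowerOrder_linearization hU
  refine ⟨R, hR, ?_⟩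
  rw [hasFDerivAt_iff_isLittleO_nhds_zero, Asymptotics.isLittleO_iff]
  intro c hc
  set s := ‖U.wderiv 4‖ with hs
  have hs0 : 0 ≤ s := norm_nonneg _
  -- The remainder will be bounded by `ε‖W‖` times `s` from `∂ₓ⁴U`, one from `∂ₓ⁴W` and one from the
  -- lower order part.
  set ε := c / (s + 2) with hε
  have hε0 : 0 < ε := by positivity
  obtain ⟨M, hM⟩ := isCompact_Icc.exists_bound_of_continuousOn
    (f := fun x => fderiv ℝ bendingTensor (U.rep 1 x)) (continuousOn_fderiv_bendingTensor hU)
  have hM0 : 0 ≤ M := (norm_nonneg _).trans (hM 0 zero_mem_I)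
  obtain ⟨ρ, hρ, hreg⟩ := exists_ball_rep_one_ne_zero (by omega) hU
  obtain ⟨δ₁, hδ₁, h1⟩ := exists_uniform_fderiv (F := bendingTensor)
    (U.rep_continuous (j := 1) (by omega)).continuousOn
    (fun x hx => (contDiffAt_bendingTensor (hU x hx)).of_le (by exact_mod_cast le_top)) hε0
  obtain ⟨δ₂, hδ₂, h2⟩ := exists_uniform_fderiv (continuousOn_rep_triple U)
    (fun x hx => (contDiffAt_eulerLagrangeLower (z := (U.rep 1 x, U.rep 2 x, U.rep 3 x))
      (hU x hx)).of_le (by exact_mod_cast le_top)) hε0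
  -- Below this radius the term quadratic in `W`, bounded by `(ε + M)‖W‖ ‖∂ₓ⁴W‖`, is at most `ε‖W‖`.
  have hδ₃ : 0 < ε / (ε + M) := by positivity
  filter_upwards [Metric.ball_mem_nhds (0 : Sobolev d 4)
    (lt_min (lt_min hρ hδ₃) (lt_min hδ₁ hδ₂))] with W hW
  simp only [mem_ball_zero_iff, lt_min_iff] at hW
  obtain ⟨⟨hWρ, hW3⟩, hW1, hW2⟩ := hW
  have hW3' : (ε + M) * ‖W‖ ≤ ε := by
    rw [lt_div_iff₀ (by positivity)] at hW3
    linarith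
  have key := L2.norm_le_of_ae_le_add (u := sobolevGradient (U + W) - sobolevGradient U -
      ((mulL fun x => bendingTensor (U.rep 1 x)).comp (Sobolev.wderivL d 4 4) + R) W)
    (v := U.wderiv 4) (w := W.wderiv 4) (α := ε * ‖W‖) (β := (ε + M) * ‖W‖) (γ := ε * ‖W‖)
    (by positivity) (by positivity) (by positivity) ?_
  · refine key.trans ?_
    have h3 := W.norm_wderiv_le 4
    have h4 : (ε + M) * ‖W‖ * ‖W.wderiv 4‖ ≤ ε * ‖W‖ :=
      mul_le_mul hW3' h3 (norm_nonneg _) hε0.le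
    have h5 : c = ε * (s + 2) := by rw [hε]; field_simp
    rw [h5]
    linarith
  · filter_upwards [Lp.coeFn_sub (sobolevGradient (U + W) - sobolevGradient U)
        (((mulL fun x => bendingTensor (U.rep 1 x)).comp (Sobolev.wderivL d 4 4) + R) W),
      Lp.coeFn_sub (sobolevGradient (U + W)) (sobolevGradient U),
      Lp.coeFn_add ((mulL fun x => bendingTensor (U.rep 1 x)) (W.wderiv 4)) (R W),
      sobolevGradient_ae_eq (hreg W hWρ), sobolevGradient_ae_eq hU, hRW W,
      mulL_ae_eq (continuousOn_bendingTensor_rep hU) (W.wderiv 4), W.rep_ae_eq 4, U.rep_ae_eq 4,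
      (U + W).rep_ae_eq 4, Lp.coeFn_add (U.wderiv 4) (W.wderiv 4),
      ae_restrict_mem measurableSet_Icc] with x e1 e2 e3 e4 e5 e6 e7 e8 e9 e10 e11 hx
    have e12 : (U + W).rep 4 x = U.rep 4 x + W.rep 4 x := by
      have : (U + W).rep 4 x = (U.wderiv 4 + W.wderiv 4 : L2 d) x := e10
      rw [this, e11, Pi.add_apply, ← e8, ← e9]
      rfl
    have hn : ∀ j < 4, ‖W.rep j x‖ ≤ ‖W‖ := fun j hj => W.norm_rep_le hj hx
    have hn3 : ‖(W.rep 1 x, W.rep 2 x, W.rep 3 x)‖ ≤ ‖W‖ :=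
      max_le (hn 1 (by omega)) (max_le (hn 2 (by omega)) (hn 3 (by omega)))
    have b1 := h1 x hx (W.rep 1 x) ((hn 1 (by omega)).trans_lt hW1)
    have b2 := h2 x hx _ (hn3.trans_lt hW2)
    set T := bendingTensor (U.rep 1 x + W.rep 1 x) - bendingTensor (U.rep 1 x) -
      fderiv ℝ bendingTensor (U.rep 1 x) (W.rep 1 x) with hT
    have b1' : ‖T‖ ≤ ε * ‖W‖ := b1.trans (mul_le_mul_of_nonneg_left (hn 1 (by omega)) hε0.le)
    have b2' := b2.trans (mul_le_mul_of_nonneg_left hn3 hε0.le)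
    have b3 : ‖T + fderiv ℝ bendingTensor (U.rep 1 x) (W.rep 1 x)‖ ≤ (ε + M) * ‖W‖ := by
      refine (norm_add_le _ _).trans ?_
      have := ContinuousLinearMap.le_of_opNorm_le_of_le _ (hM x hx) (hn 1 (by omega))
      linarith
    -- `T` is the first-order Taylor remainder of the bending tensor. It acts on `∂ₓ⁴U`, the full
    -- increment of the tensor acts on `∂ₓ⁴W`, and the last bracket is the Taylor remainder of the
    -- lower order part.
    have hsplit : (sobolevGradient (U + W) - sobolevGradient U -
        ((mulL fun x => bendingTensor (U.rep 1 x)).comp (Sobolev.wderivL d 4 4) + R) W : L2 d) x =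
        T (U.rep 4 x) + (T + fderiv ℝ bendingTensor (U.rep 1 x) (W.rep 1 x)) (W.rep 4 x) +
        (eulerLagrangeLower ((U.rep 1 x, U.rep 2 x, U.rep 3 x) + (W.rep 1 x, W.rep 2 x, W.rep 3 x)) -
          eulerLagrangeLower (U.rep 1 x, U.rep 2 x, U.rep 3 x) -
          fderiv ℝ eulerLagrangeLower (U.rep 1 x, U.rep 2 x, U.rep 3 x)
            (W.rep 1 x, W.rep 2 x, W.rep 3 x)) := by
      have e3' : (((mulL fun x => bendingTensor (U.rep 1 x)).comp (Sobolev.wderivL d 4 4) + R) W :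
          L2 d) x = bendingTensor (U.rep 1 x) (W.rep 4 x) + R W x := by
        refine e3.trans ?_
        rw [Pi.add_apply, e7, ← e8]
        rfl
      rw [e1, Pi.sub_apply, e2, Pi.sub_apply, e3', e4, e5, e6, eulerLagrange, eulerLagrange, e12,
        U.rep_add W (by omega) x hx, U.rep_add W (by omega) x hx, U.rep_add W (by omega) x hx, hT]
      simp only [map_add, add_apply, sub_apply, Prod.mk_add_mk]
      abel
    rw [hsplit]
    have e8' : (W.wderiv 4) x = W.rep 4 x := e8.symm
    have e9' : (U.wderiv 4) x = U.rep 4 x := e9.symm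
    rw [e8', e9']
    refine (norm_add_le _ _).trans (add_le_add ((norm_add_le _ _).trans (add_le_add ?_ ?_)) b2')
    · exact T.le_of_opNorm_le b1' _
    · exact ContinuousLinearMap.le_of_opNorm_le _ b3 _

variable {F : Sobolev d 5} (hne : ∀ x ∈ Icc (0 : ℝ) 1, F.rep 1 x ≠ 0)

theorem exists_hasFDerivAt_normalGradient : ∃ R : Sobolev d 4 →L[ℝ] L2 d, IsCompactOperator R ∧
    HasFDerivAt (normalGradient hne) (normalPart hne (leadingOp F + R)) 0 := by
  have hU := truncation_rep_one_ne_zero hne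
  obtain ⟨R, hR, hD⟩ := exists_hasFDerivAt_sobolevGradient hU
  refine ⟨R, hR, ?_⟩
  have hlead : (mulL fun x => bendingTensor ((truncation F).rep 1 x)).comp
      (Sobolev.wderivL d 4 4) = leadingOp F := by
    refine ContinuousLinearMap.ext fun W => Lp.ext ?_
    filter_upwards [mulL_ae_eq (continuousOn_bendingTensor_rep hU) (W.wderiv 4),
      leadingOp_ae_eq hne W, W.rep_ae_eq 4, ae_restrict_mem measurableSet_Icc] with x h1 h2 h3 hx
    rw [h2]
    refine h1.trans ?_
    rw [truncation_rep F (by omega) x hx, ← h3]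
    rfl
  rw [hlead] at hD
  have h1 : HasFDerivAt (fun ψ : H4cPerp (curve F) => truncation F + ψ.1)
      (H4cPerp (curve F)).subtypeL 0 := (H4cPerp (curve F)).subtypeL.hasFDerivAt.const_add _
  have h0 : truncation F = truncation F + (0 : H4cPerp (curve F)).1 := (add_zero _).symm
  rw [h0] at hD
  exact (projL2Perp hne).hasFDerivAt.comp 0 (HasFDerivAt.comp (0 : H4cPerp (curve F)) hD h1)

theorem IsL2Gradient.hasFDerivAt {ρ : ℝ} (hρ : IsAdmissibleRadius (curve F) ρ)
    {G : H4cPerp (curve F) → L2Perp (curve F)} (hG : IsL2Gradient (curve F) ρ G)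
    {T : H4cPerp (curve F) →L[ℝ] L2Perp (curve F)} (hT : HasFDerivAt (normalGradient hne) T 0) :
    HasFDerivAt G T 0 :=
  hT.congr_of_eventuallyEq (by
    filter_upwards [Metric.ball_mem_nhds (0 : H4cPerp (curve F)) hρ.1] with φ hφ
    exact hG.eq_normalGradient hne hρ φ hφ)

end Linearization

end ElasticCurve

namespace ElasticCurve

/-! ### The fourth normal derivative -/

section FourthNormalDerivative

variable {d : ℕ} {F : Sobolev d 5}

/-- The symbol of the normal derivative along a curve. -/
def normalDerivAlong (F : Sobolev d 5) :
    ℝ → EuclideanSpace ℝ (Fin d) →L[ℝ] EuclideanSpace ℝ (Fin d) :=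
  fun x => normalDerivSymbol (F.rep 1 x)

/-- On an absolutely continuous representative the normal derivative is a first-order operator with
matrix coefficient `N`. Carrying representatives along allows the iteration of `normalDeriv`. -/
theorem normalDeriv_ae_eq {ψ u u' : ℝ → EuclideanSpace ℝ (Fin d)} (hψ : u =ᵐ[muI] ψ)
    (hu : IsPrimitive u u') :
    normalDeriv (curve F) ψ =ᵐ[muI] fun x => normalDerivAlong F x (u' x) := by
  filter_upwards [weakDeriv_curve F,
    (hu.hasWeakDeriv.congr hψ (EventuallyEq.refl _ _)).weakDeriv_ae_eq] with x h1 h2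
  rw [normalDeriv, arcDeriv, arcDeriv, h1, h2, normalDerivAlong, normalDerivSymbol, smul_apply,
    normalProj_apply, smul_sub, smul_smul, smul_smul, real_inner_smul_left, real_inner_smul_right,
    real_inner_comm]
  congr 2
  ring

theorem normalProj_normalDerivSymbol {p : EuclideanSpace ℝ (Fin d)} (hp : p ≠ 0)
    (v : EuclideanSpace ℝ (Fin d)) :
    normalProj p (normalDerivSymbol p v) = normalDerivSymbol p v := by
  rw [normalDerivSymbol, smul_apply, map_smul, normalProj_normalProj hp]

/-- Idempotence of `P` reduces the left side to `|p|·|p|⁻⁴P`. This identifies the principal symbols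
of `|∂ₓf|∇⁴` and of the linearization. -/
theorem norm_smul_normalDerivSymbol_four {p : EuclideanSpace ℝ (Fin d)} (hp : p ≠ 0)
    (v : EuclideanSpace ℝ (Fin d)) :
    ‖p‖ • normalDerivSymbol p (normalDerivSymbol p (normalDerivSymbol p (normalDerivSymbol p v))) =
      bendingTensor p v := by
  have h : ‖p‖ ≠ 0 := norm_ne_zero_iff.mpr hp
  simp only [normalDerivSymbol, bendingTensor, smul_apply, map_smul, normalProj_normalProj hp,
    smul_smul]
  congr 1
  field_simp

variable (hne : ∀ x ∈ Icc (0 : ℝ) 1, F.rep 1 x ≠ 0)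

include hne in
theorem smoothOnI_normalDerivAlong : SmoothOnI 3 (normalDerivAlong F) :=
  smoothOnI_comp_tangent hne fun _ hp => contDiffAt_normalDerivSymbol hp

include hne in
/-- The fourth normal derivative as a linear differential operator. -/
theorem exists_iterate_normalDeriv_four :
    ∃ c : Fin 3 → ℝ → EuclideanSpace ℝ (Fin d) →L[ℝ] EuclideanSpace ℝ (Fin d),
      (∀ i, ContinuousOn (c i) (Icc 0 1)) ∧ ∀ φ : H4cPerp (curve F),
        (normalDeriv (curve F))^[4] (H4cPerp.field φ) =ᵐ[muI] fun x => normalDerivAlong F x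
          (c 0 x (φ.1.rep 1 x) + c 1 x (φ.1.rep 2 x) + c 2 x (φ.1.rep 3 x) +
            normalDerivAlong F x (normalDerivAlong F x (normalDerivAlong F x (φ.1.rep 4 x)))) := by
  set N := normalDerivAlong F with hN
  have hN3 : SmoothOnI 3 N := smoothOnI_normalDerivAlong hne
  -- The coefficients come from iterating `N∂ₓ`: `∇²φ = pφ' + qφ''` and `∇³φ = aφ' + bφ'' + eφ'''`.
  -- Since `N` is `C³`, `p` is `C²` and `a` is `C¹`, just enough for the fourth step.
  set p : ℝ → EuclideanSpace ℝ (Fin d) →L[ℝ] EuclideanSpace ℝ (Fin d) :=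
    fun x => (N x).comp (deriv N x) with hp
  have hp2 : SmoothOnI 2 p := (hN3.mono (by omega)).comp_clm hN3.deriv
  set q : ℝ → EuclideanSpace ℝ (Fin d) →L[ℝ] EuclideanSpace ℝ (Fin d) :=
    fun x => (N x).comp (N x) with hq
  have hq3 : SmoothOnI 3 q := hN3.comp_clm hN3
  set a : ℝ → EuclideanSpace ℝ (Fin d) →L[ℝ] EuclideanSpace ℝ (Fin d) :=
    fun x => (N x).comp (deriv p x) with ha
  have ha1 : SmoothOnI 1 a := (hN3.mono (by omega)).comp_clm hp2.deriv
  set b : ℝ → EuclideanSpace ℝ (Fin d) →L[ℝ] EuclideanSpace ℝ (Fin d) :=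
    fun x => (N x).comp (p x + deriv q x) with hb
  have hb2 : SmoothOnI 2 b := (hN3.mono (by omega)).comp_clm (hp2.add hq3.deriv)
  set e : ℝ → EuclideanSpace ℝ (Fin d) →L[ℝ] EuclideanSpace ℝ (Fin d) :=
    fun x => (N x).comp (q x) with he
  have he3 : SmoothOnI 3 e := hN3.comp_clm hq3
  refine ⟨![fun x => deriv a x, fun x => a x + deriv b x, fun x => b x + deriv e x], ?_,
    fun φ => ?_⟩
  · intro i
    fin_cases i
    · exact ha1.deriv.continuousOn
    · exact ha1.continuousOn.add hb2.deriv.continuousOn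
    · exact hb2.continuousOn.add he3.deriv.continuousOn
  · have hφ : ∀ j < 4, IsPrimitive (φ.1.rep j) (φ.1.rep (j + 1)) := fun j hj =>
      φ.1.rep_isPrimitive hj
    have s1 := normalDeriv_ae_eq (F := F) φ.1.rep_zero_ae_eq (hφ 0 (by omega))
    have s2 := normalDeriv_ae_eq (F := F) s1.symm
      (IsPrimitive.clm_apply hN3.hasDerivAt hN3.deriv.continuousOn (hφ 1 (by omega)))
    have s2' : normalDeriv (curve F) (normalDeriv (curve F) (H4cPerp.field φ)) =ᵐ[muI]
        fun x => p x (φ.1.rep 1 x) + q x (φ.1.rep 2 x) := by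
      filter_upwards [s2] with x hx
      refine hx.trans ?_
      rw [map_add]
      rfl
    have s3 := normalDeriv_ae_eq (F := F) s2'.symm
      ((IsPrimitive.clm_apply hp2.hasDerivAt hp2.deriv.continuousOn (hφ 1 (by omega))).add
      (IsPrimitive.clm_apply hq3.hasDerivAt hq3.deriv.continuousOn (hφ 2 (by omega))))
    have s3' : normalDeriv (curve F) (normalDeriv (curve F) (normalDeriv (curve F)
        (H4cPerp.field φ))) =ᵐ[muI]
        fun x => a x (φ.1.rep 1 x) + b x (φ.1.rep 2 x) + e x (φ.1.rep 3 x) := by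
      filter_upwards [s3] with x hx
      refine hx.trans ?_
      simp only [ha, hb, he, ContinuousLinearMap.comp_apply, add_apply, map_add]
      abel
    have s4 := normalDeriv_ae_eq (F := F) s3'.symm
      (((IsPrimitive.clm_apply ha1.hasDerivAt ha1.deriv.continuousOn (hφ 1 (by omega))).add
      (IsPrimitive.clm_apply hb2.hasDerivAt hb2.deriv.continuousOn (hφ 2 (by omega)))).add
      (IsPrimitive.clm_apply he3.hasDerivAt he3.deriv.continuousOn (hφ 3 (by omega))))
    filter_upwards [s4] with x hx
    refine hx.trans ?_
    simp only [he, hq, Matrix.cons_val, ContinuousLinearMap.comp_apply, add_apply, map_add]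
    abel

/-- The operator `φ ↦ |∂ₓ f| ∇⁴ φ` is the leading operator up to terms of lower order. -/
theorem exists_norm_smul_iterate_normalDeriv_four :
    ∃ R : Sobolev d 4 →L[ℝ] L2 d, IsCompactOperator R ∧ ∀ φ : H4cPerp (curve F),
      ((normalPart hne (leadingOp F + R) φ : L2 d) : ℝ → EuclideanSpace ℝ (Fin d)) =ᵐ[muI]
        fun x => ‖weakDeriv (curve F) x‖ • ((normalDeriv (curve F))^[4] (H4cPerp.field φ)) x := by
  obtain ⟨c, hc, h4⟩ := exists_iterate_normalDeriv_four hne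
  have hm : ∀ i, MemLp (fun x => ‖F.rep 1 x‖ • (normalDerivAlong F x).comp (c i x)) 2 muI :=
    fun i => memLp_of_continuousOn ((F.rep_continuous (by omega)).norm.continuousOn.smul
      ((smoothOnI_normalDerivAlong hne).continuousOn.clm_comp (hc i)))
  set T : Fin 3 → Fin 4 → Sobolev d 4 →L[ℝ] L2 d := fun i j =>
    lowerOp (fun x => ‖F.rep 1 x‖ • (normalDerivAlong F x).comp (c i x)) j with hT
  refine ⟨T 0 1 + T 1 2 + T 2 3, ?_, fun φ => ?_⟩
  · exact ((isCompactOperator_lowerOp _ _).add (isCompactOperator_lowerOp _ _)).add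
      (isCompactOperator_lowerOp _ _)
  · filter_upwards [normalPart_ae_eq hne (leadingOp F + (T 0 1 + T 1 2 + T 2 3)) φ, h4 φ,
      leadingOp_ae_eq hne φ.1, lowerOp_ae_eq (hm 0) 1 φ.1, lowerOp_ae_eq (hm 1) 2 φ.1,
      lowerOp_ae_eq (hm 2) 3 φ.1,
      Lp.coeFn_add (leadingOp F φ.1) (T 0 1 φ.1 + T 1 2 φ.1 + T 2 3 φ.1),
      Lp.coeFn_add (T 0 1 φ.1 + T 1 2 φ.1) (T 2 3 φ.1), Lp.coeFn_add (T 0 1 φ.1) (T 1 2 φ.1),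
      weakDeriv_curve F, ae_restrict_mem measurableSet_Icc] with
      x e1 e2 e3 e4 e5 e6 e7 e8 e9 e10 hx
    rw [e1, e2, e10]
    simp only [add_apply]
    rw [e7, Pi.add_apply, e8, Pi.add_apply, e9, Pi.add_apply, e3, e4, e5, e6,
      ← norm_smul_normalDerivSymbol_four (hne x hx)]
    -- The outermost factor `N` takes normal values, so the projection in `normalPart` acts
    -- trivially.
    simp only [normalDerivAlong, smul_apply, ContinuousLinearMap.comp_apply, map_add, map_smul,
      normalProj_normalDerivSymbol (hne x hx), smul_add]
    simp only [Fin.val_one, Fin.val_two, Fin.isValue]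
    abel

end FourthNormalDerivative

end ElasticCurve

end

/-! ### Assembly of the main theorem -/

open ElasticCurve in
theorem mainTheorem4 (d : ℕ) (hd : 2 ≤ d) (F : Sobolev d 5)
    (f : ℝ → EuclideanSpace ℝ (Fin d)) (hf : f = Sobolev.toL2 d 5 F)
    (hreg : IsRegularCurve f) :
    (∃ ρ : ℝ, IsAdmissibleRadius f ρ) ∧
    ∀ ρ : ℝ, IsAdmissibleRadius f ρ →
      (∃ dE : H4cPerp f → L2Perp f, IsL2Gradient f ρ dE) ∧
      ∀ dE : H4cPerp f → L2Perp f, IsL2Gradient f ρ dE →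
        ∃ 𝔏 : H4cPerp f →L[ℝ] L2Perp f,
          HasFDerivAt dE 𝔏 0 ∧
          𝔏.IsFredholm ∧ fredholmIndex 𝔏 = 0 ∧
          ∃ A B : H4cPerp f →L[ℝ] L2Perp f,
            (∀ φ : H4cPerp f, ((A φ : L2 d) : ℝ → EuclideanSpace ℝ (Fin d)) =ᵐ[muI]
              fun x => ‖weakDeriv f x‖ • ((normalDeriv f)^[4] (H4cPerp.field φ)) x) ∧
            IsCompactOperator B ∧ 𝔏 = A + B := by
  subst hf
  have hne : ∀ x ∈ Set.Icc (0 : ℝ) 1, F.rep 1 x ≠ 0 :=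
    (isRegularCurve_iff (by omega) F.rep_zero_ae_eq).mp hreg
  refine ⟨exists_isAdmissibleRadius hne, fun ρ hρ =>
    ⟨⟨_, isL2Gradient_normalGradient hne hρ⟩, fun dE hdE => ?_⟩⟩
  obtain ⟨R, hR, hD⟩ := exists_hasFDerivAt_normalGradient hne
  obtain ⟨R', hR', hA⟩ := exists_norm_smul_iterate_normalDeriv_four hne
  obtain ⟨hF, hi⟩ := isFredholm_normalPart_leadingOp_add hne hR
  -- `R` and `R'` are the compact remainders of the linearization and of `|∂ₓf|∇⁴` over the same
  -- leading operator, so `B` is the normal part of `R - R'`.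
  refine ⟨_, hdE.hasFDerivAt hne hρ hD, hF, hi, _, normalPart hne (R - R'), hA,
    isCompactOperator_normalPart hne (hR.sub hR'), ?_⟩
  rw [← normalPart_add]
  congr 1
  abel
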